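/- Let $m,n\ge 1$ be integers. For $\vec y=(y_1,\dots,y_m)\in(\mathbb R^n)^m$ write $|\vec y|=|y_1|+\cdots+|y_m|$ and, for $\vec y\neq0$, $\vec y\,'=\vec y/|\vec y|$. Let $0<\beta<1$ and let $\Omega:(\mathbb R^n)^m\to\mathbb C$ satisfy (i) $\Omega(\lambda\vec y)=\Omega(\vec y)$ for all $\lambda>0$ and all $\vec y$; (ii) for some $C_0>0$, $|\Omega(\xi)-\Omega(\eta)|\le C_0|\xi'-\eta'|^{\beta}$ for all $\xi,\eta\in(\mathbb R^n)^m\setminus\{0\}$; (iii) $\int_{S^{n-1}}\Omega(y_1,\dots,y_m)\,d\sigma(y_j)=0$ for each $j=1,\dots,m$ and all $y_i\in\mathbb R^n$, $i\ne j$, where $\sigma$ is the surface measure. For $\vec f=(f_1,\dots,f_m)$, $f_i:\mathbb R^n\to\mathbb C$, and $t>0$ put $$F_t(\vec f)(x)=\frac1{t^m}\int_{B(0,t)^m}\frac{\Omega(\vec y)}{|\vec y|^{m(n-1)}}\prod_{i=1}^m f_i(x-y_i)\,d\vec y,\qquad \mu(\vec f)(x)=\Bigl(\int_0^\infty|F_t(\vec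 f)(x)|^2\,\frac{dt}t\Bigr)^{1/2}\in[0,\infty].$$ For $1\le p<\infty$ and $-n/p\le\alpha<1$ let $\mathcal E^{\alpha,p}(\mathbb R^n)$ be the Campanato space of locally integrable $f$ with $$\|f\|_{\mathcal E^{\alpha,p}}=\sup_B|B|^{-\alpha/n}\Bigl(\frac1{|B|}\int_B|f(x)-f_B|^p\,dx\Bigr)^{1/p}<\infty,\qquad f_B=\frac1{|B|}\int_B f(x)\,dx,$$ the supremum being over all balls $B\subset\mathbb R^n$. **Theorem.** Suppose that $\mu$ is bounded from $L^{q_1}\times\cdots\times L^{q_m}$ to $L^q$ for some $1<q_1,\dots,q_m<\infty$ with $1/q=1/q_1+\cdots+1/q_m$. Let $1<p_1,\dots,p_m<\infty$, $1/p=1/p_1+\cdots+1/p_m$, let $-n/p_j\le\alpha_j<1$ for $j=1,\dots,m$, and let $\alpha=\alpha_1+\cdots+\alpha_m<0$. Suppose that either $\alpha_1,\dots,\alpha_m<0$ and $n<p<\infty$, or $-m<\alpha<0$ and $1<p<\infty$. Then there is a constant $C$, independent of $\vec f$, such that for all $f_j\in\mathcal E^{\alpha_j,p_j}(\mathbb R^n)$,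 $j=1,\dots,m$: for almost every $x$ the integrals defining $F_t(\vec f)(x)$ converge absolutely for all $t>0$; $\mu(\vec f)$ is either infinite everywhere or finite almost everywhere; and in the latter case $\mu(\vec f)\in\mathcal E^{\alpha,p}(\mathbb R^n)$ and $$\|\mu(\vec f)\|_{\mathcal E^{\alpha,p}}\le C\prod_{j=1}^m\|f_j\|_{\mathcal E^{\alpha_j,p_j}}.$$ -/

import Mathlib

open MeasureTheory Metric Set
open scoped ENNReal NNReal

noncomputable section

namespace MultilinearMarcinkiewicz

/-- The Euclidean space `ℝⁿ`. -/
abbrev Rn (n : ℕ) : Type := EuclideanSpace ℝ (Fin n)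

/-- `|y| = |y₁| + ⋯ + |yₘ|` for `y = (y₁, …, yₘ) ∈ (ℝⁿ)ᵐ`. -/
def sumNorm {n m : ℕ} (y : Fin m → Rn n) : ℝ := ∑ i, ‖y i‖

/-- `y' = y / (|y₁| + ⋯ + |yₘ|)` for `y ≠ 0`. -/
def normalized {n m : ℕ} (y : Fin m → Rn n) : Fin m → Rn n := (sumNorm y)⁻¹ • y

/-- The conditions on `Ω`: homogeneity of degree `0`, the Lipschitz condition of index `β`,
and vanishing of the integral over the unit sphere in each variable `y_j`
(with respect to surface measure, the other variables being arbitrary points of `ℝⁿ`). -/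
structure IsKernel {n m : ℕ} (Ω : (Fin m → Rn n) → ℂ) (β : ℝ) : Prop where
  homogeneous : ∀ s : ℝ, 0 < s → ∀ y : Fin m → Rn n, Ω (s • y) = Ω y
  lipschitz : ∃ C : ℝ, 0 < C ∧ ∀ ξ η : Fin m → Rn n, ξ ≠ 0 → η ≠ 0 →
    ‖Ω ξ - Ω η‖ ≤ C * sumNorm (normalized ξ - normalized η) ^ β
  vanishing : ∀ (j : Fin m) (y : Fin m → Rn n),
    ∫ θ : sphere (0 : Rn n) 1, Ω (Function.update y j (θ : Rn n))
      ∂((volume : Measure (Rn n)).toSphere) = 0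

/-- The product of closed balls `B(0, t)ᵐ`. -/
def ballPow (n m : ℕ) (t : ℝ) : Set (Fin m → Rn n) :=
  {y | ∀ i, y i ∈ closedBall (0 : Rn n) t}

/-- The integrand `Ω(y) / |y|^{m(n-1)} ∏ fᵢ(x - yᵢ)`. -/
def integrand {n m : ℕ} (Ω : (Fin m → Rn n) → ℂ) (f : Fin m → Rn n → ℂ) (x : Rn n)
    (y : Fin m → Rn n) : ℂ :=
  Ω y / ((sumNorm y ^ (m * (n - 1)) : ℝ) : ℂ) * ∏ i, f i (x - y i)

/-- `F_t(f)(x) = t^{-m} ∫_{B(0,t)^m} Ω(y) / |y|^{m(n-1)} ∏ fᵢ(x - yᵢ) dy`. -/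
def F {n m : ℕ} (Ω : (Fin m → Rn n) → ℂ) (t : ℝ) (f : Fin m → Rn n → ℂ) (x : Rn n) : ℂ :=
  (((t ^ m)⁻¹ : ℝ) : ℂ) * ∫ y in ballPow n m t, integrand Ω f x y

/-- The multilinear Marcinkiewicz integral `μ(f)(x) = (∫₀^∞ |F_t(f)(x)|² dt/t)^{1/2}`,
with values in `[0, ∞]`. -/
def marcinkiewicz {n m : ℕ} (Ω : (Fin m → Rn n) → ℂ) (f : Fin m → Rn n → ℂ) (x : Rn n) :
    ℝ≥0∞ :=
  (∫⁻ t in Ioi (0 : ℝ), ‖F Ω t f x‖ₑ ^ 2 / ENNReal.ofReal t) ^ (1 / 2 : ℝ)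

/-- `μ` is bounded from `L^{q₁} × ⋯ × L^{qₘ}` to `L^q`. -/
def IsBoundedOnLp {n m : ℕ} (Ω : (Fin m → Rn n) → ℂ) (qs : Fin m → ℝ) (q : ℝ) : Prop :=
  ∃ K : ℝ≥0, ∀ f : Fin m → Rn n → ℂ, (∀ i, MemLp (f i) (ENNReal.ofReal (qs i)) volume) →
    eLpNorm (marcinkiewicz Ω f) (ENNReal.ofReal q) volume
      ≤ K * ∏ i, eLpNorm (f i) (ENNReal.ofReal (qs i)) volume

/-- The Campanato norm
`sup_B |B|^{-α/n} (|B|⁻¹ ∫_B |f - f_B|^p)^{1/p}`, the supremum being over all balls of `ℝⁿ`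
and `f_B` being the average of `f` over `B`. -/
def campanatoNorm {n : ℕ} {G : Type*} [NormedAddCommGroup G] [NormedSpace ℝ G]
    (α p : ℝ) (f : Rn n → G) : ℝ≥0∞ :=
  ⨆ (c : Rn n) (r : ℝ) (_ : 0 < r),
    volume (closedBall c r) ^ (-(α / n)) *
      ((volume (closedBall c r))⁻¹ *
        ∫⁻ x in closedBall c r, ‖f x - ⨍ z in closedBall c r, f z‖ₑ ^ p) ^ (1 / p)

/-- Membership in the Campanato space `𝓔^{α,p}(ℝⁿ)`. -/
def MemCampanato {n : ℕ} {G : Type*} [NormedAddCommGroup G] [NormedSpace ℝ G]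
    (α p : ℝ) (f : Rn n → G) : Prop :=
  LocallyIntegrable f volume ∧ campanatoNorm α p f < ∞

end MultilinearMarcinkiewicz

end

noncomputable section

namespace MultilinearMarcinkiewicz

/-! Cut the kernel into annuli. Let T_t be the operator whose kernel is t^{-m} Ω(y) |y|^{-m(n-1)}
restricted to t/2 < max |y_i| ≤ t. Then F_t is the sum over k ≥ 0 of 2^{-km} T_{2^{-k} t}
(`hasSum_F`), and conversely T_t = F_t - 2^{-m} F_{t/2}. Since dt/t is invariant under dilations,
μ(f) is comparable to the square function S(f), the L²(dt/t) norm of t ↦ T_t f. The kernel of T_t is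
easier to handle: it lives at scale t, has size t^{-mn}, is Hölder of order β/2 in the L²(dt/t)
sense, and has integral zero in each variable (`exists_isAnnular`).

Because of this cancellation T_t f(x) does not change when constants are subtracted from the f_i,
and these constants may depend on t and x (`annOp_sub_const`). Fix a ball B(c,r) and x in it. For t
> r subtract the averages over B(x,t): then |T_t f(x)| is at most a constant times t^α times the
product of the Campanato norms, and t^α is square integrable for dt/t on (r,∞) because α < 0. For t
≤ r only the values of f on B(c,2r) matter; subtract the averages over that ball, cut off, and apply
an L^p bound for S, which produces r^α again. So the L^p average of μ(f) itself, and not merely its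
oscillation, is O(r^α) on every ball. Hence μ(f) is finite almost everywhere, the Campanato bound
follows, and the alternative "infinite everywhere" never occurs.

What remains is to bound S from the product of the L^{p_j} to L^p, p > 1, knowing a bound for a
single tuple of exponents q_j. A Calderón–Zygmund decomposition first gives a weak type bound on L¹
× ⋯ × L¹ (`exists_volume_sqFn_le`): the good part uses the hypothesis at q, and the terms with a
cancelling entry use the regularity of the kernel, away from the points where a maximal function is
large. A sparse-type induction on dyadic cells (`setLIntegral_partialSq_mul_le`) then bounds ∫ S(f)
g by a constant times ∫ ∏ M f_i · M g for truncations of S, uniformly. Duality, Hölder's inequality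
and the maximal theorem finish (`exists_lintegral_sqFn_rpow_le`). -/

/-- The average of `h` over the ball `B(x, r)`, normalised by `rⁿ`. -/
def ballAvg {n : ℕ} (h : Rn n → ℝ≥0∞) (x : Rn n) (r : ℝ) : ℝ≥0∞ :=
  (ENNReal.ofReal r ^ n)⁻¹ * ∫⁻ z in closedBall x r, h z

/-- The centred Hardy–Littlewood maximal function. -/
def maxFn {n : ℕ} (h : Rn n → ℝ≥0∞) (x : Rn n) : ℝ≥0∞ :=
  ⨆ (r : ℝ) (_ : 0 < r), ballAvg h x r

/-- The volume of the unit ball. -/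
def unitVol (n : ℕ) : ℝ≥0∞ := volume (closedBall (0 : Rn n) 1)

/-! ### The Hardy–Littlewood maximal function on ℝⁿ. -/

section Averages

variable {n : ℕ}

lemma unitVol_ne_top : unitVol n ≠ ∞ := measure_closedBall_lt_top.ne

lemma unitVol_ne_zero : unitVol n ≠ 0 :=
  (measure_closedBall_pos volume _ one_pos).ne'

lemma volume_closedBall_eq (x : Rn n) {r : ℝ} (hr : 0 ≤ r) :
    volume (closedBall x r) = ENNReal.ofReal r ^ n * unitVol n := by
  rw [Measure.addHaar_closedBall' volume x hr, ENNReal.ofReal_pow hr]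
  simp [unitVol]

lemma ofReal_pow_ne_zero {r : ℝ} (hr : 0 < r) : ENNReal.ofReal r ^ n ≠ 0 :=
  pow_ne_zero _ (by simpa using hr)

lemma ofReal_pow_ne_top {r : ℝ} : ENNReal.ofReal r ^ n ≠ ∞ :=
  ENNReal.pow_ne_top ENNReal.ofReal_ne_top

lemma setLIntegral_closedBall_eq (h : Rn n → ℝ≥0∞) (x : Rn n) {r : ℝ} (hr : 0 < r) :
    ∫⁻ z in closedBall x r, h z = ENNReal.ofReal r ^ n * ballAvg h x r := by
  rw [ballAvg, ← mul_assoc, ENNReal.mul_inv_cancel (ofReal_pow_ne_zero hr) ofReal_pow_ne_top,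
    one_mul]

lemma ballAvg_le_maxFn (h : Rn n → ℝ≥0∞) (x : Rn n) {r : ℝ} (hr : 0 < r) :
    ballAvg h x r ≤ maxFn h x := le_iSup₂ (f := fun r (_ : 0 < r) => ballAvg h x r) r hr

lemma ballAvg_mono {g h : Rn n → ℝ≥0∞} (hgh : ∀ z, g z ≤ h z) (x : Rn n) (r : ℝ) :
    ballAvg g x r ≤ ballAvg h x r := by
  unfold ballAvg; gcongr; exact hgh _

lemma ballAvg_le_of_subset (h : Rn n → ℝ≥0∞) {x y : Rn n} {r K : ℝ} (hK : 0 < K)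
    (hsub : closedBall x r ⊆ closedBall y (K * r)) :
    ballAvg h x r ≤ ENNReal.ofReal K ^ n * ballAvg h y (K * r) := by
  unfold ballAvg
  rw [ENNReal.ofReal_mul hK.le, mul_pow, ENNReal.mul_inv (Or.inr ofReal_pow_ne_top)
    (Or.inl ofReal_pow_ne_top), ← mul_assoc, ← mul_assoc,
    ENNReal.mul_inv_cancel (ofReal_pow_ne_zero hK) ofReal_pow_ne_top, one_mul]
  gcongr

lemma ballAvg_le_total (h : Rn n → ℝ≥0∞) (x : Rn n) (r : ℝ) :
    ballAvg h x r ≤ (ENNReal.ofReal r ^ n)⁻¹ * ∫⁻ z, h z := by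
  unfold ballAvg; gcongr; exact Measure.restrict_le_self

lemma ballAvg_const (c : ℝ≥0∞) (x : Rn n) {r : ℝ} (hr : 0 < r) :
    ballAvg (fun _ => c) x r = c * unitVol n := by
  rw [ballAvg, setLIntegral_const, volume_closedBall_eq x hr.le, mul_left_comm, ← mul_assoc,
    ← mul_assoc, mul_assoc c, ENNReal.inv_mul_cancel (ofReal_pow_ne_zero hr) ofReal_pow_ne_top]
  simp

lemma ballAvg_add {g h : Rn n → ℝ≥0∞} (hg : Measurable g) (x : Rn n) (r : ℝ) :
    ballAvg (fun z => g z + h z) x r = ballAvg g x r + ballAvg h x r := by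
  unfold ballAvg
  rw [lintegral_add_left hg, mul_add]

/-- If the average over B(x,r) exceeds `lam`, a slightly larger radius still works, and that larger
ball, centred at any y near x, contains B(x,r). No measurability of `h` is needed. -/
lemma lowerSemicontinuous_maxFn (h : Rn n → ℝ≥0∞) (lam : ℝ≥0∞) :
    IsOpen {x | lam < maxFn h x} := by
  rw [isOpen_iff_mem_nhds]
  intro x hx
  simp only [mem_ofPred_eq, maxFn, lt_iSup_iff] at hx
  obtain ⟨r, hr, hlt⟩ := hx
  have hI : lam * ENNReal.ofReal r ^ n < ∫⁻ z in closedBall x r, h z := by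
    rw [setLIntegral_closedBall_eq h x hr, mul_comm lam]
    exact ENNReal.mul_lt_mul_right (ofReal_pow_ne_zero hr) ofReal_pow_ne_top hlt
  have hc : Filter.Tendsto (fun d : ℝ => lam * ENNReal.ofReal (r + d) ^ n) (nhds 0)
      (nhds (lam * ENNReal.ofReal (r + 0) ^ n)) := by
    refine ENNReal.Tendsto.const_mul ?_ (Or.inr (ENNReal.lt_top_of_mul_ne_top_left
      (ne_top_of_lt hI) (ofReal_pow_ne_zero hr)).ne)
    exact ((ENNReal.continuous_pow n).comp
      (ENNReal.continuous_ofReal.comp (continuous_const.add continuous_id))).tendsto 0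
  rw [add_zero] at hc
  have hev := hc.eventually (gt_mem_nhds hI)
  obtain ⟨d, hd, hdlt⟩ := Metric.eventually_nhds_iff.1 hev
  refine Metric.mem_nhds_iff.2 ⟨d / 2, by positivity, fun y hy => ?_⟩
  have hrd : 0 < r + d / 2 := by positivity
  have h1 := @hdlt (d / 2) (by simp [abs_of_pos hd]; linarith)
  simp only [mem_ofPred_eq, maxFn, lt_iSup_iff]
  refine ⟨r + d / 2, hrd, ?_⟩
  have h2 : lam * ENNReal.ofReal (r + d / 2) ^ n < ∫⁻ z in closedBall y (r + d / 2), h z := by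
    refine h1.trans_le (lintegral_mono_set fun z hz => ?_)
    rw [mem_closedBall] at hz ⊢
    have := dist_triangle z x y
    rw [mem_ball, dist_comm] at hy
    linarith
  rw [setLIntegral_closedBall_eq h y hrd, mul_comm lam] at h2
  exact lt_of_mul_lt_mul_left' h2

lemma measurable_maxFn (h : Rn n → ℝ≥0∞) : Measurable (maxFn h) :=
  measurable_of_Ioi fun lam => (lowerSemicontinuous_maxFn h lam).measurableSet

/-- Vitali covering with enlargement factor 5, applied to all balls whose average exceeds `lam`; the
selected balls are disjoint, so their integrals add up to at most the total integral. -/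
lemma maxFn_weak [NeZero n] (h : Rn n → ℝ≥0∞) {lam : ℝ≥0∞} (h0 : lam ≠ 0) (htop : lam ≠ ∞) :
    volume {x | lam < maxFn h x} ≤ 5 ^ n * unitVol n * (lam⁻¹ * ∫⁻ z, h z) := by
  have hn : n ≠ 0 := NeZero.ne n
  by_cases hfin : ∫⁻ z, h z = ∞
  · rw [hfin, ENNReal.mul_top (by simpa using htop), ENNReal.mul_top]
    · exact le_top
    · exact mul_ne_zero (by simp) unitVol_ne_zero
  set t : Set (Rn n × ℝ) := {a | 0 < a.2 ∧ lam < ballAvg h a.1 a.2} with ht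
  have hkey : ∀ a ∈ t, ENNReal.ofReal a.2 ^ n ≤ lam⁻¹ * ∫⁻ z in closedBall a.1 a.2, h z := by
    rintro ⟨x, r⟩ ⟨hr, hlt⟩
    simp only at hr hlt ⊢
    rw [setLIntegral_closedBall_eq h x hr, mul_left_comm]
    conv_lhs => rw [← mul_one (ENNReal.ofReal r ^ n)]
    gcongr
    rw [← ENNReal.inv_mul_cancel h0 htop]
    gcongr
  -- Vitali needs bounded radii. An admissible ball satisfies rⁿ ≤ lam⁻¹ ∫ h, and r ≤ rⁿ as soon as
  -- r > 1.
  set R : ℝ := max 1 ((lam⁻¹ * ∫⁻ z, h z).toReal) with hR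
  have hfin' : lam⁻¹ * ∫⁻ z, h z ≠ ∞ := ENNReal.mul_ne_top (by simpa using h0) hfin
  have hbd : ∀ a ∈ t, a.2 ≤ R := by
    intro a ha
    by_contra! hlt
    have h1 : 1 < a.2 := (le_max_left _ _).trans_lt hlt
    have h2 : (lam⁻¹ * ∫⁻ z, h z).toReal < a.2 := (le_max_right _ _).trans_lt hlt
    have h3 : a.2 ≤ a.2 ^ n := le_self_pow₀ h1.le hn
    have h4 : ENNReal.ofReal a.2 ^ n ≤ lam⁻¹ * ∫⁻ z, h z :=
      (hkey a ha).trans (by gcongr; exact Measure.restrict_le_self)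
    rw [← ENNReal.ofReal_pow ha.1.le, ENNReal.ofReal_le_iff_le_toReal hfin'] at h4
    linarith
  obtain ⟨u, hut, hdisj, hcov⟩ := Vitali.exists_disjoint_subfamily_covering_enlargement_closedBall
    t (fun a => a.1) (fun a => a.2) R hbd 5 (by norm_num)
  have hucount : u.Countable := by
    refine hdisj.countable_of_nonempty_interior fun a ha => ?_
    have := (hut ha).1
    exact ⟨a.1, ball_subset_interior_closedBall (mem_ball_self this)⟩
  have hsub : {x | lam < maxFn h x} ⊆ ⋃ a ∈ u, closedBall a.1 (5 * a.2) := by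
    intro x hx
    simp only [mem_ofPred_eq, maxFn, lt_iSup_iff] at hx
    obtain ⟨r, hr, hlt⟩ := hx
    obtain ⟨b, hb, hsub⟩ := hcov (x, r) ⟨hr, hlt⟩
    exact mem_biUnion hb (hsub (mem_closedBall_self hr.le))
  calc volume {x | lam < maxFn h x} ≤ volume (⋃ a ∈ u, closedBall a.1 (5 * a.2)) :=
        measure_mono hsub
    _ ≤ ∑' a : u, volume (closedBall a.1.1 (5 * a.1.2)) := measure_biUnion_le _ hucount _
    _ ≤ ∑' a : u, 5 ^ n * unitVol n * (lam⁻¹ * ∫⁻ z in closedBall a.1.1 a.1.2, h z) := by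
        refine ENNReal.tsum_le_tsum fun a => ?_
        have hr := (hut a.2).1
        rw [volume_closedBall_eq _ (by positivity), ENNReal.ofReal_mul (by norm_num), mul_pow]
        calc ENNReal.ofReal 5 ^ n * ENNReal.ofReal a.1.2 ^ n * unitVol n
            = 5 ^ n * unitVol n * ENNReal.ofReal a.1.2 ^ n := by
              rw [ENNReal.ofReal_ofNat]; ring
          _ ≤ _ := by gcongr; exact hkey _ (hut a.2)
    _ = 5 ^ n * unitVol n * (lam⁻¹ * ∑' a : u, ∫⁻ z in closedBall a.1.1 a.1.2, h z) := by
        rw [ENNReal.tsum_mul_left, ENNReal.tsum_mul_left]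
    _ ≤ 5 ^ n * unitVol n * (lam⁻¹ * ∫⁻ z, h z) := by
        gcongr
        have := hucount.to_subtype
        rw [← lintegral_iUnion (fun a => measurableSet_closedBall)]
        · exact setLIntegral_le_lintegral _ _
        · intro a b hab
          exact hdisj a.2 b.2 (fun h => hab (Subtype.ext h))

/-- The pointwise layer-cake formula p ∫₀^v s^{p-1} ds = v^p, with v = ∞ allowed. It is used with
exponent p for the maximal function and with p - 1 for the truncated function. -/
lemma lintegral_rpow_indicator {p : ℝ} (hp : 0 < p) (v : ℝ≥0∞) :
    ENNReal.ofReal p * ∫⁻ s in Ioi (0 : ℝ),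
      {s | ENNReal.ofReal s < v}.indicator (fun s => ENNReal.ofReal (s ^ (p - 1))) s = v ^ p := by
  have hfinite : ∀ w : ℝ, 0 ≤ w → ENNReal.ofReal p * ∫⁻ s in Ioo (0 : ℝ) w,
      ENNReal.ofReal (s ^ (p - 1)) = ENNReal.ofReal w ^ p := by
    intro w hw
    have hint : IntegrableOn (fun s : ℝ => s ^ (p - 1)) (Ioo 0 w) := by
      have := (intervalIntegral.intervalIntegrable_rpow' (a := 0) (b := w) (r := p - 1)
        (by linarith))
      rw [intervalIntegrable_iff_integrableOn_Ioo_of_le hw] at this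
      exact this
    rw [← ofReal_integral_eq_lintegral_ofReal hint
      ((ae_restrict_iff' measurableSet_Ioo).2 (Filter.Eventually.of_forall fun s hs =>
        Real.rpow_nonneg hs.1.le _)), ← integral_Ioc_eq_integral_Ioo,
      ← intervalIntegral.integral_of_le hw, integral_rpow (Or.inl (by linarith)),
      ← ENNReal.ofReal_mul hp.le, ENNReal.ofReal_rpow_of_nonneg hw hp.le]
    congr 1
    rw [sub_add_cancel, Real.zero_rpow hp.ne', sub_zero]
    field_simp
  have hge : ∀ w : ℝ, 0 ≤ w → ENNReal.ofReal w ≤ v → ENNReal.ofReal w ^ p ≤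
      ENNReal.ofReal p * ∫⁻ s in Ioi (0 : ℝ),
      {s | ENNReal.ofReal s < v}.indicator (fun s => ENNReal.ofReal (s ^ (p - 1))) s := by
    intro w hw hwv
    rw [← hfinite w hw, ← lintegral_indicator measurableSet_Ioo,
      ← lintegral_indicator measurableSet_Ioi]
    gcongr with s
    by_cases hs : s ∈ Ioo 0 w
    · have h1 : s ∈ {s | ENNReal.ofReal s < v} :=
        (ENNReal.ofReal_lt_ofReal_iff (hs.1.trans hs.2)).2 hs.2 |>.trans_le hwv
      rw [indicator_of_mem hs, indicator_of_mem (show s ∈ Ioi 0 from hs.1), indicator_of_mem h1]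
    · rw [indicator_of_notMem hs]; exact zero_le
  refine le_antisymm ?_ ?_
  · by_cases hv : v = ∞
    · rw [hv, ENNReal.top_rpow_of_pos hp]; exact le_top
    · rw [← ENNReal.ofReal_toReal hv, ← hfinite _ ENNReal.toReal_nonneg,
        ← lintegral_indicator measurableSet_Ioo, ← lintegral_indicator measurableSet_Ioi]
      gcongr with s
      by_cases hs : s ∈ Ioi (0 : ℝ)
      · rw [indicator_of_mem hs]
        by_cases h1 : s ∈ {s | ENNReal.ofReal s < ENNReal.ofReal v.toReal}
        · have : s ∈ Ioo 0 v.toReal := ⟨hs, (ENNReal.ofReal_lt_ofReal_iff_of_nonneg hs.le).1 h1⟩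
          rw [indicator_of_mem h1, indicator_of_mem this]
        · rw [indicator_of_notMem h1]; exact zero_le
      · rw [indicator_of_notMem hs]; exact zero_le
  · by_cases hv : v = ∞
    · rw [hv, ENNReal.top_rpow_of_pos hp]
      rw [hv] at hge
      refine ENNReal.le_of_forall_nnreal_lt fun r _ => ?_
      have := hge ((r : ℝ) ^ p⁻¹) (by positivity) le_top
      rwa [ENNReal.ofReal_rpow_of_nonneg (by positivity) hp.le, ← Real.rpow_mul (by positivity),
        inv_mul_cancel₀ hp.ne', Real.rpow_one, ENNReal.ofReal_coe_nnreal] at this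
    · have := hge v.toReal ENNReal.toReal_nonneg (ENNReal.ofReal_toReal hv).le
      rwa [ENNReal.ofReal_toReal hv] at this

/-- The maximal function is bounded on `L^p`, `1 < p < ∞`. -/
theorem maxFn_strong [NeZero n] {p : ℝ} (hp : 1 < p) : ∃ C : ℝ≥0, ∀ h : Rn n → ℝ≥0∞,
    Measurable h → ∫⁻ x, maxFn h x ^ p ≤ C * ∫⁻ x, h x ^ p := by
  -- `ballAvg` divides by rⁿ and not by the volume, so the constant lam / K has average exactly lam
  -- / 2; removing the part of h below lam / K therefore costs half of the level.
  set K : ℝ≥0∞ := 2 * unitVol n with hK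
  have hK0 : K ≠ 0 := mul_ne_zero (by simp) unitVol_ne_zero
  have hKt : K ≠ ∞ := ENNReal.mul_ne_top (by simp) unitVol_ne_top
  set W : ℝ≥0∞ := 5 ^ n * unitVol n with hW
  have hWt : W ≠ ∞ := ENNReal.mul_ne_top (by simp) unitVol_ne_top
  set C : ℝ≥0∞ := ENNReal.ofReal p * (W * (2 * ((ENNReal.ofReal (p - 1))⁻¹ * K ^ (p - 1)))) with hC
  have hCt : C ≠ ∞ := by
    refine ENNReal.mul_ne_top ENNReal.ofReal_ne_top (ENNReal.mul_ne_top hWt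
      (ENNReal.mul_ne_top (by simp) (ENNReal.mul_ne_top ?_ ?_)))
    · simpa using hp
    · exact ENNReal.rpow_ne_top_of_nonneg (by linarith) hKt
  refine ⟨C.toNNReal, fun h hh => ?_⟩
  rw [ENNReal.coe_toNNReal hCt]
  have hcut : ∀ s : ℝ, 0 < s → volume {x | ENNReal.ofReal s < maxFn h x} ≤
      W * (2 * ((ENNReal.ofReal s)⁻¹ *
        ∫⁻ z, {z | ENNReal.ofReal s < K * h z}.indicator h z)) := by
    intro s hs
    set lam := ENNReal.ofReal s with hlam
    have hl0 : lam ≠ 0 := by simpa [hlam] using hs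
    have hlt : lam ≠ ∞ := ENNReal.ofReal_ne_top
    set h' : Rn n → ℝ≥0∞ := {z | lam < K * h z}.indicator h with hh'
    have hm : Measurable h' := hh.indicator (measurableSet_lt measurable_const (hh.const_mul K))
    have hle : ∀ z, h z ≤ h' z + lam / K := by
      intro z
      by_cases hz : lam < K * h z
      · rw [hh', indicator_of_mem (show z ∈ {z | lam < K * h z} from hz)]; exact le_self_add
      · refine le_add_left ?_
        rw [ENNReal.le_div_iff_mul_le (Or.inl hK0) (Or.inl hKt), mul_comm]
        exact not_lt.1 hz
    have hsub : {x | lam < maxFn h x} ⊆ {x | lam / 2 < maxFn h' x} := by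
      intro x hx
      simp only [mem_ofPred_eq] at hx ⊢
      by_contra! hcon
      refine absurd hx (not_lt.2 (iSup₂_le fun r hr => ?_))
      calc ballAvg h x r ≤ ballAvg (fun z => h' z + lam / K) x r := ballAvg_mono hle x r
        _ = ballAvg h' x r + lam / K * unitVol n := by
            rw [ballAvg_add hm, ballAvg_const _ _ hr]
        _ ≤ lam / 2 + lam / 2 := by
            gcongr
            · exact (ballAvg_le_maxFn h' x hr).trans hcon
            · rw [hK, ENNReal.div_eq_inv_mul, ENNReal.mul_inv (Or.inl (by simp))
                (Or.inl (by simp)), mul_right_comm, mul_assoc _ _ (unitVol n),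
                ENNReal.inv_mul_cancel unitVol_ne_zero unitVol_ne_top, mul_one,
                ENNReal.div_eq_inv_mul]
        _ = lam := ENNReal.add_halves _
    refine (measure_mono hsub).trans ((maxFn_weak h' (by simpa using hl0)
      (ENNReal.div_ne_top hlt (by simp))).trans ?_)
    rw [ENNReal.inv_div (Or.inl (by simp)) (Or.inl (by simp)), ENNReal.div_eq_inv_mul,
      mul_comm lam⁻¹ 2, mul_assoc 2]
  have hM := measurable_maxFn h
  have e1 : ∫⁻ x, maxFn h x ^ p = ENNReal.ofReal p * ∫⁻ s in Ioi (0 : ℝ), ∫⁻ x,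
      {s | ENNReal.ofReal s < maxFn h x}.indicator (fun s => ENNReal.ofReal (s ^ (p - 1))) s := by
    rw [lintegral_lintegral_swap, ← lintegral_const_mul']
    · exact lintegral_congr fun x => (lintegral_rpow_indicator (by linarith) _).symm
    · exact ENNReal.ofReal_ne_top
    · refine Measurable.aemeasurable ?_
      have : MeasurableSet {z : ℝ × Rn n | ENNReal.ofReal z.1 < maxFn h z.2} :=
        measurableSet_lt (by fun_prop) (hM.comp measurable_snd)
      exact (show Measurable fun z : ℝ × Rn n => ENNReal.ofReal (z.1 ^ (p - 1)) by
        fun_prop).indicator this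
  have e2 : ∀ s : ℝ, 0 < s → ∫⁻ x,
      {s | ENNReal.ofReal s < maxFn h x}.indicator (fun s => ENNReal.ofReal (s ^ (p - 1))) s ≤
      W * (2 * ∫⁻ z, {s | ENNReal.ofReal s < K * h z}.indicator
        (fun s => ENNReal.ofReal (s ^ (p - 1 - 1))) s * h z) := by
    intro s hs
    have hs0 : ENNReal.ofReal s ≠ 0 := by simpa using hs
    have h1 : ∫⁻ x, {s | ENNReal.ofReal s < maxFn h x}.indicator
        (fun s => ENNReal.ofReal (s ^ (p - 1))) s =
        ENNReal.ofReal (s ^ (p - 1)) * volume {x | ENNReal.ofReal s < maxFn h x} := by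
      rw [← setLIntegral_const, ← lintegral_indicator (measurableSet_lt measurable_const hM)]
      rfl
    rw [h1]
    refine (mul_le_mul_right (hcut s hs) _).trans (le_of_eq ?_)
    rw [mul_left_comm, mul_left_comm _ 2]
    congr 2
    rw [← mul_assoc, ← lintegral_const_mul']
    · refine lintegral_congr fun z => ?_
      by_cases hz : ENNReal.ofReal s < K * h z
      · rw [indicator_of_mem (show z ∈ {z | ENNReal.ofReal s < K * h z} from hz),
          indicator_of_mem (show s ∈ {s | ENNReal.ofReal s < K * h z} from hz),
          Real.rpow_sub_one hs.ne' (p - 1), ENNReal.ofReal_div_of_pos hs, ENNReal.div_eq_inv_mul,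
          mul_comm (ENNReal.ofReal s)⁻¹]
      · rw [indicator_of_notMem (show z ∉ {z | ENNReal.ofReal s < K * h z} from hz),
          indicator_of_notMem (show s ∉ {s | ENNReal.ofReal s < K * h z} from hz)]
        simp
    · exact ENNReal.mul_ne_top ENNReal.ofReal_ne_top (by simpa using hs)
  rw [e1]
  calc _ ≤ ENNReal.ofReal p * ∫⁻ s in Ioi (0 : ℝ), W * (2 * ∫⁻ z,
        {s | ENNReal.ofReal s < K * h z}.indicator
        (fun s => ENNReal.ofReal (s ^ (p - 1 - 1))) s * h z) := by
        refine mul_le_mul_right ?_ _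
        exact setLIntegral_mono' measurableSet_Ioi fun s hs => e2 s hs
    _ = ENNReal.ofReal p * (W * (2 * ∫⁻ z, (∫⁻ s in Ioi (0 : ℝ),
        {s | ENNReal.ofReal s < K * h z}.indicator
        (fun s => ENNReal.ofReal (s ^ (p - 1 - 1))) s) * h z)) := by
        rw [lintegral_const_mul' _ _ hWt, lintegral_const_mul' _ _ (by simp),
          lintegral_lintegral_swap]
        · congr 3
          refine lintegral_congr fun z => ?_
          rw [lintegral_mul_const]
          exact (show Measurable fun s : ℝ => ENNReal.ofReal (s ^ (p - 1 - 1)) by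
            fun_prop).indicator (measurableSet_lt (by fun_prop) measurable_const)
        · refine Measurable.aemeasurable ?_
          have : MeasurableSet {z : ℝ × Rn n | ENNReal.ofReal z.1 < K * h z.2} :=
            measurableSet_lt (by fun_prop) ((hh.comp measurable_snd).const_mul K)
          exact Measurable.mul ((show Measurable fun z : ℝ × Rn n =>
            ENNReal.ofReal (z.1 ^ (p - 1 - 1)) by fun_prop).indicator this)
            (hh.comp measurable_snd)
    _ = C * ∫⁻ x, h x ^ p := by
        have h3 : ∀ z, (∫⁻ s in Ioi (0 : ℝ), {s | ENNReal.ofReal s < K * h z}.indicator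
            (fun s => ENNReal.ofReal (s ^ (p - 1 - 1))) s) * h z =
            (ENNReal.ofReal (p - 1))⁻¹ * K ^ (p - 1) * h z ^ p := by
          intro z
          have hp1 : ENNReal.ofReal (p - 1) ≠ 0 := by simpa using hp
          have := lintegral_rpow_indicator (p := p - 1) (by linarith) (K * h z)
          rw [ENNReal.mul_rpow_of_nonneg _ _ (by linarith)] at this
          have h4 : h z ^ p = h z ^ (p - 1) * h z := by
            have := ENNReal.rpow_add_of_nonneg (x := h z) (p - 1) 1 (by linarith) zero_le_one
            rwa [sub_add_cancel, ENNReal.rpow_one] at this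
          rw [h4, ← mul_assoc, mul_assoc _ (K ^ (p - 1)), ← this, ← mul_assoc,
            ENNReal.inv_mul_cancel hp1 ENNReal.ofReal_ne_top, one_mul]
        simp_rw [h3]
        rw [lintegral_const_mul _ (hh.pow_const p), hC]
        ring

end Averages

/-! ### Tonelli and Fubini on finite powers. -/

section ProductSpaces

variable {E : Type*} [MeasureSpace E] [SigmaFinite (volume : Measure E)]

lemma lintegral_fin_prod_eq_prod : ∀ {m : ℕ} (h : Fin m → E → ℝ≥0∞), (∀ i, Measurable (h i)) →
    ∫⁻ z : Fin m → E, ∏ i, h i (z i) = ∏ i, ∫⁻ z, h i z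
  | 0, h, _ => by simp [volume_pi]
  | m + 1, h, hh => by
    have hmp := (volume_preserving_piFinSuccAbove (fun _ : Fin (m + 1) => E) 0).symm
    rw [← hmp.lintegral_comp_emb (MeasurableEquiv.measurableEmbedding _), Measure.volume_eq_prod,
      Fin.prod_univ_succ, ← lintegral_fin_prod_eq_prod (fun i => h i.succ) fun i => hh _,
      ← lintegral_prod_mul (hh 0).aemeasurable]
    · refine lintegral_congr fun z => ?_
      rw [Fin.prod_univ_succ]
      simp [MeasurableEquiv.piFinSuccAbove]
    · exact (Finset.measurable_prod _ fun i _ => (hh _).comp (measurable_pi_apply i)).aemeasurable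

lemma setLIntegral_fin_prod_eq_prod {m : ℕ} (h : Fin m → E → ℝ≥0∞) (hh : ∀ i, Measurable (h i))
    (s : Fin m → Set E) (hs : ∀ i, MeasurableSet (s i)) :
    ∫⁻ z in univ.pi s, ∏ i, h i (z i) = ∏ i, ∫⁻ z in s i, h i z := by
  rw [← lintegral_indicator (MeasurableSet.univ_pi hs)]
  simp_rw [← lintegral_indicator (hs _)]
  rw [← lintegral_fin_prod_eq_prod _ fun i => (hh i).indicator (hs i)]
  refine lintegral_congr fun z => ?_
  by_cases hz : z ∈ univ.pi s
  · rw [indicator_of_mem hz]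
    exact Finset.prod_congr rfl fun i _ => (indicator_of_mem (hz i (mem_univ i)) _).symm
  · rw [indicator_of_notMem hz]
    simp only [mem_pi, mem_univ, forall_const, not_forall] at hz
    obtain ⟨i, hi⟩ := hz
    exact (Finset.prod_eq_zero (Finset.mem_univ i) (indicator_of_notMem hi _)).symm

/-- A function on a product space whose integral in one variable always vanishes has integral
zero. -/
lemma integral_eq_zero_of_forall_update {m : ℕ} (j : Fin m) {Φ : (Fin m → E) → ℂ}
    (h0 : ∀ y : Fin m → E, ∫ z, Φ (Function.update y j z) = 0) : ∫ y, Φ y = 0 := by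
  -- For a non-integrable `Φ` the Bochner integral is 0 by convention, so integrability is not
  -- assumed.
  by_cases hint : Integrable Φ
  swap
  · exact integral_undef hint
  cases m with
  | zero => exact j.elim0
  | succ m =>
    have hmp := (volume_preserving_piFinSuccAbove (fun _ : Fin (m + 1) => E) j).symm
    have hint' := (hmp.integrable_comp_emb (MeasurableEquiv.measurableEmbedding _)).2 hint
    rw [← hmp.integral_comp (MeasurableEquiv.measurableEmbedding _), Measure.volume_eq_prod,
      integral_prod_symm _ (by rwa [Measure.volume_eq_prod] at hint')]
    by_cases hE : Nonempty E
    · obtain ⟨e⟩ := hE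
      refine integral_eq_zero_of_ae (Filter.Eventually.of_forall fun y => ?_)
      refine Eq.trans ?_ (h0 (Fin.insertNth j e y))
      refine integral_congr_ae (Filter.Eventually.of_forall fun z => ?_)
      beta_reduce
      rw [Fin.update_insertNth]
      rfl
    · refine integral_eq_zero_of_ae (Filter.Eventually.of_forall fun y => ?_)
      rw [not_nonempty_iff] at hE
      simp [Measure.eq_zero_of_isEmpty]

end ProductSpaces

/-! ### Cauchy–Schwarz and Minkowski in L². -/

section Minkowski

variable {X T : Type*} [MeasurableSpace X] [MeasurableSpace T]

lemma lintegral_mul_sq_le (τ : Measure T) {f g : T → ℝ≥0∞} (hf : AEMeasurable f τ)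
    (hg : AEMeasurable g τ) {a b : ℝ≥0∞} (ha : ∫⁻ t, f t ^ 2 ∂τ ≤ a ^ 2)
    (hb : ∫⁻ t, g t ^ 2 ∂τ ≤ b ^ 2) : ∫⁻ t, f t * g t ∂τ ≤ a * b := by
  have h := ENNReal.lintegral_mul_le_Lp_mul_Lq τ Real.HolderConjugate.two_two hf hg
  simp only [ENNReal.rpow_two] at h
  refine h.trans (mul_le_mul' ?_ ?_)
  · refine (ENNReal.rpow_le_rpow ha (by norm_num)).trans (le_of_eq ?_)
    rw [← ENNReal.rpow_natCast_mul]; norm_num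
  · refine (ENNReal.rpow_le_rpow hb (by norm_num)).trans (le_of_eq ?_)
    rw [← ENNReal.rpow_natCast_mul]; norm_num

/-- Minkowski's integral inequality in `L²`. -/
lemma lintegral_sq_lintegral_le (τ : Measure T) (ν : Measure X) [SFinite τ] [SFinite ν]
    {Φ : T → X → ℝ≥0∞} (hΦ : Measurable (Function.uncurry Φ)) {w : X → ℝ≥0∞} (hw : Measurable w)
    (h : ∀ z, ∫⁻ t, Φ t z ^ 2 ∂τ ≤ w z ^ 2) :
    ∫⁻ t, (∫⁻ z, Φ t z ∂ν) ^ 2 ∂τ ≤ (∫⁻ z, w z ∂ν) ^ 2 := by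
  have hm : ∀ z, Measurable fun t => Φ t z := fun z => hΦ.comp (measurable_id.prodMk measurable_const)
  have hm' : ∀ t, Measurable (Φ t) := fun t => hΦ.comp (measurable_const.prodMk measurable_id)
  have h1 : ∀ (F : X → ℝ≥0∞), Measurable F →
      (∫⁻ z, F z ∂ν) ^ 2 = ∫⁻ z, ∫⁻ z', F z * F z' ∂ν ∂ν := by
    intro F hF
    rw [sq, ← lintegral_mul_const _ hF]
    exact lintegral_congr fun z => (lintegral_const_mul _ hF).symm
  have hΦ3 : Measurable fun a : (T × X) × X => Φ a.1.1 a.1.2 * Φ a.1.1 a.2 :=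
    (hΦ.comp (measurable_fst)).mul
      (hΦ.comp ((measurable_fst.comp measurable_fst).prodMk measurable_snd))
  -- The square is expanded as a double integral in z, z', and Cauchy–Schwarz in t is applied to
  -- each pair; this avoids duality and any finiteness assumption.
  calc ∫⁻ t, (∫⁻ z, Φ t z ∂ν) ^ 2 ∂τ = ∫⁻ t, ∫⁻ z, ∫⁻ z', Φ t z * Φ t z' ∂ν ∂ν ∂τ :=
        lintegral_congr fun t => h1 _ (hm' t)
    _ = ∫⁻ z, ∫⁻ t, ∫⁻ z', Φ t z * Φ t z' ∂ν ∂τ ∂ν :=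
        lintegral_lintegral_swap (Measurable.lintegral_prod_right' (f := fun a : (T × X) × X =>
          Φ a.1.1 a.1.2 * Φ a.1.1 a.2) hΦ3).aemeasurable
    _ = ∫⁻ z, ∫⁻ z', ∫⁻ t, Φ t z * Φ t z' ∂τ ∂ν ∂ν := by
        refine lintegral_congr fun z => lintegral_lintegral_swap ?_
        exact (((hm z).comp measurable_fst).mul hΦ).aemeasurable
    _ ≤ ∫⁻ z, ∫⁻ z', w z * w z' ∂ν ∂ν := by
        gcongr with z z'
        exact lintegral_mul_sq_le τ (hm z).aemeasurable (hm z').aemeasurable (h z) (h z')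
    _ = _ := (h1 _ hw).symm

end Minkowski

/-! ### The dilation invariant measure dt / t and its dyadic blocks. -/

section LogMeasure

/-- The measure `dt / t` on `(0, ∞)`. -/
def logMeasure : Measure ℝ :=
  (volume.restrict (Ioi (0 : ℝ))).withDensity fun t => (ENNReal.ofReal t)⁻¹

instance : SFinite logMeasure := by unfold logMeasure; infer_instance

lemma measurable_ofReal_inv : Measurable fun t : ℝ => (ENNReal.ofReal t)⁻¹ := by fun_prop

lemma lintegral_logMeasure (G : ℝ → ℝ≥0∞) :
    ∫⁻ t, G t ∂logMeasure = ∫⁻ t in Ioi (0 : ℝ), G t / ENNReal.ofReal t := by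
  unfold logMeasure
  rw [lintegral_withDensity_eq_lintegral_mul_non_measurable _ measurable_ofReal_inv]
  · simp only [Pi.mul_apply, ENNReal.div_eq_inv_mul]
  · rw [ae_restrict_iff' measurableSet_Ioi]
    exact Filter.Eventually.of_forall fun t ht => by simpa using ht

lemma setLIntegral_logMeasure (G : ℝ → ℝ≥0∞) {s : Set ℝ} (hs : MeasurableSet s)
    (hs0 : s ⊆ Ioi 0) :
    ∫⁻ t in s, G t ∂logMeasure = ∫⁻ t in s, G t / ENNReal.ofReal t := by
  rw [← lintegral_indicator hs, lintegral_logMeasure, ← lintegral_indicator hs,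
    ← lintegral_indicator measurableSet_Ioi]
  refine lintegral_congr fun t => ?_
  by_cases ht : t ∈ s
  · simp [ht, indicator_of_mem (hs0 ht)]
  · simp [ht]

lemma logMeasure_Iic_zero : logMeasure (Iic 0) = 0 := by
  unfold logMeasure
  rw [withDensity_apply _ measurableSet_Iic, Measure.restrict_restrict measurableSet_Iic,
    Iic_inter_Ioi, Ioc_self]
  simp

lemma ae_logMeasure_pos : ∀ᵐ t ∂logMeasure, 0 < t := by
  rw [ae_iff]
  have : {t : ℝ | ¬0 < t} = Iic 0 := by ext t; simp
  rw [this, logMeasure_Iic_zero]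

lemma lintegral_logMeasure_comp_mul (G : ℝ → ℝ≥0∞) (hG : Measurable G) {c : ℝ} (hc : 0 < c) :
    ∫⁻ t, G (c * t) ∂logMeasure = ∫⁻ t, G t ∂logMeasure := by
  rw [lintegral_logMeasure, lintegral_logMeasure, ← lintegral_indicator measurableSet_Ioi,
    ← lintegral_indicator measurableSet_Ioi]
  have hm : Measurable ((Ioi (0 : ℝ)).indicator fun t => G t / ENNReal.ofReal t) :=
    (hG.div (by fun_prop)).indicator measurableSet_Ioi
  have := lintegral_map (μ := (volume : Measure ℝ)) hm (measurable_const_mul c)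
  rw [Real.map_volume_mul_left hc.ne', lintegral_smul_measure] at this
  have hc' : ENNReal.ofReal |c⁻¹| ≠ 0 := by simpa using hc.ne'
  have e : ∀ t, (Ioi (0 : ℝ)).indicator (fun t => G t / ENNReal.ofReal t) (c * t) =
      ENNReal.ofReal |c⁻¹| * (Ioi (0 : ℝ)).indicator (fun t => G (c * t) / ENNReal.ofReal t) t := by
    intro t
    by_cases ht : 0 < t
    · rw [indicator_of_mem (show c * t ∈ Ioi 0 from mul_pos hc ht),
        indicator_of_mem (show t ∈ Ioi 0 from ht), ENNReal.ofReal_mul hc.le,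
        abs_of_pos (inv_pos.2 hc), ENNReal.ofReal_inv_of_pos hc, ENNReal.div_eq_inv_mul,
        ENNReal.mul_inv (Or.inl (by simpa using hc)) (Or.inl ENNReal.ofReal_ne_top),
        ENNReal.div_eq_inv_mul, mul_assoc]
    · rw [indicator_of_notMem (show t ∉ Ioi 0 from ht),
        indicator_of_notMem (show c * t ∉ Ioi 0 from fun h => ht (pos_of_mul_pos_right h hc.le)),
        mul_zero]
  simp_rw [e] at this
  rw [lintegral_const_mul' _ _ ENNReal.ofReal_ne_top, smul_eq_mul] at this
  exact ((ENNReal.mul_right_inj hc' ENNReal.ofReal_ne_top).1 this).symm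

/-- On t > a the density 1/t is at most 1/a. This measures the set of t for which a sharp cutoff
separates two nearby points. -/
lemma logMeasure_inter_Ioc_le {U : Set ℝ} (hU : MeasurableSet U) {a b : ℝ} (ha : 0 < a) :
    logMeasure (U ∩ Ioc a b) ≤ (ENNReal.ofReal a)⁻¹ * volume U := by
  have h0 : U ∩ Ioc a b ⊆ Ioi 0 := fun t ht => ha.trans ht.2.1
  have hm := hU.inter (measurableSet_Ioc (a := a) (b := b))
  rw [← setLIntegral_one, setLIntegral_logMeasure _ hm h0]
  refine le_trans ?_ (mul_le_mul_right (measure_mono (inter_subset_left (t := Ioc a b))) _)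
  rw [← setLIntegral_const]
  refine setLIntegral_mono' hm fun t ht => ?_
  rw [one_div]
  exact ENNReal.inv_le_inv.2 (ENNReal.ofReal_le_ofReal ht.2.1.le)

lemma logMeasure_Ioc_le {a b : ℝ} (ha : 0 < a) :
    logMeasure (Ioc a b) ≤ ENNReal.ofReal ((b - a) / a) := by
  have h0 : Ioc a b ⊆ Ioi 0 := fun t ht => ha.trans ht.1
  rw [← setLIntegral_one, setLIntegral_logMeasure _ measurableSet_Ioc h0,
    ENNReal.ofReal_div_of_pos ha, ENNReal.div_eq_inv_mul, ← Real.volume_Ioc,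
    ← setLIntegral_const]
  refine setLIntegral_mono' measurableSet_Ioc fun t ht => ?_
  rw [one_div]
  exact ENNReal.inv_le_inv.2 (ENNReal.ofReal_le_ofReal ht.1.le)

lemma iUnion_Ioc_two_zpow : ⋃ l : ℤ, Ioc ((2 : ℝ) ^ l) (2 * 2 ^ l) = Ioi 0 := by
  ext t
  simp only [mem_iUnion, mem_Ioi]
  constructor
  · rintro ⟨l, hl⟩
    exact lt_trans (by positivity) hl.1
  · intro ht
    obtain ⟨l, hl⟩ := exists_mem_Ioc_zpow ht (one_lt_two (α := ℝ))
    refine ⟨l, hl.1, ?_⟩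
    rw [← zpow_one_add₀ two_ne_zero, add_comm]; exact hl.2

lemma pairwise_disjoint_Ioc_two_zpow :
    Pairwise (Function.onFun Disjoint fun l : ℤ => Ioc ((2 : ℝ) ^ l) (2 * 2 ^ l)) := by
  have key : ∀ a b : ℤ, a < b → Disjoint (Ioc ((2 : ℝ) ^ a) (2 * 2 ^ a))
      (Ioc ((2 : ℝ) ^ b) (2 * 2 ^ b)) := fun a b hab => by
    have h1 : (2 : ℝ) * 2 ^ a ≤ 2 ^ b := by
      rw [← zpow_one_add₀ two_ne_zero]
      exact zpow_le_zpow_right₀ one_le_two (by omega)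
    exact Set.disjoint_left.2 fun t ht ht' => absurd (ht.2.trans h1) (not_le.2 ht'.1)
  intro a b hab
  rcases lt_or_gt_of_ne hab with h | h
  · exact key a b h
  · exact (key b a h).symm

lemma lintegral_logMeasure_eq_tsum (G : ℝ → ℝ≥0∞) :
    ∫⁻ t, G t ∂logMeasure = ∑' l : ℤ, ∫⁻ t in Ioc ((2 : ℝ) ^ l) (2 * 2 ^ l), G t ∂logMeasure := by
  rw [← lintegral_iUnion (fun l => measurableSet_Ioc) pairwise_disjoint_Ioc_two_zpow,
    iUnion_Ioc_two_zpow]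
  rw [Measure.restrict_eq_self_of_ae_mem (s := Ioi 0) ae_logMeasure_pos]

end LogMeasure

/-- The kernel `t^{-m} Ω(y) |y|^{-m(n-1)}` cut off to the annulus `t / 2 < max |yᵢ| ≤ t`. -/
def annularKernel {n m : ℕ} (Ω : (Fin m → Rn n) → ℂ) (t : ℝ) (y : Fin m → Rn n) : ℂ :=
  if t / 2 < ‖y‖ ∧ ‖y‖ ≤ t then
    (((t ^ m)⁻¹ : ℝ) : ℂ) * (Ω y / ((sumNorm y ^ (m * (n - 1)) : ℝ) : ℂ)) else 0

/-! ### The norm |y₁| + ⋯ + |yₘ| and the radial projection. -/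

section SumNorm

variable {n m : ℕ}

lemma sumNorm_nonneg (y : Fin m → Rn n) : 0 ≤ sumNorm y :=
  Finset.sum_nonneg fun _ _ => norm_nonneg _

lemma norm_le_sumNorm (y : Fin m → Rn n) : ‖y‖ ≤ sumNorm y :=
  (pi_norm_le_iff_of_nonneg (sumNorm_nonneg y)).2 fun i =>
    Finset.single_le_sum (f := fun i => ‖y i‖) (fun _ _ => norm_nonneg _) (Finset.mem_univ i)

lemma sumNorm_le (y : Fin m → Rn n) : sumNorm y ≤ m * ‖y‖ := by
  refine (Finset.sum_le_card_nsmul _ _ ‖y‖ fun i _ => norm_le_pi_norm y i).trans ?_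
  simp

lemma sumNorm_smul (c : ℝ) (y : Fin m → Rn n) : sumNorm (c • y) = |c| * sumNorm y := by
  simp [sumNorm, norm_smul, Finset.mul_sum]

lemma sumNorm_add_le (y v : Fin m → Rn n) : sumNorm (y + v) ≤ sumNorm y + sumNorm v := by
  unfold sumNorm
  rw [← Finset.sum_add_distrib]
  exact Finset.sum_le_sum fun i _ => norm_add_le _ _

lemma sumNorm_sub_comm (y v : Fin m → Rn n) : sumNorm (y - v) = sumNorm (v - y) := by
  simp [sumNorm, norm_sub_rev]

lemma abs_sumNorm_sub_le (y v : Fin m → Rn n) : |sumNorm y - sumNorm v| ≤ sumNorm (y - v) := by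
  have h1 := sumNorm_add_le (y - v) v
  have h2 := sumNorm_add_le (v - y) y
  rw [sub_add_cancel] at h1 h2
  rw [abs_le, sumNorm_sub_comm v y] at *
  constructor <;> linarith

lemma continuous_sumNorm : Continuous (sumNorm : (Fin m → Rn n) → ℝ) := by
  unfold sumNorm; fun_prop

lemma sumNorm_pos {y : Fin m → Rn n} (hy : y ≠ 0) : 0 < sumNorm y :=
  (norm_pos_iff.2 hy).trans_le (norm_le_sumNorm y)

lemma sumNorm_normalized {y : Fin m → Rn n} (hy : y ≠ 0) : sumNorm (normalized y) = 1 := by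
  have := sumNorm_pos hy
  rw [normalized, sumNorm_smul, abs_of_pos (inv_pos.2 this), inv_mul_cancel₀ this.ne']

/-- v' - y' splits as (v - y)/|v| plus a multiple of y coming from the change of length; each piece
is at most |v - y|/|v|. -/
lemma sumNorm_normalized_sub_le {y v : Fin m → Rn n} (hy : y ≠ 0) (hv : v ≠ 0) :
    sumNorm (normalized v - normalized y) ≤ 2 * sumNorm (v - y) / sumNorm v := by
  have hy' := sumNorm_pos hy
  have hv' := sumNorm_pos hv
  have e : normalized v - normalized y =
      (sumNorm v)⁻¹ • (v - y) + ((sumNorm v)⁻¹ - (sumNorm y)⁻¹) • y := by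
    unfold normalized; module
  rw [e]
  refine (sumNorm_add_le _ _).trans ?_
  rw [sumNorm_smul, sumNorm_smul, abs_of_pos (inv_pos.2 hv'), inv_sub_inv hv'.ne' hy'.ne', abs_div,
    abs_of_pos (mul_pos hv' hy')]
  have := abs_sumNorm_sub_le y v
  rw [sumNorm_sub_comm] at this
  rw [div_mul_eq_mul_div, mul_div_mul_right _ _ hy'.ne', inv_mul_eq_div, ← add_div]
  gcongr
  linarith

end SumNorm

/-! ### Integration in polar coordinates. -/

section Polar

variable {n : ℕ} [NeZero n]

/-- Polar coordinates turn the integral into an iterated one whose inner spherical integral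
vanishes. A non-integrable `φ` has integral 0 by convention. -/
lemma integral_eq_zero_of_sphere {φ : Rn n → ℂ}
    (h : ∀ r : ℝ, 0 < r → ∫ θ : sphere (0 : Rn n) 1, φ (r • (θ : Rn n))
      ∂((volume : Measure (Rn n)).toSphere) = 0) : ∫ z, φ z = 0 := by
  have : Nonempty (Fin n) := ⟨0⟩
  by_cases hint : Integrable φ
  swap
  · exact integral_undef hint
  set Ψ : sphere (0 : Rn n) 1 × Ioi (0 : ℝ) → ℂ := fun a => φ (a.2.1 • (a.1 : Rn n)) with hΨ
  have hmp := (volume : Measure (Rn n)).measurePreserving_homeomorphUnitSphereProd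
  have hcomp : ∀ z : ({0}ᶜ : Set (Rn n)), Ψ (homeomorphUnitSphereProd (Rn n) z) = φ z := by
    intro z
    have hz : ‖(z : Rn n)‖ ≠ 0 := norm_ne_zero_iff.2 z.2
    simp [hΨ, smul_smul, mul_inv_cancel₀ hz]
  have e1 : ∫ z, φ z = ∫ z : ({0}ᶜ : Set (Rn n)), Ψ (homeomorphUnitSphereProd (Rn n) z)
      ∂((volume : Measure (Rn n)).comap Subtype.val) := by
    simp_rw [hcomp]
    rw [integral_subtype_comap (measurableSet_singleton _).compl φ, restrict_compl_singleton]
  rw [e1, hmp.integral_comp (Homeomorph.measurableEmbedding _)]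
  have hi : Integrable Ψ ((volume : Measure (Rn n)).toSphere.prod
      (Measure.volumeIoiPow (Module.finrank ℝ (Rn n) - 1))) := by
    rw [← hmp.integrable_comp_emb (Homeomorph.measurableEmbedding _)]
    have : Ψ ∘ (homeomorphUnitSphereProd (Rn n)) = φ ∘ Subtype.val := funext hcomp
    rw [this, ← integrableOn_iff_comap_subtypeVal (measurableSet_singleton _).compl, IntegrableOn,
      restrict_compl_singleton]
    exact hint
  rw [integral_prod_symm _ hi]
  exact integral_eq_zero_of_ae (Filter.Eventually.of_forall fun r => h r.1 r.2)

end Polar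

/-! ### Size, cancellation and regularity of the annular kernel. -/

section Kernel

variable {n m : ℕ} {Ω : (Fin m → Rn n) → ℂ} {β : ℝ}

lemma exists_ne_zero [NeZero n] [NeZero m] : ∃ y : Fin m → Rn n, y ≠ 0 :=
  ⟨fun _ => EuclideanSpace.single 0 1, fun h => by simpa using congrFun h 0⟩

lemma IsKernel.bounded [NeZero n] [NeZero m] (hΩ : IsKernel Ω β) (hβ : 0 < β) :
    ∃ B : ℝ, 0 < B ∧ ∀ y, y ≠ 0 → ‖Ω y‖ ≤ B := by
  obtain ⟨C, hC, hL⟩ := hΩ.lipschitz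
  obtain ⟨y0, hy0⟩ := exists_ne_zero (n := n) (m := m)
  refine ⟨‖Ω y0‖ + C * 2 ^ β, by positivity, fun y hy => ?_⟩
  have h1 := hL y y0 hy hy0
  have h2 : sumNorm (normalized y - normalized y0) ≤ 2 := by
    have := sumNorm_add_le (normalized y) ((-1 : ℝ) • normalized y0)
    rw [sumNorm_smul, sumNorm_normalized hy, sumNorm_normalized hy0] at this
    rw [sub_eq_add_neg, ← neg_one_smul ℝ]
    refine this.trans ?_
    norm_num
  have h3 : sumNorm (normalized y - normalized y0) ^ β ≤ 2 ^ β :=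
    Real.rpow_le_rpow (sumNorm_nonneg _) h2 hβ.le
  have h4 := norm_sub_norm_le (Ω y) (Ω y0)
  nlinarith

/-- The Hölder condition makes `Ω` continuous away from 0; the value at 0 is treated separately,
since the condition says nothing there. -/
lemma IsKernel.measurable (hΩ : IsKernel Ω β) (hβ : 0 < β) : Measurable Ω := by
  obtain ⟨C, hC, hL⟩ := hΩ.lipschitz
  have hc : ContinuousOn Ω {0}ᶜ := by
    intro y hy
    refine ContinuousAt.continuousWithinAt ?_
    rw [ContinuousAt, tendsto_iff_norm_sub_tendsto_zero]
    have hnorm : ContinuousAt (fun v => C * sumNorm (normalized v - normalized y) ^ β) y := by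
      have h1 : ContinuousAt (fun v : Fin m → Rn n => normalized v) y := by
        unfold normalized
        exact (continuous_sumNorm.continuousAt.inv₀ (sumNorm_pos hy).ne').smul continuousAt_id
      exact continuousAt_const.mul (ContinuousAt.rpow_const (continuous_sumNorm.continuousAt.comp
        (h1.sub continuousAt_const)) (Or.inr hβ.le))
    have h0 : C * sumNorm (normalized y - normalized y) ^ β = 0 := by
      rw [sub_self]; simp [sumNorm, Real.zero_rpow hβ.ne']
    have ht := hnorm.tendsto
    rw [h0] at ht
    refine squeeze_zero' (Filter.Eventually.of_forall fun _ => norm_nonneg _) ?_ ht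
    filter_upwards [isOpen_compl_singleton.mem_nhds hy] with v hv
    exact hL v y hv hy
  have : Ω = ({0}ᶜ : Set (Fin m → Rn n)).piecewise Ω (fun _ => Ω 0) := by
    ext y
    by_cases hy : y = 0
    · simp [hy, Set.piecewise]
    · simp [Set.piecewise, hy]
  rw [this]
  exact hc.measurable_piecewise continuousOn_const (measurableSet_singleton _).compl

lemma measurable_annularKernel (hΩm : Measurable Ω) :
    Measurable (Function.uncurry (annularKernel Ω)) := by
  have hs : MeasurableSet {a : ℝ × (Fin m → Rn n) | a.1 / 2 < ‖a.2‖ ∧ ‖a.2‖ ≤ a.1} :=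
    (measurableSet_lt (f := fun a : ℝ × (Fin m → Rn n) => a.1 / 2) (g := fun a => ‖a.2‖)
      (by fun_prop) (by fun_prop)).inter
      (measurableSet_le (f := fun a : ℝ × (Fin m → Rn n) => ‖a.2‖) (g := fun a => a.1)
      (by fun_prop) (by fun_prop))
  have hsn : Measurable fun a : ℝ × (Fin m → Rn n) => sumNorm a.2 :=
    continuous_sumNorm.measurable.comp measurable_snd
  have : Measurable fun a : ℝ × (Fin m → Rn n) =>
      (((a.1 ^ m)⁻¹ : ℝ) : ℂ) * (Ω a.2 / ((sumNorm a.2 ^ (m * (n - 1)) : ℝ) : ℂ)) := by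
    refine (Complex.measurable_ofReal.comp (by fun_prop)).mul
      ((hΩm.comp measurable_snd).div (Complex.measurable_ofReal.comp (hsn.pow_const _)))
  exact Measurable.ite hs this measurable_const

/-- On a sphere |y_j| = r with the other variables fixed, both the cutoff (a sup norm condition) and
|y| are constant, so only `Ω` varies. Homogeneity rescales the sphere to radius 1, and the vanishing
condition applies because it holds for arbitrary values of the other variables. -/
lemma integral_annularKernel_update [NeZero n] (hΩ : IsKernel Ω β) (t : ℝ) (j : Fin m) (y : Fin m → Rn n) :
    ∫ z, annularKernel Ω t (Function.update y j z) = 0 := by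
  refine integral_eq_zero_of_sphere fun r hr => ?_
  have hnorm : ∀ θ : sphere (0 : Rn n) 1, ‖r • (θ : Rn n)‖ = r := by
    intro θ
    rw [norm_smul, Real.norm_of_nonneg hr.le, norm_eq_of_mem_sphere, mul_one]
  have hpi : ∀ z z' : Rn n, ‖z‖ = ‖z'‖ →
      ‖Function.update y j z‖ = ‖Function.update y j z'‖ := by
    have : ∀ z z' : Rn n, ‖z‖ = ‖z'‖ →
      ‖Function.update y j z‖ ≤ ‖Function.update y j z'‖ := by
      intro z z' h
      refine (pi_norm_le_iff_of_nonneg (norm_nonneg _)).2 fun i => ?_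
      by_cases hij : i = j
      · subst hij
        have := norm_le_pi_norm (Function.update y i z') i
        simpa [h] using this
      · have := norm_le_pi_norm (Function.update y j z') i
        simpa [hij] using this
    exact fun z z' h => le_antisymm (this z z' h) (this z' z h.symm)
  have hsn : ∀ z z' : Rn n, ‖z‖ = ‖z'‖ →
      sumNorm (Function.update y j z) = sumNorm (Function.update y j z') := by
    intro z z' h
    refine Finset.sum_congr rfl fun i _ => ?_
    by_cases hij : i = j
    · subst hij; simpa using h
    · simp [hij]
  have hup : ∀ θ : sphere (0 : Rn n) 1, Ω (Function.update y j (r • (θ : Rn n))) =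
      Ω (Function.update (r⁻¹ • y) j (θ : Rn n)) := by
    intro θ
    rw [← hΩ.homogeneous r⁻¹ (inv_pos.2 hr) (Function.update y j (r • (θ : Rn n)))]
    congr 1
    ext1 i
    by_cases hij : i = j
    · subst hij; simp [smul_smul, inv_mul_cancel₀ hr.ne']
    · simp [hij]
  by_cases hemp : IsEmpty (sphere (0 : Rn n) 1)
  · simp [Measure.eq_zero_of_isEmpty]
  rw [not_isEmpty_iff] at hemp
  obtain ⟨θ0⟩ := hemp
  set z0 : Rn n := r • (θ0 : Rn n)
  have e : ∀ θ : sphere (0 : Rn n) 1, annularKernel Ω t (Function.update y j (r • (θ : Rn n))) =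
      (if t / 2 < ‖Function.update y j z0‖ ∧ ‖Function.update y j z0‖ ≤ t then
        (((t ^ m)⁻¹ : ℝ) : ℂ) / ((sumNorm (Function.update y j z0) ^ (m * (n - 1)) : ℝ) : ℂ)
        else 0) * Ω (Function.update (r⁻¹ • y) j (θ : Rn n)) := by
    intro θ
    have h1 := hpi (r • (θ : Rn n)) z0 (by rw [hnorm, hnorm])
    have h2 := hsn (r • (θ : Rn n)) z0 (by rw [hnorm, hnorm])
    unfold annularKernel
    rw [← hup, h1, h2]
    split_ifs
    · ring
    · simp
  simp_rw [e]
  rw [integral_const_mul, hΩ.vanishing j, mul_zero]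

/-- On the annulus |y| ≥ t/2, so the kernel is O(t^{-m} t^{-m(n-1)}) = O(t^{-mn}). -/
lemma norm_annularKernel_le [NeZero n] {B : ℝ} (hB : 0 < B) (hΩB : ∀ y, y ≠ 0 → ‖Ω y‖ ≤ B) {t : ℝ}
    (ht : 0 < t) (y : Fin m → Rn n) :
    ‖annularKernel Ω t y‖ ≤ B * 2 ^ (m * (n - 1)) * (t ^ (m * n))⁻¹ := by
  unfold annularKernel
  split_ifs with h
  · have hy : y ≠ 0 := norm_pos_iff.1 (lt_trans (by positivity) h.1)
    have hs : t / 2 ≤ sumNorm y := h.1.le.trans (norm_le_sumNorm y)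
    rw [norm_mul, norm_div, Complex.norm_real, Complex.norm_real,
      Real.norm_of_nonneg (by positivity), Real.norm_of_nonneg (pow_nonneg (sumNorm_nonneg y) _)]
    have e : m * n = m + m * (n - 1) := by
      obtain ⟨k, hk⟩ := Nat.exists_eq_succ_of_ne_zero (NeZero.ne n)
      subst hk; simp; ring
    calc (t ^ m)⁻¹ * (‖Ω y‖ / sumNorm y ^ (m * (n - 1)))
        ≤ (t ^ m)⁻¹ * (B / (t / 2) ^ (m * (n - 1))) := by
          gcongr
          exact hΩB y hy
      _ = B * 2 ^ (m * (n - 1)) * (t ^ (m * n))⁻¹ := by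
          rw [e, pow_add, div_pow]
          field_simp
  · simp; positivity

lemma annularKernel_eq_zero {t : ℝ} {y : Fin m → Rn n} (h : t < ‖y‖) :
    annularKernel Ω t y = 0 := if_neg fun h' => absurd h'.2 (not_le.2 h)

/-- With both points in the annulus the cutoff plays no role: the difference is that of `Ω`,
controlled by the Hölder condition on the projections, plus that of |y|^{-m(n-1)}, which is
Lipschitz and hence Hölder because ‖v - y‖ ≤ T and β < 1. -/
lemma norm_annularKernel_sub_le [NeZero n] (hβ0 : 0 < β) (hβ1 : β < 1) {B L : ℝ} (hB : 0 < B)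
    (hΩB : ∀ y, y ≠ 0 → ‖Ω y‖ ≤ B) (hL : 0 < L) (hΩL : ∀ ξ η : Fin m → Rn n, ξ ≠ 0 → η ≠ 0 →
      ‖Ω ξ - Ω η‖ ≤ L * sumNorm (normalized ξ - normalized η) ^ β) {T t : ℝ} (hT : 0 < T)
    (ht : T < t) {v y : Fin m → Rn n} (hv : t / 2 < ‖v‖ ∧ ‖v‖ ≤ t) (hy : t / 2 < ‖y‖ ∧ ‖y‖ ≤ t)
    (hd : ‖v - y‖ ≤ T) :
    ‖annularKernel Ω t v - annularKernel Ω t y‖ ≤ 2 ^ (m * (n - 1)) *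
      (L * (4 * m) ^ β + 2 * B * m * (m * (n - 1) : ℕ)) * (‖v - y‖ / T) ^ β * (T ^ (m * n))⁻¹ := by
  have hv0 : v ≠ 0 := norm_pos_iff.1 (lt_trans (by linarith) hv.1)
  have hy0 : y ≠ 0 := norm_pos_iff.1 (lt_trans (by linarith) hy.1)
  have hvs : T / 2 ≤ sumNorm v := by have := norm_le_sumNorm v; linarith [hv.1]
  have hys : T / 2 ≤ sumNorm y := by have := norm_le_sumNorm y; linarith [hy.1]
  have hvp := sumNorm_pos hv0
  have hyp := sumNorm_pos hy0
  set N := m * (n - 1) with hN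
  set s : ℝ := 2 / T with hs
  have hs0 : 0 < s := by positivity
  set δ : ℝ := ‖v - y‖ / T with hδ
  have hδ0 : 0 ≤ δ := by positivity
  have hδ1 : δ ≤ 1 := (div_le_one hT).2 hd
  have hδβ : δ ≤ δ ^ β := by
    conv_lhs => rw [← Real.rpow_one δ]
    exact Real.rpow_le_rpow_of_exponent_ge' hδ0 hδ1 hβ0.le hβ1.le
  have hvi : (sumNorm v)⁻¹ ≤ s := by
    rw [hs, ← inv_div]; exact inv_anti₀ (by positivity) hvs
  have hyi : (sumNorm y)⁻¹ ≤ s := by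
    rw [hs, ← inv_div]; exact inv_anti₀ (by positivity) hys
  have hsub : sumNorm (v - y) ≤ m * δ * T := by
    refine (sumNorm_le _).trans (le_of_eq ?_)
    rw [hδ]; field_simp
  have h1 : ‖Ω v - Ω y‖ ≤ L * (4 * m) ^ β * δ ^ β := by
    refine (hΩL v y hv0 hy0).trans ?_
    rw [mul_assoc, ← Real.mul_rpow (by positivity) hδ0]
    gcongr
    · exact sumNorm_nonneg _
    · refine (sumNorm_normalized_sub_le hy0 hv0).trans ?_
      rw [div_eq_mul_inv]
      calc 2 * sumNorm (v - y) * (sumNorm v)⁻¹ ≤ 2 * (m * δ * T) * s := by gcongr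
        _ = 4 * m * δ := by rw [hs]; field_simp; ring
  have h2 : |(sumNorm v)⁻¹ ^ N - (sumNorm y)⁻¹ ^ N| ≤ 2 * m * N * δ * s ^ N := by
    refine (abs_pow_sub_pow_le (sumNorm v)⁻¹ (sumNorm y)⁻¹ N).trans ?_
    have h3 : |(sumNorm v)⁻¹ - (sumNorm y)⁻¹| ≤ 2 * m * δ * s := by
      rw [inv_sub_inv hvp.ne' hyp.ne', abs_div, abs_of_pos (mul_pos hvp hyp), div_eq_mul_inv,
        mul_inv]
      calc |sumNorm y - sumNorm v| * ((sumNorm v)⁻¹ * (sumNorm y)⁻¹)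
          ≤ (m * δ * T) * (s * s) := by
            gcongr
            rw [abs_sub_comm]
            exact (abs_sumNorm_sub_le v y).trans hsub
        _ = 2 * m * δ * s := by rw [hs]; field_simp
    have h4 : max |(sumNorm v)⁻¹| |(sumNorm y)⁻¹| ≤ s := by
      rw [abs_of_pos (inv_pos.2 hvp), abs_of_pos (inv_pos.2 hyp)]; exact max_le hvi hyi
    calc _ ≤ (2 * m * δ * s) * N * s ^ (N - 1) := by gcongr
      _ = 2 * m * N * δ * s ^ N := by
        rcases Nat.eq_zero_or_pos N with h0 | h0
        · simp [h0]
        · rw [← Nat.sub_add_cancel h0, pow_succ, Nat.add_sub_cancel]; ring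
  have e : m * n = m + N := by
    obtain ⟨k, hk⟩ := Nat.exists_eq_succ_of_ne_zero (NeZero.ne n)
    rw [hN, hk]; simp; ring
  have ek : annularKernel Ω t v - annularKernel Ω t y = (((t ^ m)⁻¹ : ℝ) : ℂ) *
      ((Ω v - Ω y) * (((sumNorm v)⁻¹ ^ N : ℝ) : ℂ) +
        Ω y * (((sumNorm v)⁻¹ ^ N - (sumNorm y)⁻¹ ^ N : ℝ) : ℂ)) := by
    unfold annularKernel
    rw [if_pos hv, if_pos hy]
    push_cast
    rw [inv_pow, inv_pow]
    ring
  rw [ek, norm_mul, Complex.norm_real, Real.norm_of_nonneg (by have := hT.trans ht; positivity)]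
  calc (t ^ m)⁻¹ * ‖(Ω v - Ω y) * (((sumNorm v)⁻¹ ^ N : ℝ) : ℂ) +
        Ω y * (((sumNorm v)⁻¹ ^ N - (sumNorm y)⁻¹ ^ N : ℝ) : ℂ)‖
      ≤ (T ^ m)⁻¹ * (L * (4 * m) ^ β * δ ^ β * s ^ N + B * (2 * m * N * δ ^ β * s ^ N)) := by
        gcongr
        refine (norm_add_le _ _).trans ?_
        rw [norm_mul, norm_mul, Complex.norm_real, Complex.norm_real,
          Real.norm_of_nonneg (by positivity), Real.norm_eq_abs]
        have h5 : 2 * (m : ℝ) * N * δ * s ^ N ≤ 2 * m * N * δ ^ β * s ^ N := by gcongr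
        gcongr
        · exact hΩB y hy0
        · exact h2.trans h5
    _ = 2 ^ N * (L * (4 * m) ^ β + 2 * B * m * N) * δ ^ β * (T ^ (m * n))⁻¹ := by
        rw [e, pow_add, hs, div_pow]
        field_simp

/-- The properties of the kernel of an annular square function: measurability, size, regularity in
`L²(dt / t)` and cancellation in each variable. -/
structure IsAnnular (k : ℝ → (Fin m → Rn n) → ℂ) (C : ℝ≥0) (γ : ℝ) : Prop where
  measurable : Measurable (Function.uncurry k)
  support : ∀ t y, t < ‖y‖ → k t y = 0
  size : ∀ t, 0 < t → ∀ y, ‖k t y‖ₑ ≤ C * ((ENNReal.ofReal t ^ n)⁻¹) ^ m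
  regular : ∀ T, 0 < T → ∀ v y, ∫⁻ t in Ioc T (2 * T), ‖k t v - k t y‖ₑ ^ 2 ∂logMeasure ≤
    (C * ((ENNReal.ofReal T ^ n)⁻¹) ^ m * ENNReal.ofReal (‖v - y‖ / T) ^ γ) ^ 2
  vanishing : ∀ t j y, ∫ z, k t (Function.update y j z) = 0

lemma ofReal_inv_pow {T : ℝ} (hT : 0 < T) :
    ((ENNReal.ofReal T ^ n)⁻¹) ^ m = ENNReal.ofReal ((T ^ (m * n))⁻¹) := by
  rw [← ENNReal.inv_pow, ← pow_mul, mul_comm n m, ENNReal.ofReal_inv_of_pos (by positivity),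
    ENNReal.ofReal_pow hT.le]

/-- The sharp cutoff is not continuous in y for a fixed t, so regularity is measured in L²(dt/t). A
jump occurs only on a set of t of relative size δ = ‖v - y‖ / T. It contributes δ ≤ δ^β to the
integral of the square when δ ≤ 1, whence the exponent β / 2. -/
lemma exists_isAnnular [NeZero n] [NeZero m] (hΩ : IsKernel Ω β) (hβ0 : 0 < β) (hβ1 : β < 1) :
    ∃ C : ℝ≥0, IsAnnular (annularKernel Ω) C (β / 2) := by
  obtain ⟨B, hB, hΩB⟩ := hΩ.bounded hβ0
  obtain ⟨L, hL, hΩL⟩ := hΩ.lipschitz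
  set N := m * (n - 1) with hN
  set K1 : ℝ := B * 2 ^ N with hK1
  set K2 : ℝ := 2 ^ N * (L * (4 * m) ^ β + 2 * B * m * N) with hK2
  -- 2 K1 bounds the difference trivially and K2 is the Hölder constant. The factor 2 is √4, from
  -- δ^β + 3δ ≤ 4 δ^β for δ ≤ 1.
  set K : ℝ := 2 * (2 * K1 + K2) with hK
  have hK1p : 0 < K1 := by positivity
  have hm0 : (0 : ℝ) < m := Nat.cast_pos.2 (Nat.pos_of_ne_zero (NeZero.ne m))
  have hK2p : 0 < K2 := by positivity
  have hsize : ∀ t, 0 < t → ∀ y, ‖annularKernel Ω t y‖ ≤ K1 * (t ^ (m * n))⁻¹ :=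
    fun t ht y => norm_annularKernel_le hB hΩB ht y
  refine ⟨K.toNNReal, measurable_annularKernel (hΩ.measurable hβ0),
    fun t y h => annularKernel_eq_zero h, fun t ht y => ?_, fun T hT v y => ?_,
    fun t j y => integral_annularKernel_update hΩ t j y⟩
  · rw [ofReal_inv_pow ht, ← ofReal_norm, ENNReal.ofNNReal_toNNReal,
      ← ENNReal.ofReal_mul (by positivity)]
    refine ENNReal.ofReal_le_ofReal ((hsize t ht y).trans ?_)
    gcongr
    linarith
  · set δ : ℝ := ‖v - y‖ / T with hδ
    have hδ0 : 0 ≤ δ := by positivity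
    set D : ℝ := (2 * K1 + K2) * (T ^ (m * n))⁻¹ with hD
    have hDp : 0 < D := by positivity
    have hTi : 0 < (T ^ (m * n))⁻¹ := by positivity
    have hsize' : ∀ t ∈ Ioc T (2 * T), ∀ y, ‖annularKernel Ω t y‖ ≤ K1 * (T ^ (m * n))⁻¹ := by
      intro t ht y
      refine (hsize t (hT.trans ht.1) y).trans ?_
      gcongr
      exact ht.1.le
    have hRHS : (((K.toNNReal : ℝ≥0) : ℝ≥0∞) * ((ENNReal.ofReal T ^ n)⁻¹) ^ m *
        ENNReal.ofReal δ ^ (β / 2)) ^ 2 = ENNReal.ofReal (D ^ 2 * (4 * δ ^ β)) := by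
      rw [ofReal_inv_pow hT, ENNReal.ofNNReal_toNNReal, ENNReal.ofReal_rpow_of_nonneg hδ0 (by positivity),
        ← ENNReal.ofReal_mul (by positivity), ← ENNReal.ofReal_mul (by positivity),
        ← ENNReal.ofReal_pow (by positivity)]
      congr 1
      have : δ ^ β = (δ ^ (β / 2)) ^ 2 := by
        rw [← Real.rpow_natCast, ← Real.rpow_mul hδ0]; norm_num
      rw [this, hD, hK]; ring
    rw [hRHS]
    -- The conditions ‖·‖ ≤ t and t < 2‖·‖ can distinguish v from y only when t lies between ‖v‖ and
    -- ‖y‖, or between their doubles.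
    set U : Set ℝ := uIcc ‖v‖ ‖y‖ ∪ uIcc (2 * ‖v‖) (2 * ‖y‖) with hU
    have hUm : MeasurableSet U := measurableSet_uIcc.union measurableSet_uIcc
    have hUv : volume U ≤ ENNReal.ofReal (3 * ‖v - y‖) := by
      refine (measure_union_le _ _).trans ?_
      rw [Real.volume_interval, Real.volume_interval, ← ENNReal.ofReal_add (abs_nonneg _) (abs_nonneg _),
        ← mul_sub, abs_mul, abs_two, abs_sub_comm]
      exact ENNReal.ofReal_le_ofReal (by linarith [abs_norm_sub_norm_le v y])
    have hpt : ∀ t ∈ Ioc T (2 * T), ‖annularKernel Ω t v - annularKernel Ω t y‖ₑ ^ 2 ≤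
        ENNReal.ofReal (D ^ 2) * (ENNReal.ofReal (δ ^ β) + U.indicator 1 t) := by
      intro t ht
      have hsq : ∀ a : ℝ, 0 ≤ a → ‖annularKernel Ω t v - annularKernel Ω t y‖ ≤ D * a →
          ‖annularKernel Ω t v - annularKernel Ω t y‖ₑ ^ 2 ≤
            ENNReal.ofReal (D ^ 2) * ENNReal.ofReal (a ^ 2) := by
        intro a ha h
        rw [← ofReal_norm, ← ENNReal.ofReal_pow (norm_nonneg _),
          ← ENNReal.ofReal_mul (by positivity), ← mul_pow]
        gcongr
      have htriv : ‖annularKernel Ω t v - annularKernel Ω t y‖ ≤ D * 1 := by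
        refine (norm_sub_le _ _).trans ?_
        have h1 := hsize' t ht v
        have h2 := hsize' t ht y
        have h3 : 0 ≤ K2 * (T ^ (m * n))⁻¹ := by positivity
        rw [hD]; linarith
      rcases le_or_gt 1 δ with h1 | h1
      · refine (hsq 1 zero_le_one htriv).trans ?_
        gcongr
        refine le_add_right (ENNReal.ofReal_le_ofReal ?_)
        rw [one_pow]; exact Real.one_le_rpow h1 hβ0.le
      by_cases hPv : t / 2 < ‖v‖ ∧ ‖v‖ ≤ t <;> by_cases hPy : t / 2 < ‖y‖ ∧ ‖y‖ ≤ t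
      · have h2 := norm_annularKernel_sub_le hβ0 hβ1 hB hΩB hL hΩL hT ht.1 hPv hPy
          (by rw [hδ, div_lt_one hT] at h1; exact h1.le)
        refine (hsq (δ ^ β) (by positivity) (h2.trans ?_)).trans ?_
        · rw [← hN, ← hK2, ← hδ, hD, mul_right_comm]
          gcongr
          linarith
        · gcongr
          refine le_add_right (ENNReal.ofReal_le_ofReal ?_)
          have h3 : δ ^ β ≤ 1 := Real.rpow_le_one hδ0 h1.le hβ0.le
          have h4 : 0 ≤ δ ^ β := by positivity
          nlinarith
      · have htU : t ∈ U := by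
          simp only [hU, mem_union, mem_uIcc]
          rcases not_and_or.1 hPy with h | h
          · right; right; constructor <;> linarith [hPv.1]
          · left; left; constructor <;> linarith [hPv.2]
        refine (hsq 1 zero_le_one htriv).trans ?_
        rw [indicator_of_mem htU]
        gcongr
        simp
      · have htU : t ∈ U := by
          simp only [hU, mem_union, mem_uIcc]
          rcases not_and_or.1 hPv with h | h
          · right; left; constructor <;> linarith [hPy.1]
          · left; right; constructor <;> linarith [hPy.2]
        refine (hsq 1 zero_le_one htriv).trans ?_
        rw [indicator_of_mem htU]
        gcongr
        simp
      · simp [annularKernel, hPv, hPy]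
    have hmeas1 : logMeasure (Ioc T (2 * T)) ≤ 1 := by
      refine (logMeasure_Ioc_le hT).trans ?_
      rw [show (2 * T - T) / T = 1 by field_simp; ring, ENNReal.ofReal_one]
    refine (setLIntegral_mono' measurableSet_Ioc hpt).trans ?_
    rw [lintegral_const_mul' _ _ ENNReal.ofReal_ne_top,
      lintegral_add_left measurable_const, setLIntegral_const, lintegral_indicator_one hUm,
      Measure.restrict_apply hUm, ENNReal.ofReal_mul (by positivity)]
    gcongr
    have hU1 : logMeasure (U ∩ Ioc T (2 * T)) ≤ ENNReal.ofReal (3 * δ) := by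
      refine (logMeasure_inter_Ioc_le hUm hT).trans ?_
      rw [show 3 * δ = 3 * ‖v - y‖ / T by rw [hδ]; ring, ENNReal.ofReal_div_of_pos hT,
        ENNReal.div_eq_inv_mul]
      gcongr
    rcases le_or_gt 1 δ with h1 | h1
    · have h2 : (1 : ℝ) ≤ δ ^ β := Real.one_le_rpow h1 hβ0.le
      calc _ ≤ ENNReal.ofReal (δ ^ β) * 1 + 1 := by
            gcongr
            exact (measure_mono inter_subset_right).trans hmeas1
        _ = ENNReal.ofReal (δ ^ β + 1) := by
            rw [ENNReal.ofReal_add (by positivity) zero_le_one]; simp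
        _ ≤ _ := ENNReal.ofReal_le_ofReal (by linarith)
    · have hδβ : δ ≤ δ ^ β := by
        conv_lhs => rw [← Real.rpow_one δ]
        exact Real.rpow_le_rpow_of_exponent_ge' hδ0 h1.le hβ0.le hβ1.le
      calc _ ≤ ENNReal.ofReal (δ ^ β) * 1 + ENNReal.ofReal (3 * δ) := by gcongr
        _ = ENNReal.ofReal (δ ^ β + 3 * δ) := by
            rw [ENNReal.ofReal_add (by positivity) (by positivity)]; simp
        _ ≤ _ := ENNReal.ofReal_le_ofReal (by linarith)

end Kernel

/-! ### The annular operator: pointwise bounds, multilinear expansion, regularity and cancellation.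
-/

/-- The multilinear operator with kernel `k t (x - z)`. -/
def annOp {n m : ℕ} (k : ℝ → (Fin m → Rn n) → ℂ) (f : Fin m → Rn n → ℂ) (t : ℝ) (x : Rn n) : ℂ :=
  ∫ z : Fin m → Rn n, k t (fun i => x - z i) * ∏ i, f i (z i)

/-- The `L²(dt / t)` norm of `annOp` over the block `T < t ≤ 2T`. -/
def blockNorm {n m : ℕ} (k : ℝ → (Fin m → Rn n) → ℂ) (f : Fin m → Rn n → ℂ) (T : ℝ) (x : Rn n) :
    ℝ≥0∞ :=
  (∫⁻ t in Ioc T (2 * T), ‖annOp k f t x‖ₑ ^ 2 ∂logMeasure) ^ (1 / 2 : ℝ)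

lemma ennreal_sqrt_sq (a : ℝ≥0∞) : (a ^ 2) ^ (1 / 2 : ℝ) = a := by
  rw [← ENNReal.rpow_natCast_mul]; norm_num

lemma ennreal_sq_sqrt (a : ℝ≥0∞) : (a ^ (1 / 2 : ℝ)) ^ 2 = a := by
  rw [← ENNReal.rpow_mul_natCast]; norm_num

lemma ennreal_sqrt_le {a b : ℝ≥0∞} (h : a ≤ b ^ 2) : a ^ (1 / 2 : ℝ) ≤ b :=
  (ENNReal.rpow_le_rpow h (by norm_num)).trans_eq (ennreal_sqrt_sq b)

section Operator

variable {n m : ℕ} {k : ℝ → (Fin m → Rn n) → ℂ} {C : ℝ≥0} {γ : ℝ} {f : Fin m → Rn n → ℂ}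

lemma enorm_finsetProd {ι : Type*} (s : Finset ι) (g : ι → ℂ) :
    ‖∏ i ∈ s, g i‖ₑ = ∏ i ∈ s, ‖g i‖ₑ := by
  simp only [enorm_eq_nnnorm, nnnorm_prod]
  push_cast
  rfl

lemma sub_pi_mem_iff {x : Rn n} {z : Fin m → Rn n} {t : ℝ} (ht : 0 ≤ t) :
    ‖fun i => x - z i‖ ≤ t ↔ z ∈ univ.pi fun _ : Fin m => closedBall x t := by
  rw [pi_norm_le_iff_of_nonneg ht]
  simp only [mem_pi, mem_univ, forall_const, mem_closedBall, dist_eq_norm]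
  exact forall_congr' fun i => by rw [norm_sub_rev]

lemma measurable_prod_enorm (hf : ∀ i, Measurable (f i)) :
    Measurable fun z : Fin m → Rn n => ∏ i, ‖f i (z i)‖ₑ :=
  Finset.measurable_prod _ fun i _ => ((hf i).comp (measurable_pi_apply i)).enorm

lemma measurable_prod_apply (hf : ∀ i, Measurable (f i)) :
    Measurable fun z : Fin m → Rn n => ∏ i, f i (z i) :=
  Finset.measurable_prod _ fun i _ => (hf i).comp (measurable_pi_apply i)

lemma IsAnnular.measurable_comp (hk : IsAnnular k C γ) (t : ℝ) {α : Type*} [MeasurableSpace α]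
    {p : α → Fin m → Rn n} (hp : Measurable p) : Measurable fun a => k t (p a) :=
  hk.measurable.comp (measurable_const.prodMk hp)

lemma measurable_const_sub (x : Rn n) : Measurable fun (z : Fin m → Rn n) i => x - z i :=
  measurable_pi_lambda _ fun i => measurable_const.sub (measurable_pi_apply i)

lemma enorm_integrand_eq (k : ℝ → (Fin m → Rn n) → ℂ) (f : Fin m → Rn n → ℂ) (t : ℝ) (x : Rn n)
    (z : Fin m → Rn n) : ‖k t (fun i => x - z i) * ∏ i, f i (z i)‖ₑ =
      ‖k t (fun i => x - z i)‖ₑ * ∏ i, ‖f i (z i)‖ₑ := by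
  rw [enorm_mul]
  congr 1
  exact enorm_finsetProd _ _

lemma lintegral_annOp_le (hk : IsAnnular k C γ) (hf : ∀ i, Measurable (f i)) {t : ℝ} (ht : 0 < t)
    (x : Rn n) : ∫⁻ z : Fin m → Rn n, ‖k t (fun i => x - z i) * ∏ i, f i (z i)‖ₑ ≤
      C * ∏ i, ballAvg (fun z => ‖f i z‖ₑ) x t := by
  have hs : ∀ i : Fin m, MeasurableSet (closedBall x t) := fun _ => measurableSet_closedBall
  calc ∫⁻ z : Fin m → Rn n, ‖k t (fun i => x - z i) * ∏ i, f i (z i)‖ₑ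
      ≤ ∫⁻ z : Fin m → Rn n, (univ.pi fun _ : Fin m => closedBall x t).indicator
          (fun z => C * ((ENNReal.ofReal t ^ n)⁻¹) ^ m * ∏ i, ‖f i (z i)‖ₑ) z := by
        refine lintegral_mono fun z => ?_
        by_cases hz : z ∈ univ.pi fun _ : Fin m => closedBall x t
        · rw [indicator_of_mem hz, enorm_integrand_eq]
          exact mul_le_mul_left (hk.size t ht _) _
        · rw [indicator_of_notMem hz, hk.support]
          · simp
          · rwa [← sub_pi_mem_iff ht.le, not_le] at hz
    _ = C * ((ENNReal.ofReal t ^ n)⁻¹) ^ m * ∏ i, ∫⁻ z in closedBall x t, ‖f i z‖ₑ := by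
        rw [lintegral_indicator (MeasurableSet.univ_pi hs),
          lintegral_const_mul _ (measurable_prod_enorm hf),
          setLIntegral_fin_prod_eq_prod (fun i z => ‖f i z‖ₑ) (fun i => (hf i).enorm) _ hs]
    _ = C * ∏ i, ballAvg (fun z => ‖f i z‖ₑ) x t := by
        unfold ballAvg
        rw [Finset.prod_mul_distrib, Finset.prod_const, Finset.card_univ, Fintype.card_fin, mul_assoc]

lemma enorm_annOp_le (hk : IsAnnular k C γ) (hf : ∀ i, Measurable (f i)) {t : ℝ} (ht : 0 < t)
    (x : Rn n) : ‖annOp k f t x‖ₑ ≤ C * ∏ i, ballAvg (fun z => ‖f i z‖ₑ) x t :=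
  (enorm_integral_le_lintegral_enorm _).trans (lintegral_annOp_le hk hf ht x)

lemma ballAvg_enorm_ne_top {g : Rn n → ℂ} (hg : LocallyIntegrable g) (x : Rn n) {t : ℝ}
    (ht : 0 < t) : ballAvg (fun z => ‖g z‖ₑ) x t ≠ ∞ :=
  ENNReal.mul_ne_top (ENNReal.inv_ne_top.2 (ofReal_pow_ne_zero ht))
    (hg.integrableOn_isCompact (isCompact_closedBall x t)).2.ne

lemma aestronglyMeasurable_integrand (hk : IsAnnular k C γ) (hf : ∀ i, Measurable (f i)) (t : ℝ)
    (x : Rn n) : AEStronglyMeasurable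
      (fun z : Fin m → Rn n => k t (fun i => x - z i) * ∏ i, f i (z i)) :=
  ((hk.measurable_comp t (measurable_const_sub x)).mul
    (measurable_prod_apply hf)).aestronglyMeasurable

lemma integrable_annOp (hk : IsAnnular k C γ) (hf : ∀ i, Measurable (f i))
    (hl : ∀ i, LocallyIntegrable (f i)) {t : ℝ} (ht : 0 < t) (x : Rn n) :
    Integrable fun z : Fin m → Rn n => k t (fun i => x - z i) * ∏ i, f i (z i) := by
  refine ⟨aestronglyMeasurable_integrand hk hf t x, (lintegral_annOp_le hk hf ht x).trans_lt ?_⟩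
  exact ENNReal.mul_lt_top ENNReal.coe_lt_top (ENNReal.prod_lt_top fun i _ =>
    (ballAvg_enorm_ne_top (hl i) x ht).lt_top)

lemma measurable_annOp (hk : IsAnnular k C γ) (hf : ∀ i, Measurable (f i)) :
    Measurable fun a : ℝ × Rn n => annOp k f a.1 a.2 := by
  have : StronglyMeasurable fun b : (ℝ × Rn n) × (Fin m → Rn n) =>
      k b.1.1 (fun i => b.1.2 - b.2 i) * ∏ i, f i (b.2 i) := by
    refine Measurable.stronglyMeasurable (Measurable.mul ?_
      ((measurable_prod_apply hf).comp measurable_snd))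
    refine hk.measurable.comp ((measurable_fst.comp measurable_fst).prodMk ?_)
    exact measurable_pi_lambda _ fun i => (measurable_snd.comp measurable_fst).sub
      ((measurable_pi_apply i).comp measurable_snd)
  exact this.integral_prod_right'.measurable

lemma measurable_annOp_left (hk : IsAnnular k C γ) (hf : ∀ i, Measurable (f i)) (x : Rn n) :
    Measurable fun t => annOp k f t x :=
  (measurable_annOp hk hf).comp (measurable_id.prodMk measurable_const)

lemma measurable_blockNorm (hk : IsAnnular k C γ) (hf : ∀ i, Measurable (f i)) (T : ℝ) :
    Measurable (blockNorm k f T) := by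
  refine Measurable.pow_const ?_ _
  exact Measurable.lintegral_prod_right' (f := fun a : Rn n × ℝ => ‖annOp k f a.2 a.1‖ₑ ^ 2)
    (((measurable_annOp hk hf).comp measurable_swap).enorm.pow_const 2)

lemma annOp_congr (hk : IsAnnular k C γ) {g : Fin m → Rn n → ℂ} {t : ℝ} (ht : 0 ≤ t) {x : Rn n}
    (h : ∀ i, ∀ z ∈ closedBall x t, f i z = g i z) : annOp k f t x = annOp k g t x := by
  refine integral_congr_ae (Filter.Eventually.of_forall fun z => ?_)
  by_cases hz : z ∈ univ.pi fun _ : Fin m => closedBall x t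
  · beta_reduce
    rw [Finset.prod_congr rfl fun i _ => h i _ (hz i (mem_univ i))]
  · beta_reduce
    rw [hk.support, zero_mul, zero_mul]
    rwa [← sub_pi_mem_iff ht, not_le] at hz

lemma annOp_smul (c : Fin m → ℂ) (t : ℝ) (x : Rn n) :
    annOp k (fun i z => c i * f i z) t x = (∏ i, c i) * annOp k f t x := by
  unfold annOp
  rw [← integral_const_mul]
  refine integral_congr_ae (Filter.Eventually.of_forall fun z => ?_)
  beta_reduce
  rw [Finset.prod_mul_distrib]; ring

/-- The tuple `(f₁, …, f_{j-1}, b_j, g_{j+1}, …, g_m)`. -/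
def mixedTuple (f b g : Fin m → Rn n → ℂ) (j i : Fin m) : Rn n → ℂ :=
  if i < j then f i else if i = j then b i else g i

lemma mixedTuple_self (f b g : Fin m → Rn n → ℂ) (j : Fin m) : mixedTuple f b g j j = b j := by
  simp [mixedTuple]

lemma mixedTuple_induction {f b g : Fin m → Rn n → ℂ} {P : (Rn n → ℂ) → Prop} (hf : ∀ i, P (f i))
    (hb : ∀ i, P (b i)) (hg : ∀ i, P (g i)) (j i : Fin m) : P (mixedTuple f b g j i) := by
  unfold mixedTuple
  split_ifs
  exacts [hf i, hb i, hg i]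

/-- Ordered expansion of ∏ (g_i + b_i): for each j the entries before j keep the sum, the j-th is
b_j, and those after j are g_i. Only m error terms arise, and the cancellation of the distinguished
entry b_j is available in each. -/
lemma annOp_add (hk : IsAnnular k C γ) {g b : Fin m → Rn n → ℂ} (hg : ∀ i, Measurable (g i))
    (hb : ∀ i, Measurable (b i)) (hgl : ∀ i, LocallyIntegrable (g i))
    (hbl : ∀ i, LocallyIntegrable (b i)) {t : ℝ} (ht : 0 < t) (x : Rn n) :
    annOp k (fun i z => g i z + b i z) t x = annOp k g t x +
      ∑ j, annOp k (mixedTuple (fun i z => g i z + b i z) b g j) t x := by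
  unfold annOp
  have hm : ∀ j i, Measurable (mixedTuple (fun i z => g i z + b i z) b g j i) :=
    fun j i => mixedTuple_induction (P := Measurable) (fun i => (hg i).add (hb i)) hb hg j i
  have hl : ∀ j i, LocallyIntegrable (mixedTuple (fun i z => g i z + b i z) b g j i) :=
    fun j i => mixedTuple_induction (P := fun h => LocallyIntegrable h)
      (fun i => (hgl i).add (hbl i)) hbl hgl j i
  rw [← integral_finsetSum _ fun j _ => integrable_annOp hk (hm j) (hl j) ht x,
    ← integral_add (integrable_annOp hk hg hgl ht x)
      (integrable_finsetSum _ fun j _ => integrable_annOp hk (hm j) (hl j) ht x)]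
  refine integral_congr_ae (Filter.Eventually.of_forall fun z => ?_)
  beta_reduce
  rw [Finset.prod_add_ordered, mul_add, Finset.mul_sum]
  congr 1
  refine Finset.sum_congr rfl fun j _ => ?_
  congr 1
  rw [← Finset.mul_prod_erase Finset.univ _ (Finset.mem_univ j), mixedTuple_self, mul_assoc]
  congr 1
  have hsplit : Finset.univ.erase j = Finset.univ.filter (· < j) ∪ Finset.univ.filter (j < ·) := by
    ext i; simp [lt_or_lt_iff_ne]
  rw [hsplit, Finset.prod_union]
  · congr 1
    · refine Finset.prod_congr rfl fun i hi => ?_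
      simp only [Finset.mem_filter, Finset.mem_univ, true_and] at hi
      simp [mixedTuple, hi]
    · refine Finset.prod_congr rfl fun i hi => ?_
      simp only [Finset.mem_filter, Finset.mem_univ, true_and] at hi
      simp [mixedTuple, hi.not_gt, hi.ne']
  · rw [Finset.disjoint_filter]
    intro i _ h; exact h.not_gt

lemma prod_update_eq (h : Fin m → Rn n → ℂ) (j : Fin m) (y : Fin m → Rn n) (ζ : Rn n) :
    ∏ i, h i (Function.update y j ζ i) = h j ζ * ∏ i ∈ Finset.univ.erase j, h i (y i) := by
  rw [← Finset.mul_prod_erase Finset.univ _ (Finset.mem_univ j), Function.update_self]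
  congr 1
  refine Finset.prod_congr rfl fun i hi => ?_
  rw [Function.update_of_ne (Finset.ne_of_mem_erase hi)]

lemma sub_update_eq (x : Rn n) (y : Fin m → Rn n) (j : Fin m) (ζ : Rn n) :
    (fun i => x - Function.update y j ζ i) = Function.update (fun i => x - y i) j (x - ζ) := by
  ext1 i
  by_cases hij : i = j
  · subst hij; simp
  · simp [hij]

/-- Integrating first in the j-th variable leaves, after z ↦ x - z, the integral of the kernel in
that variable, which is 0. -/
lemma annOp_eq_zero_of_const (hk : IsAnnular k C γ) {j : Fin m} {c : ℂ} (hj : ∀ z, f j z = c)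
    (t : ℝ) (x : Rn n) : annOp k f t x = 0 := by
  refine integral_eq_zero_of_forall_update j fun y => ?_
  simp_rw [prod_update_eq, hj, sub_update_eq]
  rw [integral_mul_const, integral_sub_left_eq_self
    (fun ζ => k t (Function.update (fun i => x - y i) j ζ)) volume x, hk.vanishing, zero_mul]

/-- Every error term in the expansion has a constant entry and vanishes. The constants are free at
each t and x, which is what makes Campanato norms suffice. -/
lemma annOp_sub_const (hk : IsAnnular k C γ) (hf : ∀ i, Measurable (f i))
    (hl : ∀ i, LocallyIntegrable (f i)) (c : Fin m → ℂ) {t : ℝ} (ht : 0 < t) (x : Rn n) :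
    annOp k f t x = annOp k (fun i z => f i z - c i) t x := by
  have hc : ∀ i, LocallyIntegrable (fun _ : Rn n => c i) := fun i => locallyIntegrable_const _
  have := annOp_add hk (g := fun i z => f i z - c i) (b := fun i _ => c i)
    (fun i => (hf i).sub measurable_const) (fun i => measurable_const)
    (fun i => (hl i).sub (hc i)) hc ht x
  simp only [sub_add_cancel] at this
  rw [this, Finset.sum_eq_zero, add_zero]
  intro j _
  exact annOp_eq_zero_of_const hk (j := j) (c := c j) (fun z => by rw [mixedTuple_self]) t x

lemma blockNorm_sq (T : ℝ) (x : Rn n) : blockNorm k f T x ^ 2 =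
    ∫⁻ t in Ioc T (2 * T), ‖annOp k f t x‖ₑ ^ 2 ∂logMeasure := ennreal_sq_sqrt _

lemma blockNorm_le_of_forall {T : ℝ} (hT : 0 < T) {x : Rn n} {a : ℝ≥0∞}
    (h : ∀ t ∈ Ioc T (2 * T), ‖annOp k f t x‖ₑ ≤ a) : blockNorm k f T x ≤ a := by
  refine ennreal_sqrt_le ?_
  calc _ ≤ ∫⁻ t in Ioc T (2 * T), a ^ 2 ∂logMeasure :=
        setLIntegral_mono' measurableSet_Ioc fun t ht => by gcongr; exact h t ht
    _ = a ^ 2 * logMeasure (Ioc T (2 * T)) := setLIntegral_const _ _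
    _ ≤ a ^ 2 * 1 := by
        gcongr
        refine (logMeasure_Ioc_le hT).trans ?_
        rw [show (2 * T - T) / T = 1 by field_simp; ring, ENNReal.ofReal_one]
    _ = a ^ 2 := mul_one _

lemma prod_ballAvg_le (h : Fin m → Rn n → ℝ≥0∞) {x y : Rn n} {r K : ℝ} (hK : 0 < K)
    (hsub : closedBall x r ⊆ closedBall y (K * r)) :
    ∏ i, ballAvg (h i) x r ≤ (ENNReal.ofReal K ^ n) ^ m * ∏ i, ballAvg (h i) y (K * r) := by
  calc ∏ i, ballAvg (h i) x r ≤ ∏ i, ENNReal.ofReal K ^ n * ballAvg (h i) y (K * r) :=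
        Finset.prod_le_prod' fun i _ => ballAvg_le_of_subset (h i) hK hsub
    _ = _ := by simp [Finset.prod_mul_distrib]

lemma blockNorm_le (hk : IsAnnular k C γ) (hf : ∀ i, Measurable (f i)) {T : ℝ} (hT : 0 < T)
    (x : Rn n) : blockNorm k f T x ≤
      C * ((2 ^ n) ^ m * ∏ i, ballAvg (fun z => ‖f i z‖ₑ) x (2 * T)) := by
  refine blockNorm_le_of_forall hT fun t ht => ?_
  have ht0 : 0 < t := hT.trans ht.1
  refine (enorm_annOp_le hk hf ht0 x).trans ?_
  gcongr
  have h1 : 0 < 2 * T / t := by positivity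
  have e : 2 * T / t * t = 2 * T := by field_simp
  refine (prod_ballAvg_le (fun i z => ‖f i z‖ₑ) (y := x) h1
    (closedBall_subset_closedBall (by rw [e]; exact ht.2))).trans ?_
  rw [e]
  gcongr
  rw [← ENNReal.ofReal_ofNat 2]
  refine ENNReal.ofReal_le_ofReal ?_
  rw [div_le_iff₀ ht0]
  linarith [ht.1]

/-- Minkowski's inequality for differences of the kernel. -/
lemma lintegral_sq_kernel_sub_le (hk : IsAnnular k C γ) {T : ℝ} (hT : 0 < T)
    {p q : (Fin m → Rn n) → Fin m → Rn n} (hp : Measurable p) (hq : Measurable q)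
    {G : (Fin m → Rn n) → ℝ≥0∞} (hG : Measurable G) {S : Set (Fin m → Rn n)}
    (hS : MeasurableSet S) (hpS : ∀ z, ‖p z‖ ≤ 2 * T → z ∈ S) (hqS : ∀ z, ‖q z‖ ≤ 2 * T → z ∈ S) :
    ∫⁻ t in Ioc T (2 * T), (∫⁻ z, ‖k t (p z) - k t (q z)‖ₑ * G z) ^ 2 ∂logMeasure ≤
      (∫⁻ z in S, C * ((ENNReal.ofReal T ^ n)⁻¹) ^ m *
        ENNReal.ofReal (‖p z - q z‖ / T) ^ γ * G z) ^ 2 := by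
  have hm : Measurable (Function.uncurry fun (t : ℝ) (z : Fin m → Rn n) =>
      ‖k t (p z) - k t (q z)‖ₑ * G z) := by
    refine Measurable.mul (Measurable.enorm (Measurable.sub ?_ ?_)) (hG.comp measurable_snd)
    · exact hk.measurable.comp (measurable_fst.prodMk (hp.comp measurable_snd))
    · exact hk.measurable.comp (measurable_fst.prodMk (hq.comp measurable_snd))
  have hw : Measurable fun z => C * ((ENNReal.ofReal T ^ n)⁻¹) ^ m *
        ENNReal.ofReal (‖p z - q z‖ / T) ^ γ * G z := by
    refine Measurable.mul (Measurable.const_mul (Measurable.pow_const ?_ _) _) hG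
    exact ((hp.sub hq).norm.div_const T).ennreal_ofReal
  have hres : ∀ t ∈ Ioc T (2 * T), ∫⁻ z, ‖k t (p z) - k t (q z)‖ₑ * G z ≤
      ∫⁻ z in S, ‖k t (p z) - k t (q z)‖ₑ * G z := by
    intro t ht
    rw [← lintegral_indicator hS]
    refine lintegral_mono fun z => ?_
    by_cases hz : z ∈ S
    · rw [indicator_of_mem hz]
    · have h1 : t < ‖p z‖ := ht.2.trans_lt (not_le.1 fun h => hz (hpS z h))
      have h2 : t < ‖q z‖ := ht.2.trans_lt (not_le.1 fun h => hz (hqS z h))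
      rw [indicator_of_notMem hz, hk.support t _ h1, hk.support t _ h2]
      simp
  refine (setLIntegral_mono' measurableSet_Ioc fun t ht => pow_le_pow_left' (hres t ht) 2).trans ?_
  refine lintegral_sq_lintegral_le _ _ hm hw fun z => ?_
  simp_rw [mul_pow _ (G z)]
  have hkm : Measurable fun t => ‖k t (p z) - k t (q z)‖ₑ ^ 2 := by
    refine Measurable.pow_const (Measurable.enorm (Measurable.sub ?_ ?_)) _
    · exact hk.measurable.comp (measurable_id.prodMk measurable_const)
    · exact hk.measurable.comp (measurable_id.prodMk measurable_const)
  rw [lintegral_mul_const _ hkm]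
  exact mul_le_mul_left (hk.regular T hT _ _) _

lemma blockNorm_le_add {x x' : Rn n} {T : ℝ} {R : ℝ≥0∞} (hm : Measurable fun t => annOp k f t x)
    (hm' : Measurable fun t => annOp k f t x')
    (h : ∫⁻ t in Ioc T (2 * T), ‖annOp k f t x - annOp k f t x'‖ₑ ^ 2 ∂logMeasure ≤ R ^ 2) :
    blockNorm k f T x ≤ blockNorm k f T x' + R := by
  have h1 := ENNReal.lintegral_Lp_add_le (μ := logMeasure.restrict (Ioc T (2 * T))) (p := 2)
    (f := fun t => ‖annOp k f t x'‖ₑ) (g := fun t => ‖annOp k f t x - annOp k f t x'‖ₑ)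
    hm'.enorm.aemeasurable (hm.sub hm').enorm.aemeasurable (by norm_num)
  simp only [Pi.add_apply, ENNReal.rpow_two] at h1
  calc blockNorm k f T x ≤ _ := by
        refine ENNReal.rpow_le_rpow (lintegral_mono fun t => ?_) (by norm_num)
        gcongr
        calc ‖annOp k f t x‖ₑ = ‖annOp k f t x' + (annOp k f t x - annOp k f t x')‖ₑ := by
              rw [add_sub_cancel]
          _ ≤ _ := enorm_add_le _ _
    _ ≤ _ := h1
    _ ≤ _ := by
        gcongr
        · exact le_rfl
        · exact ennreal_sqrt_le h

/-- Regularity of `annOp` in the space variable. -/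
lemma blockNorm_regular [NeZero m] (hk : IsAnnular k C γ) (hf : ∀ i, Measurable (f i))
    (hl : ∀ i, LocallyIntegrable (f i)) {T : ℝ} (hT : 0 < T) {x x' : Rn n} (hx : dist x x' ≤ T) :
    blockNorm k f T x ≤ blockNorm k f T x' + C * ENNReal.ofReal (dist x x' / T) ^ γ *
      ((3 ^ n) ^ m * ∏ i, ballAvg (fun z => ‖f i z‖ₑ) x' (3 * T)) := by
  refine blockNorm_le_add (measurable_annOp_left hk hf x) (measurable_annOp_left hk hf x') ?_
  -- For t ≤ 2T the kernels centred at x and x' see only the balls of radius 2T about them, and both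
  -- lie in B(x', 3T) since dist x x' ≤ T.
  set S : Set (Fin m → Rn n) := univ.pi fun _ : Fin m => closedBall x' (3 * T) with hS
  have hSm : MeasurableSet S := MeasurableSet.univ_pi fun _ => measurableSet_closedBall
  have key := lintegral_sq_kernel_sub_le hk hT (measurable_const_sub (m := m) x)
    (measurable_const_sub (m := m) x') (measurable_prod_enorm hf) hSm
    (fun z hz => by
      rw [sub_pi_mem_iff (by positivity)] at hz
      intro i hi
      have := hz i hi
      rw [mem_closedBall] at this ⊢
      have := dist_triangle (z i) x x'
      linarith)
    (fun z hz => by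
      rw [sub_pi_mem_iff (by positivity)] at hz
      intro i hi
      exact closedBall_subset_closedBall (by linarith) (hz i hi))
  have hpq : ∀ z : Fin m → Rn n, ‖(fun i => x - z i) - (fun i => x' - z i)‖ = dist x x' := by
    intro z
    have : ((fun i => x - z i) - fun i => x' - z i) = fun _ : Fin m => x - x' := by
      ext1 i; simp
    rw [this, dist_eq_norm]
    exact pi_norm_const _
  refine (setLIntegral_mono' measurableSet_Ioc fun t ht => ?_).trans (key.trans (le_of_eq ?_))
  · have ht0 : 0 < t := hT.trans ht.1
    gcongr
    unfold annOp
    rw [← integral_sub (integrable_annOp hk hf hl ht0 x) (integrable_annOp hk hf hl ht0 x')]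
    refine (enorm_integral_le_lintegral_enorm _).trans (le_of_eq ?_)
    refine lintegral_congr fun z => ?_
    rw [← sub_mul, enorm_mul]
    congr 1
    exact enorm_finsetProd _ _
  · simp_rw [hpq]
    congr 1
    rw [lintegral_const_mul _ (measurable_prod_enorm hf),
      setLIntegral_fin_prod_eq_prod (fun i z => ‖f i z‖ₑ) (fun i => (hf i).enorm) _
        (fun _ => measurableSet_closedBall)]
    unfold ballAvg
    have h3 : ((3 : ℝ≥0∞) ^ n) ^ m * ((3 ^ n)⁻¹) ^ m = 1 := by
      rw [← mul_pow, ENNReal.mul_inv_cancel (by simp) (by simp), one_pow]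
    rw [Finset.prod_mul_distrib, Finset.prod_const, Finset.card_univ, Fintype.card_fin,
      ENNReal.ofReal_mul (by norm_num), ENNReal.ofReal_ofNat, mul_pow,
      ENNReal.mul_inv (Or.inl (by simp)) (Or.inl (by simp)), mul_pow]
    generalize ∏ i, ∫⁻ z in closedBall x' (3 * T), ‖f i z‖ₑ = P
    rw [← mul_one (_ * P), ← h3]
    ring

/-- The gain coming from the cancellation of one of the functions. -/
lemma blockNorm_le_of_cancel (hk : IsAnnular k C γ) (hγ : 0 ≤ γ) (hf : ∀ i, Measurable (f i))
    (hi : ∀ i, Integrable (f i)) (j : Fin m) {π : Rn n → Rn n} (hπ : Measurable π)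
    (hcan : ∀ φ : Rn n → ℂ, Measurable φ → (∃ B, ∀ z, ‖φ z‖ ≤ B) → ∫ z, φ (π z) * f j z = 0)
    {T : ℝ} (hT : 0 < T) (x : Rn n) {S : Set (Rn n)} (hS : MeasurableSet S)
    (hS1 : ∀ z, f j z ≠ 0 → z ∈ closedBall x (2 * T) ∨ π z ∈ closedBall x (2 * T) → z ∈ S) :
    blockNorm k f T x ≤ C * (2 ^ n) ^ m *
      ((∏ i ∈ Finset.univ.erase j, ballAvg (fun z => ‖f i z‖ₑ) x (2 * T)) *
        ((ENNReal.ofReal T ^ n)⁻¹ *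
          ∫⁻ z in S, ENNReal.ofReal (dist (π z) z / T) ^ γ * ‖f j z‖ₑ)) := by
  set g : Fin m → Rn n → ℝ≥0∞ := Function.update (fun i z => ‖f i z‖ₑ) j
    fun z => ENNReal.ofReal (dist (π z) z / T) ^ γ * ‖f j z‖ₑ with hg
  have hdist : Measurable fun z => ENNReal.ofReal (dist (π z) z / T) ^ γ :=
    ((hπ.dist measurable_id).div_const T).ennreal_ofReal.pow_const γ
  have hgm : ∀ i, Measurable (g i) := by
    intro i
    by_cases hij : i = j
    · subst hij; simp only [hg, Function.update_self]; exact hdist.mul (hf i).enorm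
    · simp only [hg, Function.update_of_ne hij]; exact (hf i).enorm
  -- `S` is only known to catch points where f_j ≠ 0. Adding the zero set of f_j makes the product
  -- set contain the support of both kernels, at no cost in the integral.
  set S' : Fin m → Set (Rn n) := Function.update (fun _ => closedBall x (2 * T)) j
    (S ∪ {z | f j z = 0}) with hS'
  have hZ : MeasurableSet {z | f j z = 0} := hf j (measurableSet_singleton 0)
  have hS'm : ∀ i, MeasurableSet (S' i) := by
    intro i
    by_cases hij : i = j
    · subst hij; simp only [hS', Function.update_self]; exact hS.union hZ
    · simp only [hS', Function.update_of_ne hij]; exact measurableSet_closedBall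
  set q : (Fin m → Rn n) → Fin m → Rn n := fun z => Function.update z j (π (z j)) with hq
  have hqm : Measurable q := by
    refine measurable_pi_lambda _ fun i => ?_
    by_cases hij : i = j
    · subst hij; simp only [hq, Function.update_self]; exact hπ.comp (measurable_pi_apply i)
    · simp only [hq, Function.update_of_ne hij]; exact measurable_pi_apply i
  have hxq : Measurable fun (z : Fin m → Rn n) i => x - q z i := (measurable_const_sub x).comp hqm
  have hmem : ∀ z : Fin m → Rn n, (∀ i, i ≠ j → z i ∈ closedBall x (2 * T)) →
      (z j ∈ closedBall x (2 * T) ∨ π (z j) ∈ closedBall x (2 * T)) → z ∈ univ.pi S' := by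
    intro z h1 h2 i _
    by_cases hij : i = j
    · subst hij
      simp only [hS', Function.update_self]
      by_cases h0 : f i (z i) = 0
      · exact Or.inr h0
      · exact Or.inl (hS1 _ h0 h2)
    · simp only [hS', Function.update_of_ne hij]; exact h1 i hij
  have key := lintegral_sq_kernel_sub_le hk hT (measurable_const_sub (m := m) x) hxq
    (measurable_prod_enorm hf) (MeasurableSet.univ_pi hS'm)
    (fun z hz => by
      rw [sub_pi_mem_iff (by positivity)] at hz
      exact hmem z (fun i _ => hz i (mem_univ i)) (Or.inl (hz j (mem_univ j))))
    (fun z hz => by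
      rw [sub_pi_mem_iff (by positivity)] at hz
      refine hmem z (fun i hij => ?_) (Or.inr ?_)
      · simpa [hq, hij] using hz i (mem_univ i)
      · simpa [hq] using hz j (mem_univ j))
  have hprod : Integrable fun z : Fin m → Rn n => ∏ i, f i (z i) :=
    Integrable.fintype_prod (μ := fun _ => (volume : Measure (Rn n))) hi
  -- With the j-th variable replaced by π(z_j), the kernel depends on z_j only through π, so `hcan`
  -- annihilates it. It may thus be subtracted from the kernel of `annOp`.
  have hzero : ∀ t, 0 < t → ∫ z : Fin m → Rn n, k t (fun i => x - q z i) * ∏ i, f i (z i) = 0 := by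
    intro t ht
    refine integral_eq_zero_of_forall_update j fun y => ?_
    simp_rw [prod_update_eq, hq, Function.update_idem, Function.update_self, ← mul_assoc]
    rw [integral_mul_const]
    rw [hcan (fun w => k t (fun i => x - Function.update y j w i)), zero_mul]
    · exact (hk.measurable_comp t (measurable_const_sub x)).comp (measurable_update y)
    · refine ⟨(C * ((ENNReal.ofReal t ^ n)⁻¹) ^ m).toReal, fun z => ?_⟩
      rw [← toReal_enorm]
      exact ENNReal.toReal_mono (ENNReal.mul_ne_top ENNReal.coe_ne_top (ENNReal.pow_ne_top
        (ENNReal.inv_ne_top.2 (ofReal_pow_ne_zero ht)))) (hk.size t ht _)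
  have hdiff : ∀ t ∈ Ioc T (2 * T), ‖annOp k f t x‖ₑ ≤ ∫⁻ z : Fin m → Rn n,
      ‖k t (fun i => x - z i) - k t (fun i => x - q z i)‖ₑ * ∏ i, ‖f i (z i)‖ₑ := by
    intro t ht
    have ht0 : 0 < t := hT.trans ht.1
    have hint : Integrable fun z : Fin m → Rn n => k t (fun i => x - q z i) * ∏ i, f i (z i) := by
      refine hprod.bdd_mul (hk.measurable_comp t hxq).aestronglyMeasurable
        (c := (C * ((ENNReal.ofReal t ^ n)⁻¹) ^ m).toReal)
        (Filter.Eventually.of_forall fun z => ?_)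
      rw [← toReal_enorm]
      exact ENNReal.toReal_mono (ENNReal.mul_ne_top ENNReal.coe_ne_top (ENNReal.pow_ne_top
          (ENNReal.inv_ne_top.2 (ofReal_pow_ne_zero ht0)))) (hk.size t ht0 _)
    have e : annOp k f t x = ∫ z : Fin m → Rn n, (k t (fun i => x - z i) * ∏ i, f i (z i) -
        k t (fun i => x - q z i) * ∏ i, f i (z i)) := by
      rw [integral_sub (integrable_annOp hk hf (fun i => (hi i).locallyIntegrable) ht0 x) hint,
        hzero t ht0, sub_zero, annOp]
    rw [e]
    refine (enorm_integral_le_lintegral_enorm _).trans (le_of_eq (lintegral_congr fun z => ?_))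
    rw [← sub_mul, enorm_mul, enorm_finsetProd]
  refine ennreal_sqrt_le ((setLIntegral_mono' measurableSet_Ioc fun t ht =>
    pow_le_pow_left' (hdiff t ht) 2).trans (key.trans (pow_le_pow_left' ?_ 2)))
  have hnorm : ∀ z : Fin m → Rn n, ‖(fun i => x - z i) - fun i => x - q z i‖ ≤ dist (π (z j)) (z j) := by
    intro z
    refine (pi_norm_le_iff_of_nonneg dist_nonneg).2 fun i => ?_
    by_cases hij : i = j
    · subst hij; simp [hq, dist_eq_norm]
    · simp [hq, hij]
  have hS'j : ∫⁻ z in S' j, g j z ≤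
      ∫⁻ z in S, ENNReal.ofReal (dist (π z) z / T) ^ γ * ‖f j z‖ₑ := by
    simp only [hS', hg, Function.update_self]
    refine (lintegral_union_le _ _ _).trans ?_
    have : ∫⁻ z in {z | f j z = 0}, ENNReal.ofReal (dist (π z) z / T) ^ γ * ‖f j z‖ₑ = 0 := by
      refine (setLIntegral_congr_fun hZ fun z hz => ?_).trans lintegral_zero
      rw [show f j z = 0 from hz]; simp
    rw [this, add_zero]
  have hother : ∀ i ∈ Finset.univ.erase j, ∫⁻ z in S' i, g i z =
      ENNReal.ofReal T ^ n * (2 ^ n * ballAvg (fun z => ‖f i z‖ₑ) x (2 * T)) := by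
    intro i hij
    have hij := Finset.ne_of_mem_erase hij
    simp only [hS', hg, Function.update_of_ne hij]
    rw [setLIntegral_closedBall_eq _ _ (by positivity), ENNReal.ofReal_mul (by norm_num),
      ENNReal.ofReal_ofNat, mul_pow]
    ring
  calc _ ≤ ∫⁻ z in univ.pi S', C * ((ENNReal.ofReal T ^ n)⁻¹) ^ m * ∏ i, g i (z i) := by
        refine lintegral_mono fun z => ?_
        rw [mul_assoc ((C : ℝ≥0∞) * _)]
        refine mul_le_mul_right ?_ _
        rw [← Finset.mul_prod_erase Finset.univ _ (Finset.mem_univ j),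
          ← Finset.mul_prod_erase Finset.univ _ (Finset.mem_univ j), ← mul_assoc]
        simp only [hg, Function.update_self]
        refine mul_le_mul' ?_ (le_of_eq ?_)
        · gcongr
          exact hnorm z
        · exact Finset.prod_congr rfl fun i hi => by
            rw [Function.update_of_ne (Finset.ne_of_mem_erase hi)]
    _ = C * ((ENNReal.ofReal T ^ n)⁻¹) ^ m * ((∫⁻ z in S' j, g j z) *
          ∏ i ∈ Finset.univ.erase j, ∫⁻ z in S' i, g i z) := by
        rw [lintegral_const_mul _ (show Measurable fun z : Fin m → Rn n => ∏ i, g i (z i) from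
            Finset.measurable_prod _ fun i _ => (hgm i).comp (measurable_pi_apply i)),
          setLIntegral_fin_prod_eq_prod g hgm _ hS'm, ← Finset.mul_prod_erase Finset.univ _
            (Finset.mem_univ j)]
    _ ≤ C * ((ENNReal.ofReal T ^ n)⁻¹) ^ m *
        ((∫⁻ z in S, ENNReal.ofReal (dist (π z) z / T) ^ γ * ‖f j z‖ₑ) *
          ((ENNReal.ofReal T ^ n) ^ (m - 1) * (2 ^ n) ^ m *
            ∏ i ∈ Finset.univ.erase j, ballAvg (fun z => ‖f i z‖ₑ) x (2 * T))) := by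
        gcongr
        rw [Finset.prod_congr rfl hother, Finset.prod_mul_distrib, Finset.prod_mul_distrib]
        simp only [Finset.prod_const, Finset.card_erase_of_mem (Finset.mem_univ j),
          Finset.card_univ, Fintype.card_fin]
        rw [← mul_assoc]
        gcongr
        · exact one_le_pow₀ one_le_two
        · omega
    _ = _ := by
        have hm1 : m = (m - 1) + 1 := (Nat.sub_add_cancel (Fin.pos j)).symm
        have hc : ((ENNReal.ofReal T ^ n)⁻¹) ^ m * (ENNReal.ofReal T ^ n) ^ (m - 1) =
            (ENNReal.ofReal T ^ n)⁻¹ := by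
          conv_lhs => rw [hm1, pow_succ, Nat.add_sub_cancel, mul_right_comm, ← mul_pow,
            ENNReal.inv_mul_cancel (ofReal_pow_ne_zero hT) ofReal_pow_ne_top, one_pow, one_mul]
        generalize ∏ i ∈ Finset.univ.erase j, ballAvg (fun z => ‖f i z‖ₑ) x (2 * T) = P
        generalize ∫⁻ z in S, ENNReal.ofReal (dist (π z) z / T) ^ γ * ‖f j z‖ₑ = I
        generalize (ENNReal.ofReal T ^ n)⁻¹ = a at *
        calc _ = C * (2 ^ n) ^ m * (P * ((a ^ m * (ENNReal.ofReal T ^ n) ^ (m - 1)) * I)) := by ring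
          _ = _ := by rw [hc]

end Operator

/-! ### Comparison of the Marcinkiewicz integral with the annular square function. -/

/-- The square function associated with `annOp`. -/
def sqFn {n m : ℕ} (k : ℝ → (Fin m → Rn n) → ℂ) (f : Fin m → Rn n → ℂ) (x : Rn n) : ℝ≥0∞ :=
  (∫⁻ t, ‖annOp k f t x‖ₑ ^ 2 ∂logMeasure) ^ (1 / 2 : ℝ)

/-- The averages of `g` over small balls centred at `x` are bounded. -/
def LocBdd {n : ℕ} (g : Rn n → ℂ) (x : Rn n) : Prop :=
  ∀ R : ℝ, ∃ M : ℝ≥0∞, M ≠ ∞ ∧ ∀ r, 0 < r → r ≤ R → ballAvg (fun z => ‖g z‖ₑ) x r ≤ M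

section Bridge

variable {n m : ℕ} {Ω : (Fin m → Rn n) → ℂ} {C : ℝ≥0} {γ : ℝ} {f : Fin m → Rn n → ℂ}

instance : (volume : Measure (Fin m → Rn n)).IsNegInvariant := by
  exact ⟨(measurePreserving_pi (fun _ => (volume : Measure (Rn n))) (fun _ => volume)
    (fun _ => Measure.measurePreserving_neg volume)).map_eq⟩

lemma ennreal_add_sq_le (a b : ℝ≥0∞) : (a + b) ^ 2 ≤ 2 * (a ^ 2 + b ^ 2) := by
  have := ENNReal.rpow_add_le_mul_rpow_add_rpow a b (one_le_two (α := ℝ))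
  simp only [ENNReal.rpow_two] at this
  norm_num at this
  exact this

lemma ballAvg_le_of_ae_le {h : Rn n → ℝ≥0∞} {B : ℝ≥0∞} (hB : ∀ᵐ z, h z ≤ B) (x : Rn n) {r : ℝ}
    (hr : 0 < r) : ballAvg h x r ≤ B * unitVol n := by
  rw [← ballAvg_const B x hr]
  unfold ballAvg
  exact mul_le_mul_right (lintegral_mono_ae (ae_restrict_of_ae hB)) _

lemma locBdd_of_ae_bdd {g : Rn n → ℂ} {B : ℝ≥0∞} (hBt : B ≠ ∞) (hB : ∀ᵐ z, ‖g z‖ₑ ≤ B)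
    (x : Rn n) : LocBdd g x :=
  fun _ => ⟨B * unitVol n, ENNReal.mul_ne_top hBt unitVol_ne_top, fun _ hr _ =>
    ballAvg_le_of_ae_le hB x hr⟩

/-- At a Lebesgue point the averages over small balls are bounded by 1 plus |g(x)|, up to the volume
of the unit ball; for larger radii up to R, the integral over B(x,R) suffices. -/
lemma ae_locBdd {g : Rn n → ℂ} (hg : LocallyIntegrable g) : ∀ᵐ x, LocBdd g x := by
  filter_upwards [IsUnifLocDoublingMeasure.ae_tendsto_average_norm_sub volume hg 1] with x hx
  have h1 := hx (fun _ : ℝ => x) (fun r => r) (l := nhdsWithin 0 (Ioi 0)) Filter.tendsto_id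
    (by
      filter_upwards [self_mem_nhdsWithin] with r hr
      exact mem_closedBall_self (by rw [one_mul]; exact le_of_lt hr))
  have h2 := h1.eventually (gt_mem_nhds one_pos)
  obtain ⟨d, hd, hdlt⟩ := (mem_nhdsGT_iff_exists_Ioo_subset).1 h2
  have hd : 0 < d := hd
  intro R
  refine ⟨max (((1 + ‖g x‖ₑ)) * unitVol n)
    ((ENNReal.ofReal (d / 2) ^ n)⁻¹ * ∫⁻ z in closedBall x R, ‖g z‖ₑ), ?_, fun r hr hrR => ?_⟩
  · refine (max_lt ?_ ?_).ne
    · exact ENNReal.mul_lt_top (ENNReal.add_lt_top.2 ⟨ENNReal.one_lt_top, enorm_lt_top⟩)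
        unitVol_ne_top.lt_top
    · exact ENNReal.mul_lt_top (ENNReal.inv_lt_top.2 (ofReal_pow_ne_zero (by positivity)).bot_lt)
        (hg.integrableOn_isCompact (isCompact_closedBall x R)).2
  · by_cases hrd : r < d
    · refine le_max_of_le_left ?_
      have h3 : ⨍ y in closedBall x r, ‖g y - g x‖ < 1 := hdlt ⟨hr, hrd⟩
      have hio : IntegrableOn (fun y => g y - g x) (closedBall x r) :=
        (hg.integrableOn_isCompact (isCompact_closedBall x r)).sub
          (integrableOn_const measure_closedBall_lt_top.ne)
      have hv0 : volume (closedBall x r) ≠ 0 := (measure_closedBall_pos volume x hr).ne'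
      have hvt : volume (closedBall x r) ≠ ∞ := measure_closedBall_lt_top.ne
      have hpos : 0 < volume.real (closedBall x r) := ENNReal.toReal_pos hv0 hvt
      have h4 : ∫⁻ y in closedBall x r, ‖g y - g x‖ₑ ≤ volume (closedBall x r) := by
        rw [setAverage_eq, smul_eq_mul, inv_mul_lt_iff₀ hpos, mul_one] at h3
        have h5 := ofReal_integral_norm_eq_lintegral_enorm hio
        rw [← h5, ← ENNReal.ofReal_toReal hvt]
        exact ENNReal.ofReal_le_ofReal h3.le
      calc ballAvg (fun z => ‖g z‖ₑ) x r
          ≤ (ENNReal.ofReal r ^ n)⁻¹ * ∫⁻ z in closedBall x r, (‖g z - g x‖ₑ + ‖g x‖ₑ) := by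
            unfold ballAvg
            gcongr with z
            calc ‖g z‖ₑ = ‖(g z - g x) + g x‖ₑ := by rw [sub_add_cancel]
              _ ≤ _ := enorm_add_le _ _
        _ ≤ (ENNReal.ofReal r ^ n)⁻¹ * (volume (closedBall x r) +
              ‖g x‖ₑ * volume (closedBall x r)) := by
            gcongr
            rw [lintegral_add_right _ measurable_const, setLIntegral_const]
            gcongr
        _ = _ := by
            rw [volume_closedBall_eq x hr.le, ← one_add_mul, mul_left_comm, ← mul_assoc,
              ← mul_assoc, mul_assoc (1 + ‖g x‖ₑ),
              ENNReal.inv_mul_cancel (ofReal_pow_ne_zero hr) ofReal_pow_ne_top, mul_one]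
    · refine le_max_of_le_right ?_
      unfold ballAvg
      gcongr
      · linarith

lemma mem_ballPow_iff {t : ℝ} (ht : 0 ≤ t) {y : Fin m → Rn n} : y ∈ ballPow n m t ↔ ‖y‖ ≤ t := by
  rw [pi_norm_le_iff_of_nonneg ht]
  simp [ballPow]

/-- The annulus `t / 2 < max |yᵢ| ≤ t`. -/
def annulus (n m : ℕ) (t : ℝ) : Set (Fin m → Rn n) := {y | t / 2 < ‖y‖ ∧ ‖y‖ ≤ t}

lemma measurableSet_annulus (t : ℝ) : MeasurableSet (annulus n m t) :=
  (measurableSet_lt (f := fun _ : Fin m → Rn n => t / 2) (g := fun a => ‖a‖)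
    (by fun_prop) (by fun_prop)).inter
    (measurableSet_le (f := fun a : Fin m → Rn n => ‖a‖) (g := fun _ => t)
    (by fun_prop) (by fun_prop))

lemma annularKernel_mul_eq (f : Fin m → Rn n → ℂ) (x : Rn n) (t : ℝ) (y : Fin m → Rn n) :
    annularKernel Ω t y * ∏ i, f i (x - y i) =
      (((t ^ m)⁻¹ : ℝ) : ℂ) * (annulus n m t).indicator (integrand Ω f x) y := by
  unfold annularKernel integrand
  by_cases h : t / 2 < ‖y‖ ∧ ‖y‖ ≤ t
  · rw [if_pos h, indicator_of_mem (show y ∈ annulus n m t from h)]; ring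
  · rw [if_neg h, indicator_of_notMem (show y ∉ annulus n m t from h)]; ring

lemma annOp_eq_setIntegral (f : Fin m → Rn n → ℂ) (x : Rn n) (t : ℝ) :
    annOp (annularKernel Ω) f t x =
      (((t ^ m)⁻¹ : ℝ) : ℂ) * ∫ y in annulus n m t, integrand Ω f x y := by
  rw [← integral_indicator (measurableSet_annulus t), ← integral_const_mul]
  simp_rw [← annularKernel_mul_eq]
  unfold annOp
  rw [← integral_sub_left_eq_self
    (fun y : Fin m → Rn n => annularKernel Ω t y * ∏ i, f i (x - y i)) volume (fun _ => x)]
  simp [Pi.sub_def]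

lemma setLIntegral_annulus_le (hk : IsAnnular (annularKernel Ω) C γ) (hf : ∀ i, Measurable (f i))
    {t : ℝ} (ht : 0 < t) (x : Rn n) : ∫⁻ y in annulus n m t, ‖integrand Ω f x y‖ₑ ≤
      ENNReal.ofReal (t ^ m) * (C * ∏ i, ballAvg (fun z => ‖f i z‖ₑ) x t) := by
  refine le_trans (le_of_eq ?_) (mul_le_mul_right (lintegral_annOp_le hk hf ht x) _)
  have e : ∫⁻ z : Fin m → Rn n, ‖annularKernel Ω t (fun i => x - z i) * ∏ i, f i (z i)‖ₑ =
      ∫⁻ y : Fin m → Rn n, ‖annularKernel Ω t y * ∏ i, f i (x - y i)‖ₑ := by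
    rw [← lintegral_sub_left_eq_self
      (fun y : Fin m → Rn n => ‖annularKernel Ω t y * ∏ i, f i (x - y i)‖ₑ) (fun _ => x)]
    simp [Pi.sub_def]
  rw [e, ← lintegral_const_mul' _ _ ENNReal.ofReal_ne_top,
    ← lintegral_indicator (measurableSet_annulus t)]
  refine lintegral_congr fun y => ?_
  rw [annularKernel_mul_eq, enorm_mul, ← mul_assoc, ← ofReal_norm (((t ^ m)⁻¹ : ℝ) : ℂ),
    Complex.norm_real, Real.norm_of_nonneg (by positivity), ← ENNReal.ofReal_mul (by positivity),
    mul_inv_cancel₀ (by positivity), ENNReal.ofReal_one, one_mul, enorm_indicator_eq_indicator_enorm]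

lemma measurable_integrand (hΩ : Measurable Ω) (hf : ∀ i, Measurable (f i)) :
    Measurable fun a : Rn n × (Fin m → Rn n) => integrand Ω f a.1 a.2 := by
  unfold integrand
  have hsn : Measurable fun a : Rn n × (Fin m → Rn n) => sumNorm a.2 :=
    continuous_sumNorm.measurable.comp measurable_snd
  refine ((hΩ.comp measurable_snd).div (Complex.measurable_ofReal.comp (hsn.pow_const _))).mul
    (Finset.measurable_prod _ fun i _ => (hf i).comp ?_)
  exact measurable_fst.sub ((measurable_pi_apply i).comp measurable_snd)

lemma ballPow_eq_iUnion {t : ℝ} (ht : 0 < t) :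
    ballPow n m t = {0} ∪ ⋃ k : ℕ, annulus n m ((1 / 2) ^ k * t) := by
  ext y
  rw [mem_ballPow_iff ht.le]
  simp only [mem_union, mem_singleton_iff, mem_iUnion]
  constructor
  · intro h
    by_cases hy : y = 0
    · exact Or.inl hy
    · right
      have hy' : 0 < ‖y‖ / t := div_pos (norm_pos_iff.2 hy) ht
      obtain ⟨k, hk1, hk2⟩ := exists_nat_pow_near_of_lt_one hy' ((div_le_one ht).2 h)
        (by norm_num : (0 : ℝ) < 1 / 2) (by norm_num)
      rw [lt_div_iff₀ ht] at hk1
      rw [div_le_iff₀ ht] at hk2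
      exact ⟨k, by rw [pow_succ] at hk1; linarith, hk2⟩
  · rintro (rfl | ⟨k, hk⟩)
    · simpa using ht.le
    · refine hk.2.trans ?_
      have : (1 / 2 : ℝ) ^ k ≤ 1 := pow_le_one₀ (by norm_num) (by norm_num)
      nlinarith

lemma pairwise_disjoint_annulus {t : ℝ} (ht : 0 < t) :
    Pairwise (Function.onFun Disjoint fun k : ℕ => annulus n m ((1 / 2) ^ k * t)) := by
  have key : ∀ a b : ℕ, a < b → Disjoint (annulus n m ((1 / 2) ^ a * t))
      (annulus n m ((1 / 2) ^ b * t)) := fun a b hab => by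
    have h1 : (1 / 2 : ℝ) ^ b ≤ (1 / 2) ^ (a + 1) :=
      pow_le_pow_of_le_one (by norm_num) (by norm_num) hab
    rw [pow_succ] at h1
    refine Set.disjoint_left.2 fun y hy hy' => absurd (hy.1.trans_le hy'.2) (not_lt.2 ?_)
    nlinarith
  intro a b hab
  rcases lt_or_gt_of_ne hab with h | h
  · exact key a b h
  · exact (key b a h).symm

/-- The annulus of radius 2^{-k} t contributes O(2^{-km} t^m) once the small averages of the f_i at
x are bounded, and m ≥ 1 makes the series converge. This is where `LocBdd`, hence "almost every x",
enters. -/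
lemma integrableOn_integrand [NeZero n] [NeZero m] (hΩ : Measurable Ω)
    (hk : IsAnnular (annularKernel Ω) C γ)
    (hf : ∀ i, Measurable (f i)) {x : Rn n} (hx : ∀ i, LocBdd (f i) x) {t : ℝ} (ht : 0 < t) :
    IntegrableOn (integrand Ω f x) (ballPow n m t) := by
  have : Nonempty (Fin n) := ⟨0⟩
  have : Nonempty (Fin m) := ⟨0⟩
  refine ⟨((measurable_integrand hΩ hf).comp
    (measurable_const.prodMk measurable_id)).aestronglyMeasurable, ?_⟩
  choose M hM hMle using fun i => hx i t
  set P : ℝ≥0∞ := C * ∏ i, M i with hP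
  have hPt : P ≠ ∞ := ENNReal.mul_ne_top ENNReal.coe_ne_top
    (ENNReal.prod_ne_top fun i _ => hM i)
  have hterm : ∀ k : ℕ, ∫⁻ y in annulus n m ((1 / 2) ^ k * t), ‖integrand Ω f x y‖ₑ ≤
      ENNReal.ofReal (t ^ m) * P * (1 / 2) ^ k := by
    intro k
    have hkt : 0 < (1 / 2 : ℝ) ^ k * t := by positivity
    have hk1 : (1 / 2 : ℝ) ^ k ≤ 1 := pow_le_one₀ (by norm_num) (by norm_num)
    calc _ ≤ ENNReal.ofReal (((1 / 2) ^ k * t) ^ m) * P := by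
          refine (setLIntegral_annulus_le hk hf hkt x).trans ?_
          rw [hP]
          gcongr with i
          exact hMle i _ hkt (by nlinarith)
      _ ≤ ENNReal.ofReal ((1 / 2) ^ k * t ^ m) * P := by
          gcongr
          rw [mul_pow]
          gcongr
          exact pow_le_of_le_one (by positivity) hk1 (NeZero.ne m)
      _ = _ := by
          rw [ENNReal.ofReal_mul (by positivity), ENNReal.ofReal_pow (by norm_num),
            ENNReal.ofReal_div_of_pos (by norm_num)]
          simp; ring
  have h0 : (volume : Measure (Fin m → Rn n)) {0} = 0 := by
    have : (volume : Measure (Fin m → Rn n)).IsAddHaarMeasure := inferInstance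
    exact measure_singleton 0
  change ∫⁻ y in ballPow n m t, ‖integrand Ω f x y‖ₑ < ∞
  rw [ballPow_eq_iUnion ht]
  calc _ ≤ _ := lintegral_union_le _ _ _
    _ ≤ 0 + ∑' k : ℕ, ENNReal.ofReal (t ^ m) * P * (1 / 2) ^ k := by
        gcongr
        · rw [Measure.restrict_eq_zero.2 h0, lintegral_zero_measure]
        · rw [lintegral_iUnion (fun k => measurableSet_annulus _) (pairwise_disjoint_annulus ht)]
          exact ENNReal.tsum_le_tsum hterm
    _ = ENNReal.ofReal (t ^ m) * P * 2 := by
        rw [ENNReal.tsum_mul_left, zero_add, one_div, ENNReal.tsum_geometric,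
          ENNReal.one_sub_inv_two, inv_inv]
    _ < ∞ := ENNReal.mul_lt_top (ENNReal.mul_lt_top ENNReal.ofReal_lt_top hPt.lt_top) (by simp)

/-- Splitting B(0,t)^m minus the origin into annuli of radii 2^{-k} t; the weight 2^{-km}
compensates the normalisation (2^{-k} t)^{-m} of the annular kernel. -/
lemma hasSum_F [NeZero n] [NeZero m] {x : Rn n} {t : ℝ} (ht : 0 < t)
    (hi : IntegrableOn (integrand Ω f x) (ballPow n m t)) :
    HasSum (fun k : ℕ => ((((1 / 2) ^ k) ^ m : ℝ) : ℂ) *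
      annOp (annularKernel Ω) f ((1 / 2) ^ k * t) x) (F Ω t f x) := by
  have : Nonempty (Fin n) := ⟨0⟩
  have : Nonempty (Fin m) := ⟨0⟩
  have h0 : ∀ᵐ y : Fin m → Rn n, y ≠ 0 := by
    have : (volume : Measure (Fin m → Rn n)).IsAddHaarMeasure := inferInstance
    simp [ae_iff]
  have hae : ballPow n m t =ᵐ[volume] ⋃ k : ℕ, annulus n m ((1 / 2) ^ k * t) := by
    filter_upwards [h0] with y hy
    rw [ballPow_eq_iUnion ht]
    exact propext ⟨fun h => h.resolve_left hy, Or.inr⟩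
  have hs := hasSum_integral_iUnion (f := integrand Ω f x) (μ := volume)
    (fun k : ℕ => measurableSet_annulus ((1 / 2) ^ k * t)) (pairwise_disjoint_annulus ht)
    (hi.congr_set_ae hae.symm)
  rw [← setIntegral_congr_set hae] at hs
  have := hs.mul_left ((((t ^ m)⁻¹ : ℝ) : ℂ))
  unfold F
  refine (congrArg (fun u : ℕ → ℂ => HasSum u _) (funext fun k => ?_)).mpr this
  rw [annOp_eq_setIntegral, ← mul_assoc, ← Complex.ofReal_mul]
  congr 2
  rw [mul_pow]; field_simp

lemma marcinkiewicz_eq (f : Fin m → Rn n → ℂ) (x : Rn n) : marcinkiewicz Ω f x =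
    (∫⁻ t, ‖F Ω t f x‖ₑ ^ 2 ∂logMeasure) ^ (1 / 2 : ℝ) := by
  rw [lintegral_logMeasure]; rfl

/-- Minkowski in L²(dt/t) for the series of `hasSum_F`, with counting measure in k. Each dilate has
the same norm as `sqFn`, and the weights are at most 2^{-k}, with sum 2. -/
lemma marcinkiewicz_le_sqFn [NeZero n] [NeZero m] (hk : IsAnnular (annularKernel Ω) C γ)
    (hf : ∀ i, Measurable (f i)) {x : Rn n}
    (hi : ∀ t, 0 < t → IntegrableOn (integrand Ω f x) (ballPow n m t)) :
    marcinkiewicz Ω f x ≤ 2 * sqFn (annularKernel Ω) f x := by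
  rw [marcinkiewicz_eq]
  have hpt : ∀ᵐ t ∂logMeasure, ‖F Ω t f x‖ₑ ^ 2 ≤
      (∫⁻ k : ℕ, (1 / 2) ^ k * ‖annOp (annularKernel Ω) f ((1 / 2) ^ k * t) x‖ₑ
        ∂Measure.count) ^ 2 := by
    filter_upwards [ae_logMeasure_pos] with t ht
    gcongr
    rw [lintegral_count, ← (hasSum_F ht (hi t ht)).tsum_eq]
    refine enorm_tsum_le_tsum_enorm.trans (ENNReal.tsum_le_tsum fun k => ?_)
    rw [enorm_mul]
    gcongr
    rw [← ofReal_norm, Complex.norm_real, Real.norm_of_nonneg (by positivity)]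
    have h2 : ((1 / 2 : ℝ≥0∞)) ^ k = ENNReal.ofReal ((1 / 2) ^ k) := by
      rw [ENNReal.ofReal_pow (by norm_num), ENNReal.ofReal_div_of_pos (by norm_num)]
      simp
    rw [h2]
    exact ENNReal.ofReal_le_ofReal (pow_le_of_le_one (by positivity)
      (pow_le_one₀ (by norm_num) (by norm_num)) (NeZero.ne m))
  refine ennreal_sqrt_le ((lintegral_mono_ae hpt).trans ?_)
  have hm := measurable_annOp_left hk hf x
  refine (lintegral_sq_lintegral_le logMeasure (Measure.count : Measure ℕ)
    (w := fun k => (1 / 2) ^ k * sqFn (annularKernel Ω) f x) ?_ (measurable_of_countable _)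
    fun k => ?_).trans ?_
  · refine measurable_from_prod_countable_left fun k => ?_
    exact (show Measurable fun t => ‖annOp (annularKernel Ω) f ((1 / 2) ^ k * t) x‖ₑ from
      (hm.comp (measurable_const_mul ((1 / 2) ^ k))).enorm).const_mul ((1 / 2) ^ k)
  · simp_rw [mul_pow _ (enorm _)]
    rw [lintegral_const_mul _ (show Measurable fun t =>
        ‖annOp (annularKernel Ω) f ((1 / 2) ^ k * t) x‖ₑ ^ 2 from
        (hm.comp (measurable_const_mul ((1 / 2) ^ k))).enorm.pow_const 2),
      lintegral_logMeasure_comp_mul (fun t => ‖annOp (annularKernel Ω) f t x‖ₑ ^ 2)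
        (hm.enorm.pow_const 2) (by positivity), mul_pow, sqFn, ennreal_sq_sqrt]
  · rw [lintegral_count, ENNReal.tsum_mul_right]
    simp [one_div, ENNReal.tsum_geometric, ENNReal.one_sub_inv_two]

lemma measurableSet_ballPow : MeasurableSet {a : ℝ × (Fin m → Rn n) | a.2 ∈ ballPow n m a.1} := by
  have : {a : ℝ × (Fin m → Rn n) | a.2 ∈ ballPow n m a.1} = ⋂ i, {a | ‖a.2 i‖ ≤ a.1} := by
    ext a; simp [ballPow]
  rw [this]
  refine MeasurableSet.iInter fun i => measurableSet_le ?_ measurable_fst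
  exact ((measurable_pi_apply i).comp measurable_snd).norm

lemma measurableSet_ballPow_right (t : ℝ) : MeasurableSet (ballPow n m t) := by
  have : ballPow n m t = ⋂ i, {y | ‖y i‖ ≤ t} := by
    ext a; simp [ballPow]
  rw [this]
  exact MeasurableSet.iInter fun i => measurableSet_le (measurable_pi_apply i).norm measurable_const

lemma measurable_F (hΩ : Measurable Ω) (hf : ∀ i, Measurable (f i)) :
    Measurable fun a : ℝ × Rn n => F Ω a.1 f a.2 := by
  have hm : Measurable fun b : (ℝ × Rn n) × (Fin m → Rn n) =>
      (ballPow n m b.1.1).indicator (integrand Ω f b.1.2) b.2 := by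
    have h1 : Measurable fun b : (ℝ × Rn n) × (Fin m → Rn n) => integrand Ω f b.1.2 b.2 :=
      Measurable.comp (g := fun a : Rn n × (Fin m → Rn n) => integrand Ω f a.1 a.2)
        (f := fun b : (ℝ × Rn n) × (Fin m → Rn n) => (b.1.2, b.2)) (measurable_integrand hΩ hf)
        ((measurable_snd.comp measurable_fst).prodMk measurable_snd)
    have h2 : MeasurableSet {b : (ℝ × Rn n) × (Fin m → Rn n) | b.2 ∈ ballPow n m b.1.1} :=
      MeasurableSet.preimage (t := {a : ℝ × (Fin m → Rn n) | a.2 ∈ ballPow n m a.1})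
        (f := fun b : (ℝ × Rn n) × (Fin m → Rn n) => (b.1.1, b.2)) measurableSet_ballPow
        ((measurable_fst.comp measurable_fst).prodMk measurable_snd)
    have e : (fun b : (ℝ × Rn n) × (Fin m → Rn n) =>
        (ballPow n m b.1.1).indicator (integrand Ω f b.1.2) b.2) =
        {b : (ℝ × Rn n) × (Fin m → Rn n) | b.2 ∈ ballPow n m b.1.1}.indicator
          fun b => integrand Ω f b.1.2 b.2 := by
      funext b
      by_cases hb : b.2 ∈ ballPow n m b.1.1
      · rw [indicator_of_mem hb, indicator_of_mem (show b ∈ {b : (ℝ × Rn n) × (Fin m → Rn n) |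
          b.2 ∈ ballPow n m b.1.1} from hb)]
      · rw [indicator_of_notMem hb, indicator_of_notMem (show b ∉ {b : (ℝ × Rn n) ×
          (Fin m → Rn n) | b.2 ∈ ballPow n m b.1.1} from hb)]
    rw [e]
    exact h1.indicator h2
  have hI : Measurable fun a : ℝ × Rn n =>
      ∫ y, (ballPow n m a.1).indicator (integrand Ω f a.2) y :=
    (StronglyMeasurable.integral_prod_right' (ν := volume) hm.stronglyMeasurable).measurable
  have eF : (fun a : ℝ × Rn n => F Ω a.1 f a.2) = fun a => (((a.1 ^ m)⁻¹ : ℝ) : ℂ) *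
      ∫ y, (ballPow n m a.1).indicator (integrand Ω f a.2) y := by
    funext a
    rw [integral_indicator (measurableSet_ballPow_right a.1), F]
  rw [eF]
  have hc : Measurable fun a : ℝ × Rn n => (((a.1 ^ m)⁻¹ : ℝ) : ℂ) :=
    Complex.measurable_ofReal.comp (measurable_fst.pow_const m).inv
  exact hc.mul hI

lemma measurable_F_left (hΩ : Measurable Ω) (hf : ∀ i, Measurable (f i)) (x : Rn n) :
    Measurable fun t => F Ω t f x :=
  (measurable_F hΩ hf).comp (measurable_id.prodMk measurable_const)

lemma measurable_marcinkiewicz (hΩ : Measurable Ω) (hf : ∀ i, Measurable (f i)) :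
    Measurable (marcinkiewicz Ω f) := by
  simp_rw [show marcinkiewicz Ω f = fun x => _ from funext fun x => marcinkiewicz_eq f x]
  refine Measurable.pow_const ?_ _
  exact Measurable.lintegral_prod_right' (f := fun a : Rn n × ℝ => ‖F Ω a.2 f a.1‖ₑ ^ 2)
    (((measurable_F hΩ hf).comp measurable_swap).enorm.pow_const 2)

/-- Comparing the series for t and t/2 gives T_t = F_t - 2^{-m} F_{t/2}. This direction carries the
assumed L^q bound over to the square function. -/
lemma sqFn_le_marcinkiewicz [NeZero n] [NeZero m] (hΩ : Measurable Ω) (hf : ∀ i, Measurable (f i))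
    {x : Rn n} (hi : ∀ t, 0 < t → IntegrableOn (integrand Ω f x) (ballPow n m t)) :
    sqFn (annularKernel Ω) f x ≤ 2 * marcinkiewicz Ω f x := by
  have hF := measurable_F_left hΩ hf x
  have hA : ∀ t, 0 < t → annOp (annularKernel Ω) f t x =
      F Ω t f x - (((1 / 2) ^ m : ℝ) : ℂ) * F Ω (1 / 2 * t) f x := by
    intro t ht
    have ht2 : 0 < 1 / 2 * t := by positivity
    have h1 := hasSum_F ht (hi t ht)
    have h2 := (hasSum_F ht2 (hi _ ht2)).mul_left ((((1 / 2) ^ m : ℝ) : ℂ))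
    rw [hasSum_nat_add_iff' 1 |>.symm] at h1
    have h3 : HasSum (fun k : ℕ => ((((1 / 2) ^ (k + 1)) ^ m : ℝ) : ℂ) *
      annOp (annularKernel Ω) f ((1 / 2) ^ (k + 1) * t) x)
        ((((1 / 2) ^ m : ℝ) : ℂ) * F Ω (1 / 2 * t) f x) := by
      refine (congrArg (fun u : ℕ → ℂ => HasSum u _) (funext fun k => ?_)).mpr h2
      rw [← mul_assoc, ← Complex.ofReal_mul, pow_succ, mul_assoc, mul_pow]
      ring_nf
    have h4 := h1.unique h3
    simp only [Finset.range_one, Finset.sum_singleton, pow_zero, one_pow, Complex.ofReal_one,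
      one_mul] at h4
    rw [← h4]; ring
  refine ennreal_sqrt_le ?_
  have hpt : ∀ᵐ t ∂logMeasure, ‖annOp (annularKernel Ω) f t x‖ₑ ^ 2 ≤
      2 * (‖F Ω t f x‖ₑ ^ 2 + ‖F Ω (1 / 2 * t) f x‖ₑ ^ 2) := by
    filter_upwards [ae_logMeasure_pos] with t ht
    have h1 : ‖annOp (annularKernel Ω) f t x‖ₑ ≤ ‖F Ω t f x‖ₑ + ‖F Ω (1 / 2 * t) f x‖ₑ := by
      rw [hA t ht]
      refine enorm_sub_le.trans ?_
      gcongr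
      rw [enorm_mul]
      refine mul_le_of_le_one_left' ?_
      rw [← ofReal_norm, Complex.norm_real, Real.norm_of_nonneg (by positivity)]
      exact ENNReal.ofReal_le_one.2 (pow_le_one₀ (by norm_num) (by norm_num))
    refine (pow_le_pow_left' h1 2).trans ?_
    exact ennreal_add_sq_le _ _
  calc _ ≤ ∫⁻ t, 2 * (‖F Ω t f x‖ₑ ^ 2 + ‖F Ω (1 / 2 * t) f x‖ₑ ^ 2) ∂logMeasure :=
        lintegral_mono_ae hpt
    _ = (2 * marcinkiewicz Ω f x) ^ 2 := by
        rw [lintegral_const_mul' _ _ (by simp), lintegral_add_left (hF.enorm.pow_const 2),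
          lintegral_logMeasure_comp_mul (fun t => ‖F Ω t f x‖ₑ ^ 2) (hF.enorm.pow_const 2)
            (by norm_num), mul_pow, marcinkiewicz_eq, ennreal_sq_sqrt]
        ring

end Bridge

/-! ### Dyadic cells and maximal (stopping) cells. -/

section Grid

variable {n : ℕ}

/-- The index of the dyadic cell of side `2 ^ k` containing `x`. -/
def gridIdx (k : ℤ) (x : Rn n) : Fin n → ℤ := fun i => ⌊x i / 2 ^ k⌋

/-- The lower corner of the dyadic cell of side `2 ^ k` and index `v`. -/
def gridPt (k : ℤ) (v : Fin n → ℤ) : Rn n := WithLp.toLp 2 fun i => 2 ^ k * (v i : ℝ)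

lemma measurable_gridIdx (k : ℤ) : Measurable (gridIdx k : Rn n → Fin n → ℤ) :=
  measurable_pi_lambda _ fun i => Int.measurable_floor.comp
    ((show Measurable fun x : Rn n => x i by fun_prop).div_const _)

lemma floor_div_two (a : ℝ) : ⌊a / 2⌋ = ⌊a⌋ / 2 := by
  have := Int.floor_div_natCast a 2
  simpa using this

lemma gridIdx_succ (k : ℤ) (x : Rn n) (i : Fin n) : gridIdx (k + 1) x i = gridIdx k x i / 2 := by
  unfold gridIdx
  rw [← floor_div_two, zpow_add_one₀ two_ne_zero, div_div]

/-- Dyadic cells are nested, because the index at scale k + 1 is the floor of half the index at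
scale k. -/
lemma gridIdx_congr {k l : ℤ} (hkl : k ≤ l) {x y : Rn n} (h : gridIdx k x = gridIdx k y) :
    gridIdx l x = gridIdx l y := by
  induction l, hkl using Int.leInduction with
  | base => exact h
  | succ l _ ih => funext i; rw [gridIdx_succ, gridIdx_succ, ih]

lemma dist_gridPt_le (k : ℤ) (x : Rn n) : dist (gridPt k (gridIdx k x)) x ≤ √n * 2 ^ k := by
  have h2 : (0 : ℝ) < 2 ^ k := by positivity
  rw [EuclideanSpace.dist_eq, ← Real.sqrt_sq h2.le, ← Real.sqrt_mul (by positivity)]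
  refine Real.sqrt_le_sqrt ?_
  calc ∑ i, dist (gridPt k (gridIdx k x) i) (x i) ^ 2 ≤ ∑ _i : Fin n, ((2 : ℝ) ^ k) ^ 2 := by
        refine Finset.sum_le_sum fun i _ => ?_
        have h3 := Int.floor_le (x i / 2 ^ k)
        have h4 := (Int.lt_floor_add_one (x i / 2 ^ k)).le
        rw [le_div_iff₀ h2] at h3
        rw [div_le_iff₀ h2] at h4
        rw [sq_le_sq₀ dist_nonneg h2.le, Real.dist_eq, abs_le]
        simp only [gridPt, gridIdx]
        constructor <;> linarith
    _ = _ := by simp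

lemma dist_le_of_gridIdx_eq {k : ℤ} {x y : Rn n} (h : gridIdx k x = gridIdx k y) :
    dist x y ≤ 2 * √n * 2 ^ k := by
  have h1 := dist_gridPt_le k x
  have h2 := dist_gridPt_le k y
  rw [h] at h1
  have := dist_triangle_left x y (gridPt k (gridIdx k y))
  linarith

/-- The dyadic cell of side `2 ^ k` and index `v`. -/
def gridCell (k : ℤ) (v : Fin n → ℤ) : Set (Rn n) := {x | gridIdx k x = v}

lemma measurableSet_gridCell (k : ℤ) (v : Fin n → ℤ) : MeasurableSet (gridCell k v) :=
  measurable_gridIdx k (measurableSet_singleton v)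

lemma volume_gridCell (k : ℤ) (v : Fin n → ℤ) :
    volume (gridCell k v) = ENNReal.ofReal (2 ^ k) ^ n := by
  have h2 : (0 : ℝ) < 2 ^ k := by positivity
  have e : gridCell k v = (WithLp.ofLp : Rn n → Fin n → ℝ) ⁻¹'
      univ.pi fun i => Ico (2 ^ k * (v i : ℝ)) (2 ^ k * (v i : ℝ) + 2 ^ k) := by
    ext x
    simp only [gridCell, gridIdx, mem_ofPred_eq, funext_iff, Int.floor_eq_iff, mem_preimage, mem_pi,
      mem_univ, true_imp_iff, mem_Ico, le_div_iff₀ h2, div_lt_iff₀ h2]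
    refine forall_congr' fun i => ?_
    constructor <;> rintro ⟨h, h'⟩ <;> constructor <;> linarith
  rw [e, (PiLp.volume_preserving_ofLp (Fin n)).measure_preimage
    (MeasurableSet.univ_pi fun i => measurableSet_Ico).nullMeasurableSet, Real.volume_pi_Ico]
  simp

lemma volume_gridCell_ne_top (k : ℤ) (v : Fin n → ℤ) : volume (gridCell k v) ≠ ∞ := by
  rw [volume_gridCell]; exact ofReal_pow_ne_top

/-- The cell of side `2 ^ k` containing `x` is a maximal cell satisfying `Bad`. -/
def IsStop (Bad : ℤ → (Fin n → ℤ) → Prop) (k : ℤ) (x : Rn n) : Prop :=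
  Bad k (gridIdx k x) ∧ ∀ l, k < l → ¬Bad l (gridIdx l x)

variable {Bad : ℤ → (Fin n → ℤ) → Prop}

lemma IsStop.unique {k l : ℤ} {x : Rn n} (hk : IsStop Bad k x) (hl : IsStop Bad l x) : k = l := by
  by_contra h
  rcases lt_or_gt_of_ne h with h | h
  · exact hk.2 l h hl.1
  · exact hl.2 k h hk.1

lemma IsStop.congr {k : ℤ} {x y : Rn n} (h : gridIdx k x = gridIdx k y) (hx : IsStop Bad k x) :
    IsStop Bad k y :=
  ⟨h ▸ hx.1, fun l hl => gridIdx_congr hl.le h ▸ hx.2 l hl⟩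

lemma exists_isStop {b : ℤ} (hb : ∀ k v, b ≤ k → ¬Bad k v) {k : ℤ} {x : Rn n}
    (h : Bad k (gridIdx k x)) : ∃ l, k ≤ l ∧ IsStop Bad l x := by
  obtain ⟨l, hl, hmax⟩ := Int.exists_greatest_of_bdd (P := fun k => Bad k (gridIdx k x))
    ⟨b, fun z hz => le_of_lt (not_le.1 fun hbz => hb z _ hbz hz)⟩ ⟨k, h⟩
  exact ⟨l, hmax k h, hl, fun l' hl' hbad => absurd (hmax l' hbad) (not_le.2 hl')⟩

lemma measurableSet_isStop (Bad : ℤ → (Fin n → ℤ) → Prop) (k : ℤ) :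
    MeasurableSet {x : Rn n | IsStop Bad k x} := by
  have e : {x : Rn n | IsStop Bad k x} = gridIdx k ⁻¹' {v | Bad k v} ∩
      ⋂ l, ⋂ (_ : k < l), (gridIdx l ⁻¹' {v | Bad l v})ᶜ := by
    ext x; simp [IsStop]
  rw [e]
  exact (measurable_gridIdx k (MeasurableSet.of_discrete)).inter
    (MeasurableSet.iInter fun l => MeasurableSet.iInter fun _ =>
      (measurable_gridIdx l (MeasurableSet.of_discrete)).compl)

/-- The union of the maximal cells satisfying `Bad`. -/
def stopSet (Bad : ℤ → (Fin n → ℤ) → Prop) : Set (Rn n) := {x | ∃ k, IsStop Bad k x}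

open Classical in
/-- The scale of the maximal cell containing `x`. -/
def stopScale (Bad : ℤ → (Fin n → ℤ) → Prop) (x : Rn n) : ℤ :=
  if h : ∃ k, IsStop Bad k x then h.choose else 0

/-- The scale and the index of the maximal cell containing `x`. -/
def stopIdx (Bad : ℤ → (Fin n → ℤ) → Prop) (x : Rn n) : ℤ × (Fin n → ℤ) :=
  (stopScale Bad x, gridIdx (stopScale Bad x) x)

lemma isStop_stopScale {x : Rn n} (hx : x ∈ stopSet Bad) : IsStop Bad (stopScale Bad x) x := by
  have hx : ∃ k, IsStop Bad k x := hx
  rw [stopScale, dif_pos hx]; exact hx.choose_spec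

lemma IsStop.stopScale_eq {k : ℤ} {x : Rn n} (h : IsStop Bad k x) : stopScale Bad x = k :=
  (isStop_stopScale (show x ∈ stopSet Bad from ⟨k, h⟩)).unique h

lemma measurableSet_stopSet (Bad : ℤ → (Fin n → ℤ) → Prop) :
    MeasurableSet (stopSet Bad : Set (Rn n)) := by
  have : stopSet Bad = ⋃ k, {x : Rn n | IsStop Bad k x} := by ext x; simp [stopSet]
  rw [this]
  exact MeasurableSet.iUnion fun k => measurableSet_isStop Bad k

lemma measurable_stopScale (Bad : ℤ → (Fin n → ℤ) → Prop) :
    Measurable (stopScale Bad : Rn n → ℤ) := by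
  refine measurable_to_countable' fun k => ?_
  have e : stopScale Bad ⁻¹' {k} = {x : Rn n | IsStop Bad k x} ∪ ((stopSet Bad)ᶜ ∩ {_x | k = 0}) := by
    ext x
    by_cases hx : x ∈ stopSet Bad
    · simp only [mem_preimage, mem_singleton_iff, mem_union, mem_inter_iff, mem_compl_iff, hx,
        not_true_eq_false, false_and, or_false, mem_ofPred_eq]
      exact ⟨fun h => h ▸ isStop_stopScale hx, fun h => h.stopScale_eq⟩
    · have hx' : ¬∃ k, IsStop Bad k x := hx
      have hk : ¬IsStop Bad k x := fun h => hx' ⟨k, h⟩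
      simp [stopScale, hx, hx', hk, eq_comm]
  rw [e]
  exact (measurableSet_isStop Bad k).union ((measurableSet_stopSet Bad).compl.inter
    (MeasurableSet.const _))

lemma measurable_stopIdx (Bad : ℤ → (Fin n → ℤ) → Prop) :
    Measurable (stopIdx Bad : Rn n → ℤ × (Fin n → ℤ)) := by
  refine (measurable_stopScale Bad).prodMk ?_
  have : Measurable fun a : ℤ × Rn n => gridIdx a.1 a.2 :=
    measurable_from_prod_countable_right fun k => measurable_gridIdx k
  exact this.comp ((measurable_stopScale Bad).prodMk measurable_id)

/-- The fibres of `stopIdx` inside `stopSet` are exactly the maximal cells, so sums over maximal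
cells become sums over the countable range of a measurable map. -/
lemma stopSet_inter_preimage {x : Rn n} (hx : x ∈ stopSet Bad) :
    stopSet Bad ∩ stopIdx Bad ⁻¹' {stopIdx Bad x} =
      gridCell (stopScale Bad x) (gridIdx (stopScale Bad x) x) := by
  ext y
  simp only [mem_inter_iff, mem_preimage, mem_singleton_iff, stopIdx, Prod.mk.injEq, gridCell,
    mem_ofPred_eq]
  constructor
  · rintro ⟨_, h1, h2⟩
    rw [h1] at h2; exact h2
  · intro h
    have hs := (isStop_stopScale hx).congr h.symm
    have h1 := hs.stopScale_eq
    exact ⟨⟨_, hs⟩, h1, by rw [h1, h]⟩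

lemma volume_stopSet_inter_preimage_ne_top (i : ℤ × (Fin n → ℤ)) :
    volume (stopSet Bad ∩ stopIdx Bad ⁻¹' {i}) ≠ ∞ := by
  by_cases h : ∃ x, x ∈ stopSet Bad ∧ stopIdx Bad x = i
  · obtain ⟨x, hx, rfl⟩ := h
    rw [stopSet_inter_preimage hx]; exact volume_gridCell_ne_top _ _
  · have : stopSet Bad ∩ stopIdx Bad ⁻¹' {i} = ∅ := by
      ext y; simp only [mem_inter_iff, mem_preimage, mem_singleton_iff, mem_empty_iff_false,
        iff_false]
      exact fun hy => h ⟨y, hy⟩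
    simp [this]

end Grid

/-! ### Averaging over the fibres of a countably valued map. -/

section FibreAverage

set_option linter.unusedSectionVars false

variable {X ι : Type*} [MeasurableSpace X] [MeasurableSpace ι] [Countable ι]
  [MeasurableSingletonClass ι] {μ : Measure X} {E : Set X} {φ : X → ι} {f : X → ℂ}

lemma enorm_setAverage_mul_le {G : Type*} [NormedAddCommGroup G] [NormedSpace ℝ G] {f : X → G}
    (P : Set X) (hP : μ P ≠ ∞) :
    ‖⨍ y in P, f y ∂μ‖ₑ * μ P ≤ ∫⁻ y in P, ‖f y‖ₑ ∂μ := by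
  by_cases h0 : μ P = 0
  · simp [h0]
  have hpos : 0 < μ.real P := ENNReal.toReal_pos h0 hP
  rw [setAverage_eq, enorm_smul, ← ofReal_norm (μ.real P)⁻¹, Real.norm_of_nonneg (by positivity),
    ENNReal.ofReal_inv_of_pos hpos, Measure.real, ENNReal.ofReal_toReal hP, mul_comm, ← mul_assoc,
    ENNReal.mul_inv_cancel h0 hP, one_mul]
  exact enorm_integral_le_lintegral_enorm _

open Classical in
/-- Replacement of `f` by its averages over the fibres of `φ` inside `E`. -/
def fibreAvg (μ : Measure X) (E : Set X) (φ : X → ι) (f : X → ℂ) (z : X) : ℂ :=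
  if z ∈ E then ⨍ y in E ∩ φ ⁻¹' {φ z}, f y ∂μ else f z

lemma measurable_fibreAvg (hE : MeasurableSet E) (hφ : Measurable φ) (hf : Measurable f) :
    Measurable (fibreAvg μ E φ f) := by
  classical
  refine Measurable.ite hE ?_ hf
  exact (measurable_of_countable fun i => ⨍ y in E ∩ φ ⁻¹' {i}, f y ∂μ).comp hφ

lemma eq_iUnion_fibre (E : Set X) (φ : X → ι) : E = ⋃ i, E ∩ φ ⁻¹' {i} := by
  ext x; simp

lemma measurableSet_fibre (hE : MeasurableSet E) (hφ : Measurable φ) (i : ι) :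
    MeasurableSet (E ∩ φ ⁻¹' {i}) := hE.inter (hφ (measurableSet_singleton i))

lemma pairwise_disjoint_fibre (E : Set X) (φ : X → ι) :
    Pairwise (Function.onFun Disjoint fun i => E ∩ φ ⁻¹' {i}) := fun _ _ hij =>
  Set.disjoint_left.2 fun _ hx hx' => hij (hx.2.symm.trans hx'.2)

lemma fibreAvg_of_mem {i : ι} {z : X} (hz : z ∈ E ∩ φ ⁻¹' {i}) :
    fibreAvg μ E φ f z = ⨍ y in E ∩ φ ⁻¹' {i}, f y ∂μ := by
  have h2 : φ z = i := hz.2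
  rw [fibreAvg, if_pos hz.1, h2]

lemma lintegral_enorm_fibreAvg_le (hE : MeasurableSet E) (hφ : Measurable φ)
    (hfin : ∀ i, μ (E ∩ φ ⁻¹' {i}) ≠ ∞) :
    ∫⁻ z, ‖fibreAvg μ E φ f z‖ₑ ∂μ ≤ ∫⁻ z, ‖f z‖ₑ ∂μ := by
  rw [← lintegral_add_compl _ hE, ← lintegral_add_compl (fun z => ‖f z‖ₑ) hE]
  refine add_le_add ?_ (le_of_eq (setLIntegral_congr_fun hE.compl fun z hz => ?_))
  · rw [eq_iUnion_fibre E φ, lintegral_iUnion (measurableSet_fibre hE hφ)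
      (pairwise_disjoint_fibre E φ), lintegral_iUnion (measurableSet_fibre hE hφ)
      (pairwise_disjoint_fibre E φ), ← eq_iUnion_fibre E φ]
    refine ENNReal.tsum_le_tsum fun i => ?_
    rw [setLIntegral_congr_fun (measurableSet_fibre hE hφ i)
      (g := fun _ => ‖⨍ y in E ∩ φ ⁻¹' {i}, f y ∂μ‖ₑ) fun z hz => by rw [fibreAvg_of_mem hz],
      setLIntegral_const]
    exact enorm_setAverage_mul_le _ (hfin i)
  · rw [fibreAvg, if_neg hz]

/-- The weight is constant on each fibre, where f minus its average has integral 0. In the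
application the weight is a kernel frozen at the corner of a cell. -/
lemma setIntegral_fibre_mul_sub_fibreAvg (hE : MeasurableSet E) (hφ : Measurable φ)
    (hfin : ∀ i, μ (E ∩ φ ⁻¹' {i}) ≠ ∞) (hf : Integrable f μ) (hfm : Measurable f)
    {ψ : ι → ℂ} {B : ℝ} (hB : ∀ i, ‖ψ i‖ ≤ B) :
    ∫ z in E, ψ (φ z) * (f z - fibreAvg μ E φ f z) ∂μ = 0 := by
  have hg : Integrable (fibreAvg μ E φ f) μ :=
    ⟨(measurable_fibreAvg hE hφ hfm).aestronglyMeasurable,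
      (lintegral_enorm_fibreAvg_le hE hφ hfin).trans_lt hf.2⟩
  have hint : Integrable (fun z => ψ (φ z) * (f z - fibreAvg μ E φ f z)) μ :=
    (hf.sub hg).bdd_mul ((measurable_of_countable ψ).comp hφ).aestronglyMeasurable
      (Filter.Eventually.of_forall fun z => hB (φ z))
  rw [setIntegral_congr_set (Filter.EventuallyEq.of_eq (eq_iUnion_fibre E φ)), integral_iUnion (measurableSet_fibre hE hφ) (pairwise_disjoint_fibre E φ) hint.integrableOn]
  refine (tsum_congr fun i => ?_).trans tsum_zero
  rw [setIntegral_congr_fun (measurableSet_fibre hE hφ i)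
    (g := fun z => ψ i * (f z - ⨍ y in E ∩ φ ⁻¹' {i}, f y ∂μ)) fun z hz => by
      have h2 : φ z = i := hz.2
      simp only [fibreAvg_of_mem hz, h2],
    integral_const_mul, integral_sub hf.integrableOn (integrableOn_const (hfin i))]
  have : IsFiniteMeasure (μ.restrict (E ∩ φ ⁻¹' {i})) := ⟨by simpa using (hfin i).lt_top⟩
  rw [integral_average, sub_self, mul_zero]

end FibreAverage

/-! ### The simultaneous Calderón–Zygmund decomposition of a tuple. -/

section CalderonZygmund

variable {n m : ℕ} {f : Fin m → Rn n → ℂ} {A : ℝ≥0∞}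

/-- A cell is bad if one of the averages of `|f_j|` over a comparable ball exceeds `A`. -/
def czBad (f : Fin m → Rn n → ℂ) (A : ℝ≥0∞) (k : ℤ) (v : Fin n → ℤ) : Prop :=
  ∃ j, A < ballAvg (fun z => ‖f j z‖ₑ) (gridPt k v) ((√n + 1) * 2 ^ k)

/-- At scales with 2^k ≥ 2^b the total mass already forces averages at most 1 ≤ A. Bad scales are
therefore bounded above and maximal bad cells exist. -/
lemma not_czBad_of_le (hA : 1 ≤ A) {b : ℤ}
    (hf : ∀ j, ∫⁻ z, ‖f j z‖ₑ ≤ ENNReal.ofReal (2 ^ b) ^ n) (k : ℤ) (v : Fin n → ℤ) (hk : b ≤ k) :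
    ¬czBad f A k v := by
  rintro ⟨j, hj⟩
  refine absurd hj (not_lt.2 (le_trans ?_ hA))
  refine (ballAvg_le_total _ _ _).trans ?_
  rw [← ENNReal.div_eq_inv_mul]
  refine ENNReal.div_le_of_le_mul ?_
  rw [one_mul]
  refine (hf j).trans ?_
  gcongr
  calc (2 : ℝ) ^ b ≤ 1 * 2 ^ k := by
        rw [one_mul]; exact zpow_le_zpow_right₀ one_le_two hk
    _ ≤ _ := by gcongr; linarith [Real.sqrt_nonneg n]

/-- No bad cell passes through such a point, since it would lie in a maximal one. The balls attached
to the shrinking cells around z contain z, so Lebesgue differentiation applies although they are not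
centred there. -/
lemma ae_enorm_le_of_notMem_stopSet [NeZero n] (hAt : A ≠ ∞) {b : ℤ}
    (hb : ∀ k v, b ≤ k → ¬czBad f A k v) (j : Fin m) (hi : Integrable (f j)) :
    ∀ᵐ z, z ∉ stopSet (czBad f A) → ‖f j z‖ₑ ≤ A * (unitVol n)⁻¹ := by
  have hct : A * (unitVol n)⁻¹ ≠ ∞ := ENNReal.mul_ne_top hAt (ENNReal.inv_ne_top.2 unitVol_ne_zero)
  filter_upwards [IsUnifLocDoublingMeasure.ae_tendsto_average volume hi.norm.locallyIntegrable 1]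
    with x hx hxE
  have hc : (0 : ℝ) < √n + 1 := by positivity
  have hδ : Filter.Tendsto (fun k : ℕ => (√n + 1) * (2 : ℝ) ^ (-(k : ℤ))) Filter.atTop
      (nhdsWithin 0 (Ioi 0)) := by
    refine tendsto_nhdsWithin_iff.2 ⟨?_, Filter.Eventually.of_forall fun k => ?_⟩
    · have := (tendsto_pow_atTop_nhds_zero_of_lt_one (r := (1 / 2 : ℝ)) (by norm_num)
        (by norm_num)).const_mul (√n + 1)
      rw [mul_zero] at this
      refine this.congr fun k => ?_
      rw [zpow_neg, zpow_natCast, one_div, inv_pow]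
    · exact mem_Ioi.2 (by positivity)
  have h1 := hx (fun k : ℕ => gridPt (-(k : ℤ)) (gridIdx (-(k : ℤ)) x)) _ hδ
    (Filter.Eventually.of_forall fun k => by
      rw [mem_closedBall, dist_comm, one_mul]
      refine (dist_gridPt_le _ _).trans ?_
      gcongr; linarith)
  have h2 : ‖f j x‖ ≤ (A * (unitVol n)⁻¹).toReal := by
    refine le_of_tendsto' h1 fun k => ?_
    have hr : 0 < (√n + 1) * (2 : ℝ) ^ (-(k : ℤ)) := by positivity
    have hnb : ¬czBad f A (-(k : ℤ)) (gridIdx (-(k : ℤ)) x) := fun h => by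
      obtain ⟨l, -, hl⟩ := exists_isStop hb h
      exact hxE ⟨l, hl⟩
    simp only [czBad, not_exists, not_lt] at hnb
    rw [setAverage_eq, smul_eq_mul, integral_norm_eq_lintegral_enorm hi.aestronglyMeasurable.restrict,
      Measure.real, ← ENNReal.toReal_inv, ← ENNReal.toReal_mul]
    refine ENNReal.toReal_mono hct ?_
    rw [volume_closedBall_eq _ hr.le, ENNReal.mul_inv (Or.inr unitVol_ne_top)
      (Or.inr unitVol_ne_zero), mul_right_comm]
    gcongr
    exact hnb j
  rw [← ofReal_norm, ← ENNReal.ofReal_toReal hct]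
  exact ENNReal.ofReal_le_ofReal h2

/-- The parent of a maximal cell is not bad, and the ball attached to the parent contains the cell;
the constant is the ratio of rⁿ for that ball to the volume of the cell. -/
lemma enorm_fibreAvg_stop_le {z : Rn n} (hz : z ∈ stopSet (czBad f A)) (j : Fin m) :
    ‖fibreAvg volume (stopSet (czBad f A)) (stopIdx (czBad f A)) (f j) z‖ₑ ≤
      A * ENNReal.ofReal (2 * (√n + 1)) ^ n := by
  classical
  rw [fibreAvg, if_pos hz, stopSet_inter_preimage hz]
  set k := stopScale (czBad f A) z
  have h2 : (0 : ℝ) < 2 ^ k := by positivity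
  have hv0 : volume (gridCell k (gridIdx k z)) ≠ 0 := by
    rw [volume_gridCell]; exact ofReal_pow_ne_zero h2
  have hvt := volume_gridCell_ne_top k (gridIdx k z)
  refine (ENNReal.mul_le_mul_iff_left hv0 hvt).1
    ((enorm_setAverage_mul_le _ hvt).trans ?_)
  have hnb := (isStop_stopScale hz).2 (k + 1) (lt_add_one k)
  simp only [czBad, not_exists, not_lt] at hnb
  have hr : 0 < (√n + 1) * (2 : ℝ) ^ (k + 1) := by positivity
  calc ∫⁻ y in gridCell k (gridIdx k z), ‖f j y‖ₑ
      ≤ ∫⁻ y in closedBall (gridPt (k + 1) (gridIdx (k + 1) z)) ((√n + 1) * 2 ^ (k + 1)),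
          ‖f j y‖ₑ := by
        refine lintegral_mono_set fun y hy => ?_
        have hy : gridIdx k y = gridIdx k z := hy
        rw [← gridIdx_congr (Int.le_add_one le_rfl) hy, mem_closedBall, dist_comm]
        refine (dist_gridPt_le _ _).trans ?_
        gcongr; linarith
    _ ≤ ENNReal.ofReal ((√n + 1) * 2 ^ (k + 1)) ^ n * A := by
        rw [setLIntegral_closedBall_eq _ _ hr]
        gcongr
        exact hnb j
    _ = _ := by
        rw [volume_gridCell, zpow_add_one₀ two_ne_zero,
          show (√n + 1) * ((2 : ℝ) ^ k * 2) = (2 * (√n + 1)) * 2 ^ k by ring,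
          ENNReal.ofReal_mul (by positivity), mul_pow]
        ring

/-- The Calderón–Zygmund decomposition of a tuple of integrable functions at height `A`. -/
theorem exists_calderonZygmund [NeZero n] (hA : 1 ≤ A) (hAt : A ≠ ∞) {b : ℤ}
    (hfm : ∀ j, Measurable (f j)) (hf : ∀ j, ∫⁻ z, ‖f j z‖ₑ ≤ ENNReal.ofReal (2 ^ b) ^ n) :
    ∃ (g : Fin m → Rn n → ℂ) (E : Set (Rn n)) (s : Rn n → ℤ) (π : Rn n → Rn n),
      (∀ j, Measurable (g j)) ∧ MeasurableSet E ∧ Measurable s ∧ Measurable π ∧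
      (∀ j, ∫⁻ z, ‖g j z‖ₑ ≤ ∫⁻ z, ‖f j z‖ₑ) ∧
      (∀ j, ∀ᵐ z, ‖g j z‖ₑ ≤ A * ((unitVol n)⁻¹ + ENNReal.ofReal (2 * (√n + 1)) ^ n)) ∧
      (∀ j, ∀ z ∉ E, g j z = f j z) ∧
      (∀ z ∈ E, dist (π z) z ≤ √n * 2 ^ s z) ∧
      (∀ j (φ : Rn n → ℂ), Measurable φ → (∃ B, ∀ z, ‖φ z‖ ≤ B) →
        ∫ z, φ (π z) * (f j z - g j z) = 0) ∧
      ∀ z ∈ E, ∃ j, A < ballAvg (fun z => ‖f j z‖ₑ) (π z) ((√n + 1) * 2 ^ s z) := by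
  classical
  have hi : ∀ j, Integrable (f j) := fun j =>
    ⟨(hfm j).aestronglyMeasurable, (hf j).trans_lt ofReal_pow_ne_top.lt_top⟩
  have hb := not_czBad_of_le hA hf
  have hEm := measurableSet_stopSet (czBad f A)
  have hφm := measurable_stopIdx (czBad f A)
  set E := stopSet (czBad f A) with hE
  set φ := stopIdx (czBad f A) with hφ
  set s := stopScale (czBad f A) with hs
  have hsm : Measurable s := measurable_stopScale _
  set P : ℤ × (Fin n → ℤ) → Rn n := fun i => gridPt i.1 i.2
  have hfin : ∀ i, volume (E ∩ φ ⁻¹' {i}) ≠ ∞ := volume_stopSet_inter_preimage_ne_top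
  refine ⟨fun j => fibreAvg volume E φ (f j), E, s, fun z => P (φ z),
    fun j => measurable_fibreAvg hEm hφm (hfm j), hEm, hsm,
    (measurable_of_countable P).comp hφm, fun j => lintegral_enorm_fibreAvg_le hEm hφm hfin,
    fun j => ?_, fun j z hz => if_neg hz, fun z _ => dist_gridPt_le _ _, ?_, fun z hz => ?_⟩
  · filter_upwards [ae_enorm_le_of_notMem_stopSet hAt hb j (hi j)] with z hz
    by_cases hzE : z ∈ E
    · refine (enorm_fibreAvg_stop_le hzE j).trans ?_
      gcongr; exact le_add_self
    · rw [fibreAvg, if_neg hzE]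
      refine (hz hzE).trans ?_
      gcongr; exact le_self_add
  · rintro j ψ hψ ⟨B, hB⟩
    rw [← setIntegral_eq_integral_of_forall_compl_eq_zero (s := E)]
    · exact setIntegral_fibre_mul_sub_fibreAvg hEm hφm hfin (hi j) (hfm j)
        (ψ := fun i => ψ (P i)) fun i => hB _
    · intro z hz
      simp [fibreAvg, hz]
  · exact (isStop_stopScale hz).1

end CalderonZygmund

/-! ### Integral estimates for tuples with one cancelling entry. -/

section WeakType

variable {n m : ℕ} {k : ℝ → (Fin m → Rn n) → ℂ} {C : ℝ≥0} {γ : ℝ} {f : Fin m → Rn n → ℂ}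

lemma measurable_ballAvg {a : Rn n → ℝ≥0∞} (ha : Measurable a) (r : ℝ) :
    Measurable fun x => ballAvg a x r := by
  have hmem : MeasurableSet {p : Rn n × Rn n | dist p.2 p.1 ≤ r} :=
    measurableSet_le (measurable_snd.dist measurable_fst) measurable_const
  have e1 : ∀ x, ∫⁻ z in closedBall x r, a z =
      ∫⁻ z, {p : Rn n × Rn n | dist p.2 p.1 ≤ r}.indicator (fun p => a p.2) (x, z) := fun x => by
    rw [← lintegral_indicator measurableSet_closedBall]
    rfl
  simp_rw [ballAvg, e1]
  exact ((ha.comp measurable_snd).indicator hmem).lintegral_prod_right'.const_mul _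

lemma lintegral_ballAvg {a : Rn n → ℝ≥0∞} (ha : Measurable a) {r : ℝ} (hr : 0 < r) :
    ∫⁻ x, ballAvg a x r = unitVol n * ∫⁻ z, a z := by
  have hmem : MeasurableSet {p : Rn n × Rn n | dist p.2 p.1 ≤ r} :=
    measurableSet_le (measurable_snd.dist measurable_fst) measurable_const
  have e1 : ∀ x, ∫⁻ z in closedBall x r, a z =
      ∫⁻ z, {p : Rn n × Rn n | dist p.2 p.1 ≤ r}.indicator (fun p => a p.2) (x, z) := fun x => by
    rw [← lintegral_indicator measurableSet_closedBall]
    rfl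
  have e2 : ∀ z, ∫⁻ x, {p : Rn n × Rn n | dist p.2 p.1 ≤ r}.indicator (fun p => a p.2) (x, z) =
      a z * volume (closedBall z r) := fun z => by
    rw [← setLIntegral_const, ← lintegral_indicator measurableSet_closedBall]
    refine lintegral_congr fun x => ?_
    simp only [indicator, mem_closedBall, dist_comm z x, mem_ofPred_eq]
  simp_rw [ballAvg, e1]
  have hm : Measurable ({p : Rn n × Rn n | dist p.2 p.1 ≤ r}.indicator fun p => a p.2) :=
    (ha.comp measurable_snd).indicator hmem
  rw [lintegral_const_mul _ hm.lintegral_prod_right', lintegral_lintegral_swap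
    (f := fun x z => {p : Rn n × Rn n | dist p.2 p.1 ≤ r}.indicator (fun p => a p.2) (x, z))
    hm.aemeasurable]
  simp_rw [e2, volume_closedBall_eq _ hr.le]
  rw [lintegral_mul_const _ ha, mul_comm (∫⁻ z, a z), ← mul_assoc, ← mul_assoc,
    ENNReal.inv_mul_cancel (ofReal_pow_ne_zero hr) ofReal_pow_ne_top, one_mul]

lemma sqFn_sq_eq_tsum (k : ℝ → (Fin m → Rn n) → ℂ) (f : Fin m → Rn n → ℂ) (x : Rn n) :
    sqFn k f x ^ 2 = ∑' l : ℤ, blockNorm k f (2 ^ l) x ^ 2 := by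
  rw [sqFn, ennreal_sq_sqrt, lintegral_logMeasure_eq_tsum]
  simp_rw [blockNorm_sq]

lemma sqFn_le_tsum_blockNorm (k : ℝ → (Fin m → Rn n) → ℂ) (f : Fin m → Rn n → ℂ) (x : Rn n) :
    sqFn k f x ≤ ∑' l : ℤ, blockNorm k f (2 ^ l) x := by
  refine (ENNReal.pow_le_pow_left_iff two_ne_zero).1 ?_
  rw [sqFn_sq_eq_tsum, sq (∑' l : ℤ, _), ← ENNReal.tsum_mul_right]
  refine ENNReal.tsum_le_tsum fun l => ?_
  rw [sq]
  gcongr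
  exact ENNReal.le_tsum l

lemma measurable_sqFn (hk : IsAnnular k C γ) (hf : ∀ i, Measurable (f i)) :
    Measurable (sqFn k f) := by
  refine Measurable.pow_const ?_ _
  exact Measurable.lintegral_prod_right' (f := fun a : Rn n × ℝ => ‖annOp k f a.2 a.1‖ₑ ^ 2)
    (((measurable_annOp hk hf).comp measurable_swap).enorm.pow_const 2)

lemma sqFn_add_le (hk : IsAnnular k C γ) {g b : Fin m → Rn n → ℂ} (hg : ∀ i, Measurable (g i))
    (hb : ∀ i, Measurable (b i)) (hgl : ∀ i, LocallyIntegrable (g i))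
    (hbl : ∀ i, LocallyIntegrable (b i)) (x : Rn n) :
    sqFn k (fun i z => g i z + b i z) x ≤ sqFn k g x +
      ∑ j, sqFn k (mixedTuple (fun i z => g i z + b i z) b g j) x := by
  set H : Fin (m + 1) → Fin m → Rn n → ℂ :=
    Fin.cons g fun j => mixedTuple (fun i z => g i z + b i z) b g j with hH
  have hHm : ∀ o i, Measurable (H o i) := fun o => by
    refine Fin.cases hg (fun j i => ?_) o
    exact mixedTuple_induction (P := Measurable) (fun i => (hg i).add (hb i)) hb hg j i
  refine ennreal_sqrt_le ?_
  have hpt : ∀ᵐ t ∂logMeasure, ‖annOp k (fun i z => g i z + b i z) t x‖ₑ ^ 2 ≤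
      (∫⁻ o, ‖annOp k (H o) t x‖ₑ ∂Measure.count) ^ 2 := by
    filter_upwards [ae_logMeasure_pos] with t ht
    gcongr
    rw [annOp_add hk hg hb hgl hbl ht, lintegral_count, tsum_fintype, Fin.sum_univ_succ]
    refine (enorm_add_le _ _).trans ?_
    simp only [hH, Fin.cons_zero, Fin.cons_succ]
    gcongr
    exact enorm_sum_le _ _
  refine (lintegral_mono_ae hpt).trans ((lintegral_sq_lintegral_le logMeasure Measure.count
    (w := fun o => sqFn k (H o) x) ?_ (measurable_of_countable _) fun o => ?_).trans ?_)
  · exact measurable_from_prod_countable_left fun o => (measurable_annOp_left hk (hHm o) x).enorm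
  · rw [sqFn, ennreal_sq_sqrt]
  · rw [lintegral_count, tsum_fintype, Fin.sum_univ_succ]
    simp only [hH, Fin.cons_zero, Fin.cons_succ, le_refl]

lemma tsum_int_rpow_geometric (γ : ℝ) (s : ℤ) :
    ∑' l : ℤ, (if s ≤ l then ENNReal.ofReal (2 ^ s / 2 ^ l) ^ γ else 0) =
      (1 - (1 / 2 : ℝ≥0∞) ^ γ)⁻¹ := by
  have hinj : Function.Injective fun i : ℕ => s + (i : ℤ) := fun i j h => by simpa using h
  rw [← hinj.tsum_eq, ← ENNReal.tsum_geometric]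
  · refine tsum_congr fun i => ?_
    rw [if_pos (by omega), zpow_add₀ two_ne_zero, zpow_natCast, div_mul_cancel_left₀ (by positivity),
      ← inv_pow, ENNReal.ofReal_pow (by norm_num), ENNReal.ofReal_inv_of_pos two_pos, one_div,
      ← ENNReal.rpow_natCast, ← ENNReal.rpow_natCast, ← ENNReal.rpow_mul, ← ENNReal.rpow_mul,
      mul_comm]
    simp
  · intro l hl
    rw [Function.mem_support, ne_eq, ite_eq_right_iff, Classical.not_imp] at hl
    exact ⟨(l - s).toNat, by simp only; have := hl.1; omega⟩

/-- The constant in the estimate of the square function of a tuple with a cancelling entry. -/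
def cancelConst (n : ℕ) (γ : ℝ) : ℝ≥0∞ :=
  ENNReal.ofReal √n ^ γ * ENNReal.ofReal (2 + √n) ^ n * unitVol n * (1 - (1 / 2 : ℝ≥0∞) ^ γ)⁻¹

lemma cancelConst_ne_top (n : ℕ) {γ : ℝ} (hγ : 0 < γ) : cancelConst n γ ≠ ∞ := by
  refine ENNReal.mul_ne_top (ENNReal.mul_ne_top (ENNReal.mul_ne_top
    (ENNReal.rpow_ne_top_of_nonneg hγ.le ENNReal.ofReal_ne_top) ofReal_pow_ne_top)
    unitVol_ne_top) ?_
  rw [ENNReal.inv_ne_top, ne_eq, tsub_eq_zero_iff_le, not_le]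
  exact ENNReal.rpow_lt_one (by simp) hγ

/-- By `hscale`, a point of G meets the part of f_j in a cell of side 2^s only at scales 2^l with l
≥ s, and there cancellation gains (2^s / 2^l)^γ. Integrating in x turns the averages of f_j into its
L¹ norm, and the sum over l ≥ s is geometric. The other entries have averages at most D on G. -/
theorem setLIntegral_sqFn_le_of_cancel (hk : IsAnnular k C γ) (hγ : 0 < γ)
    (hf : ∀ i, Measurable (f i)) (hi : ∀ i, Integrable (f i)) (j : Fin m)
    {E G : Set (Rn n)} {s : Rn n → ℤ} {π : Rn n → Rn n} (hE : MeasurableSet E)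
    (hG : MeasurableSet G) (hs : Measurable s) (hπ : Measurable π)
    (hcan : ∀ φ : Rn n → ℂ, Measurable φ → (∃ B, ∀ z, ‖φ z‖ ≤ B) → ∫ z, φ (π z) * f j z = 0)
    (hfE : ∀ z ∉ E, f j z = 0) (hdist : ∀ z ∈ E, dist (π z) z ≤ √n * 2 ^ s z)
    (hscale : ∀ x ∈ G, ∀ z ∈ E, ∀ l : ℤ,
      z ∈ closedBall x (2 * 2 ^ l) ∨ π z ∈ closedBall x (2 * 2 ^ l) → s z ≤ l)
    {D : ℝ≥0∞} (hD : ∀ x ∈ G, ∀ i, i ≠ j → ∀ r, 0 < r → ballAvg (fun z => ‖f i z‖ₑ) x r ≤ D) :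
    ∫⁻ x in G, sqFn k f x ≤
      C * (2 ^ n) ^ m * D ^ (m - 1) * cancelConst n γ * ∫⁻ z, ‖f j z‖ₑ := by
  -- If π z lies within 2 · 2^l of x and z within √n 2^s ≤ √n 2^l of π z, then z is within K 2^l of
  -- x.
  set K : ℝ := 2 + √n with hK
  have hK0 : 0 < K := by positivity
  set a : ℤ → Rn n → ℝ≥0∞ := fun l z =>
    ((if s z ≤ l then ENNReal.ofReal (2 ^ s z / 2 ^ l) ^ γ else 0)) * ‖f j z‖ₑ with ha
  have ham : ∀ l, Measurable (a l) := fun l => by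
    refine Measurable.mul ?_ (hf j).enorm
    exact (measurable_of_countable fun i : ℤ =>
      if i ≤ l then ENNReal.ofReal ((2 : ℝ) ^ i / 2 ^ l) ^ γ else 0).comp hs
  set c1 : ℝ≥0∞ := C * (2 ^ n) ^ m * D ^ (m - 1) with hc1
  have hblock : ∀ l : ℤ, ∀ x ∈ G, blockNorm k f (2 ^ l) x ≤
      c1 * (ENNReal.ofReal √n ^ γ * (ENNReal.ofReal K ^ n * ballAvg (a l) x (K * 2 ^ l))) := by
    intro l x hx
    have h2 : (0 : ℝ) < 2 ^ l := by positivity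
    set S : Set (Rn n) := closedBall x (K * 2 ^ l) ∩ (E ∩ {z | s z ≤ l}) with hS
    have hSm : MeasurableSet S := measurableSet_closedBall.inter
      (hE.inter (measurableSet_le hs measurable_const))
    refine (blockNorm_le_of_cancel hk hγ.le hf hi j hπ hcan h2 x hSm fun z hz hzx => ?_).trans ?_
    · have hzE : z ∈ E := by
        by_contra h
        exact hz (hfE z h)
      have hsl := hscale x hx z hzE l hzx
      refine ⟨?_, hzE, hsl⟩
      have hpow : (2 : ℝ) ^ s z ≤ 2 ^ l := zpow_le_zpow_right₀ one_le_two hsl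
      have hd := hdist z hzE
      have hd2 : √n * (2 : ℝ) ^ s z ≤ √n * 2 ^ l := by gcongr
      have hn0 := Real.sqrt_nonneg n
      rw [mem_closedBall, hK]
      rcases hzx with h | h
      · rw [mem_closedBall] at h
        nlinarith [mul_nonneg hn0 h2.le]
      · rw [mem_closedBall] at h
        have := dist_triangle_left z x (π z)
        linarith
    · rw [hc1, mul_assoc _ (D ^ (m - 1))]
      gcongr _ * (?_ * ?_)
      · calc ∏ i ∈ Finset.univ.erase j, ballAvg (fun z => ‖f i z‖ₑ) x (2 * 2 ^ l)
            ≤ ∏ _i ∈ Finset.univ.erase j, D := by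
              refine Finset.prod_le_prod' fun i hij => ?_
              exact hD x hx i (Finset.ne_of_mem_erase hij) _ (by positivity)
          _ = D ^ (m - 1) := by simp
      · rw [ballAvg, ENNReal.ofReal_mul hK0.le, mul_pow, ENNReal.mul_inv (Or.inr ofReal_pow_ne_top)
          (Or.inl ofReal_pow_ne_top), mul_assoc, ← mul_assoc (ENNReal.ofReal K ^ n),
          ENNReal.mul_inv_cancel (ofReal_pow_ne_zero hK0) ofReal_pow_ne_top, one_mul,
          mul_left_comm]
        gcongr
        rw [← lintegral_const_mul' _ _ (ENNReal.rpow_ne_top_of_nonneg hγ.le ENNReal.ofReal_ne_top)]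
        refine (setLIntegral_mono' hSm fun z hz => ?_).trans (lintegral_mono_set inter_subset_left)
        have hsl : s z ≤ l := hz.2.2
        simp only [ha, if_pos hsl]
        rw [← mul_assoc, ← ENNReal.mul_rpow_of_nonneg _ _ hγ.le, ← ENNReal.ofReal_mul (by positivity)]
        gcongr
        rw [← mul_div_assoc]
        gcongr
        exact hdist z hz.2.1
  calc ∫⁻ x in G, sqFn k f x ≤ ∫⁻ x in G, ∑' l : ℤ, blockNorm k f (2 ^ l) x :=
        lintegral_mono fun x => sqFn_le_tsum_blockNorm k f x
    _ = ∑' l : ℤ, ∫⁻ x in G, blockNorm k f (2 ^ l) x :=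
        lintegral_tsum fun l => (measurable_blockNorm hk hf _).aemeasurable
    _ ≤ ∑' l : ℤ, c1 * (ENNReal.ofReal √n ^ γ * (ENNReal.ofReal K ^ n *
          (unitVol n * ∫⁻ z, a l z))) := by
        refine ENNReal.tsum_le_tsum fun l => ?_
        refine (setLIntegral_mono' hG (hblock l)).trans ?_
        refine (lintegral_mono' Measure.restrict_le_self le_rfl).trans ?_
        rw [← lintegral_ballAvg (ham l) (show 0 < K * (2 : ℝ) ^ l by positivity)]
        have hbm := measurable_ballAvg (ham l) (K * 2 ^ l)
        rw [lintegral_const_mul _ ((hbm.const_mul _).const_mul _),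
          lintegral_const_mul _ (hbm.const_mul _), lintegral_const_mul _ hbm]
    _ = c1 * (ENNReal.ofReal √n ^ γ * (ENNReal.ofReal K ^ n *
          (unitVol n * ∫⁻ z, (1 - (1 / 2 : ℝ≥0∞) ^ γ)⁻¹ * ‖f j z‖ₑ))) := by
        rw [ENNReal.tsum_mul_left, ENNReal.tsum_mul_left, ENNReal.tsum_mul_left,
          ENNReal.tsum_mul_left, ← lintegral_tsum fun l => (ham l).aemeasurable]
        simp_rw [ha, ENNReal.tsum_mul_right, tsum_int_rpow_geometric γ]
    _ = _ := by
        rw [lintegral_const_mul _ (hf j).enorm, cancelConst]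
        ring

end WeakType

/-! ### The weak type bound on L¹ × ⋯ × L¹. -/

section WeakEndpoint

variable {n m : ℕ} {Ω : (Fin m → Rn n) → ℂ} {C : ℝ≥0} {γ : ℝ}

lemma ennreal_rpow_sum {ι : Type*} (V : ℝ≥0∞) {r : ι → ℝ} (s : Finset ι) (hr : ∀ i ∈ s, 0 ≤ r i) :
    V ^ ∑ i ∈ s, r i = ∏ i ∈ s, V ^ r i := by
  classical
  induction s using Finset.induction_on with
  | empty => simp
  | insert a s ha ih =>
    rw [Finset.sum_insert ha, Finset.prod_insert ha, ENNReal.rpow_add_of_nonneg _ _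
      (hr a (Finset.mem_insert_self a s))
      (Finset.sum_nonneg fun i hi => hr i (Finset.mem_insert_of_mem hi)),
      ih fun i hi => hr i (Finset.mem_insert_of_mem hi)]

lemma exists_mul_inv_le {c ε : ℝ≥0∞} (hc : c ≠ ∞) (hε : ε ≠ 0) :
    ∃ A : ℝ≥0∞, 1 ≤ A ∧ A ≠ ∞ ∧ ∀ B, A ≤ B → c * B⁻¹ ≤ ε := by
  refine ⟨c / ε + 1, le_add_self, ENNReal.add_ne_top.2 ⟨ENNReal.div_ne_top hc hε, by simp⟩,
    fun B hB => ?_⟩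
  refine le_trans (mul_le_mul_right (ENNReal.inv_le_inv.2 hB) c) ?_
  rw [← div_eq_mul_inv]
  refine ENNReal.div_le_of_le_mul ?_
  by_cases ht : ε = ∞
  · simp [ht]
  · rw [mul_add, ENNReal.mul_div_cancel hε ht]; exact le_self_add

lemma lintegral_rpow_le_of_ae_le {X : Type*} [MeasurableSpace X] {μ : Measure X} {h : X → ℝ≥0∞}
    {B : ℝ≥0∞} (hB : ∀ᵐ z ∂μ, h z ≤ B) (hBt : B ≠ ∞) {r : ℝ} (hr : 1 ≤ r) :
    ∫⁻ z, h z ^ r ∂μ ≤ B ^ (r - 1) * ∫⁻ z, h z ∂μ := by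
  rw [← lintegral_const_mul' _ _ (ENNReal.rpow_ne_top_of_nonneg (by linarith) hBt)]
  refine lintegral_mono_ae ?_
  filter_upwards [hB] with z hz
  calc h z ^ r = h z ^ (r - 1) * h z := by
        conv_lhs => rw [← sub_add_cancel r 1, ENNReal.rpow_add_of_nonneg _ _ (by linarith) zero_le_one,
          ENNReal.rpow_one]
    _ ≤ _ := by gcongr

/-- A function bounded by A with L¹ norm at most V has ∫ |g|^{q_i} ≤ A^{q_i - 1} V, and 1/q = Σ
1/q_i makes the powers of V combine to V^{1/q}. -/
theorem lintegral_sqFn_rpow_le [NeZero n] [NeZero m] (hΩ : Measurable Ω)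
    (hk : IsAnnular (annularKernel Ω) C γ) {qs : Fin m → ℝ} {q : ℝ} (hqs : ∀ i, 1 < qs i)
    (hq0 : 0 < q) (hq : 1 / q = ∑ i, 1 / qs i) {K : ℝ≥0}
    (hK : ∀ f : Fin m → Rn n → ℂ, (∀ i, MemLp (f i) (ENNReal.ofReal (qs i)) volume) →
      eLpNorm (marcinkiewicz Ω f) (ENNReal.ofReal q) volume
        ≤ K * ∏ i, eLpNorm (f i) (ENNReal.ofReal (qs i)) volume)
    {g : Fin m → Rn n → ℂ} (hg : ∀ i, Measurable (g i)) {A V : ℝ≥0∞} (hAt : A ≠ ∞) (hVt : V ≠ ∞)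
    (hgA : ∀ i, ∀ᵐ z, ‖g i z‖ₑ ≤ A) (hgV : ∀ i, ∫⁻ z, ‖g i z‖ₑ ≤ V) :
    ∫⁻ x, sqFn (annularKernel Ω) g x ^ q ≤
      (2 * (K * ∏ i, (A ^ (qs i - 1)) ^ (1 / qs i))) ^ q * V := by
  have hq1 : (ENNReal.ofReal q).toReal = q := ENNReal.toReal_ofReal hq0.le
  have hnorm : ∀ i, eLpNorm (g i) (ENNReal.ofReal (qs i)) volume ≤
      (A ^ (qs i - 1)) ^ (1 / qs i) * V ^ (1 / qs i) := fun i => by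
    have hi := hqs i
    rw [eLpNorm_eq_lintegral_rpow_enorm_toReal (by simpa using by linarith) ENNReal.ofReal_ne_top,
      ENNReal.toReal_ofReal (by linarith), ← ENNReal.mul_rpow_of_nonneg _ _ (by positivity)]
    gcongr
    refine (lintegral_rpow_le_of_ae_le (hgA i) hAt hi.le).trans ?_
    gcongr
    exact hgV i
  have hmem : ∀ i, MemLp (g i) (ENNReal.ofReal (qs i)) volume := fun i => by
    have hi := hqs i
    refine ⟨(hg i).aestronglyMeasurable, (hnorm i).trans_lt (ENNReal.mul_lt_top ?_ ?_)⟩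
    · exact ENNReal.rpow_lt_top_of_nonneg (by positivity)
        (ENNReal.rpow_ne_top_of_nonneg (by linarith) hAt)
    · exact ENNReal.rpow_lt_top_of_nonneg (by positivity) hVt
  have h1 := (hK g hmem).trans (mul_le_mul_right (Finset.prod_le_prod' fun i _ => hnorm i) _)
  rw [Finset.prod_mul_distrib, ← ennreal_rpow_sum V Finset.univ (r := fun i => 1 / qs i)
    fun i _ => by have := hqs i; positivity, ← hq,
    eLpNorm_eq_lintegral_rpow_enorm_toReal (by simpa using hq0) ENNReal.ofReal_ne_top, hq1] at h1
  have h2 := ENNReal.rpow_le_rpow h1 hq0.le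
  rw [← ENNReal.rpow_mul, one_div_mul_cancel hq0.ne', ENNReal.rpow_one, ← mul_assoc,
    ENNReal.mul_rpow_of_nonneg _ _ hq0.le, ← ENNReal.rpow_mul V, one_div_mul_cancel hq0.ne',
    ENNReal.rpow_one] at h2
  have hμ : ∀ x, sqFn (annularKernel Ω) g x ≤ 2 * marcinkiewicz Ω g x := fun x =>
    sqFn_le_marcinkiewicz hΩ hg fun t ht =>
      integrableOn_integrand hΩ hk hg (fun i => locBdd_of_ae_bdd hAt (hgA i) x) ht
  calc ∫⁻ x, sqFn (annularKernel Ω) g x ^ q ≤ ∫⁻ x, 2 ^ q * marcinkiewicz Ω g x ^ q := by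
        refine lintegral_mono fun x => ?_
        rw [← ENNReal.mul_rpow_of_nonneg _ _ hq0.le]
        exact ENNReal.rpow_le_rpow (hμ x) hq0.le
    _ = 2 ^ q * ∫⁻ x, marcinkiewicz Ω g x ^ q :=
        lintegral_const_mul _ ((measurable_marcinkiewicz hΩ hg).pow_const q)
    _ ≤ 2 ^ q * ((K * ∏ i, (A ^ (qs i - 1)) ^ (1 / qs i)) ^ q * V) := by
        gcongr
        simpa only [enorm_eq_self] using h2
    _ = _ := by rw [← mul_assoc, ← ENNReal.mul_rpow_of_nonneg _ _ hq0.le]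

/-- All f_j are normalised to the same mass bound V = 2^{bn}, and the level is chosen so large that
the exceptional set occupies at most the fraction `ε` of V. The maximal functions are included
because the later comparison of nearby points needs them too. -/
theorem exists_volume_sqFn_le [NeZero n] [NeZero m] (hΩ : Measurable Ω)
    (hk : IsAnnular (annularKernel Ω) C γ) (hγ : 0 < γ) {qs : Fin m → ℝ} {q : ℝ}
    (hqs : ∀ i, 1 < qs i) (hq : 1 / q = ∑ i, 1 / qs i) (hbdd : IsBoundedOnLp Ω qs q)
    {ε : ℝ≥0∞} (hε : ε ≠ 0) :
    ∃ L : ℝ≥0, ∀ (b : ℤ) (f : Fin m → Rn n → ℂ), (∀ j, Measurable (f j)) →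
      (∀ j, ∫⁻ z, ‖f j z‖ₑ ≤ ENNReal.ofReal (2 ^ b) ^ n) →
      volume {x | (∃ j, L < maxFn (fun z => ‖f j z‖ₑ) x) ∨ L < sqFn (annularKernel Ω) f x} ≤
        ε * ENNReal.ofReal (2 ^ b) ^ n := by
  obtain ⟨K, hK⟩ := hbdd
  have hq0 : 0 < q := by
    rw [← one_div_pos, hq]
    exact Finset.sum_pos (fun i _ => by have := hqs i; positivity) ⟨0, Finset.mem_univ _⟩
  have hε3 : ε / 3 ≠ 0 := by simp [hε]
  -- the constants
  have hc1 : (m : ℝ≥0∞) * (5 ^ n * unitVol n) ≠ ∞ :=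
    ENNReal.mul_ne_top (by simp) (ENNReal.mul_ne_top (by simp) unitVol_ne_top)
  obtain ⟨A₁, hA1, hAt, hA⟩ := exists_mul_inv_le hc1 hε3
  -- The height exceeds the maximal function threshold A₁ by the factor 2ⁿ lost in passing from a
  -- ball around π z to the doubled ball around x.
  set A : ℝ≥0∞ := 2 ^ n * A₁ with hAdef
  have hAt' : A ≠ ∞ := ENNReal.mul_ne_top (by simp) hAt
  have hAle : 1 ≤ A := one_le_mul_of_one_le_of_one_le (one_le_pow₀ (by norm_num)) hA1
  set A₃ : ℝ≥0∞ := A * ((unitVol n)⁻¹ + ENNReal.ofReal (2 * (√n + 1)) ^ n) with hA3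
  have hA3t : A₃ ≠ ∞ := ENNReal.mul_ne_top hAt' (ENNReal.add_ne_top.2
    ⟨ENNReal.inv_ne_top.2 unitVol_ne_zero, ofReal_pow_ne_top⟩)
  -- D bounds the averages of both kinds of non-cancelling entries: f_i on G through its maximal
  -- function, and g_i through its sup norm.
  set D : ℝ≥0∞ := A₁ + A₃ * unitVol n with hD
  have hDt : D ≠ ∞ := ENNReal.add_ne_top.2 ⟨hAt, ENNReal.mul_ne_top hA3t unitVol_ne_top⟩
  set M : ℝ≥0∞ := C * (2 ^ n) ^ m * D ^ (m - 1) * cancelConst n γ with hM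
  have hMt : M ≠ ∞ := ENNReal.mul_ne_top (ENNReal.mul_ne_top (ENNReal.mul_ne_top
    ENNReal.coe_ne_top (by finiteness)) (ENNReal.pow_ne_top hDt)) (cancelConst_ne_top n hγ)
  set K₂ : ℝ≥0∞ := (2 * (K * ∏ i, (A₃ ^ (qs i - 1)) ^ (1 / qs i))) ^ q with hK2
  have hK2t : K₂ ≠ ∞ := by
    refine ENNReal.rpow_ne_top_of_nonneg hq0.le (ENNReal.mul_ne_top (by simp)
      (ENNReal.mul_ne_top ENNReal.coe_ne_top (ENNReal.prod_ne_top fun i _ => ?_)))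
    have := hqs i
    exact ENNReal.rpow_ne_top_of_nonneg (by positivity)
      (ENNReal.rpow_ne_top_of_nonneg (by linarith) hA3t)
  obtain ⟨L₁, hL11, hL1t, hL1⟩ := exists_mul_inv_le hK2t hε3
  obtain ⟨L₂, hL21, hL2t, hL2⟩ := exists_mul_inv_le
    (ENNReal.mul_ne_top (ENNReal.natCast_ne_top m) (ENNReal.mul_ne_top hMt ENNReal.ofNat_ne_top) :
      (m : ℝ≥0∞) * (M * 2) ≠ ∞) hε3
  set L : ℝ≥0∞ := max (L₁ ^ (1 / q)) L₂ with hL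
  have hLt : L ≠ ∞ := (max_lt (ENNReal.rpow_lt_top_of_nonneg (by positivity) hL1t)
    hL2t.lt_top).ne
  have hL0 : L ≠ 0 := (lt_of_lt_of_le one_pos (hL21.trans (le_max_right _ _))).ne'
  have hLq : L₁ ≤ L ^ q := by
    calc L₁ = (L₁ ^ (1 / q)) ^ q := by
          rw [← ENNReal.rpow_mul, one_div_mul_cancel hq0.ne', ENNReal.rpow_one]
      _ ≤ _ := by gcongr; exact le_max_left _ _
  -- S(f) is split into m + 1 square functions, each allowed the level L.
  set Λ : ℝ≥0∞ := max A₁ ((m + 1) * L) with hΛ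
  have hΛt : Λ ≠ ∞ := (max_lt hAt.lt_top (ENNReal.mul_lt_top (by finiteness) hLt.lt_top)).ne
  refine ⟨Λ.toNNReal, fun b f hfm hf => ?_⟩
  rw [ENNReal.coe_toNNReal hΛt]
  set V : ℝ≥0∞ := ENNReal.ofReal (2 ^ b) ^ n with hV
  have hVt : V ≠ ∞ := ofReal_pow_ne_top
  obtain ⟨g, E, s, π, hgm, hE, hs, hπ, hgf, hgA, hgE, hdist, hcan, hbad⟩ :=
    exists_calderonZygmund hAle hAt' hfm hf
  set k := annularKernel Ω with hkdef
  set G : Set (Rn n) := {x | ∀ j, maxFn (fun z => ‖f j z‖ₑ) x ≤ A₁} with hG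
  have hGm : MeasurableSet G := by
    have : G = ⋂ j, {x | maxFn (fun z => ‖f j z‖ₑ) x ≤ A₁} := by ext; simp [hG]
    rw [this]
    exact MeasurableSet.iInter fun j => measurableSet_le (measurable_maxFn _) measurable_const
  set bb : Fin m → Rn n → ℂ := fun j z => f j z - g j z with hbb
  have hfi : ∀ j, Integrable (f j) := fun j =>
    ⟨(hfm j).aestronglyMeasurable, (hf j).trans_lt hVt.lt_top⟩
  have hgi : ∀ j, Integrable (g j) := fun j =>
    ⟨(hgm j).aestronglyMeasurable, ((hgf j).trans (hf j)).trans_lt hVt.lt_top⟩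
  have hbm : ∀ j, Measurable (bb j) := fun j => (hfm j).sub (hgm j)
  have hbi : ∀ j, Integrable (bb j) := fun j => (hfi j).sub (hgi j)
  have hsum : (fun i z => g i z + bb i z) = f := by
    funext i z; simp [hbb]
  set h : Fin m → Fin m → Rn n → ℂ := mixedTuple f bb g with hh
  have hhm : ∀ j i, Measurable (h j i) := fun j i =>
    mixedTuple_induction (P := Measurable) hfm hbm hgm j i
  have hhi : ∀ j i, Integrable (h j i) := fun j i =>
    mixedTuple_induction (P := fun u => Integrable u) hfi hbi hgi j i
  have hsq : ∀ x, sqFn k f x ≤ sqFn k g x + ∑ j, sqFn k (h j) x := fun x => by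
    have := sqFn_add_le hk hgm hbm (fun i => (hgi i).locallyIntegrable)
      (fun i => (hbi i).locallyIntegrable) x
    rwa [hsum] at this
  -- If a cell larger than 2^l came within 2 · 2^l of x, the doubled ball around x would show an
  -- average above A₁, against x ∈ G.
  have hscale : ∀ x ∈ G, ∀ z ∈ E, ∀ l : ℤ,
      z ∈ closedBall x (2 * 2 ^ l) ∨ π z ∈ closedBall x (2 * 2 ^ l) → s z ≤ l := by
    intro x hx z hz l hzl
    by_contra hlt
    rw [not_le] at hlt
    obtain ⟨j, hj⟩ := hbad z hz
    refine absurd hj (not_lt.2 ?_)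
    have h2 : (0 : ℝ) < 2 ^ s z := by positivity
    have hpow : 2 * (2 : ℝ) ^ l ≤ 2 ^ s z := by
      rw [← zpow_one_add₀ two_ne_zero]
      exact zpow_le_zpow_right₀ one_le_two (by omega)
    have hn0 : 0 ≤ √(n : ℝ) * 2 ^ s z := by positivity
    have hd : dist (π z) x ≤ (√n + 1) * 2 ^ s z := by
      have := hdist z hz
      rcases hzl with h | h <;> rw [mem_closedBall] at h
      · linarith [dist_triangle (π z) z x]
      · linarith
    have hr : 0 < (√n + 1) * (2 : ℝ) ^ s z := by positivity
    refine (ballAvg_le_of_subset _ two_pos (y := x) fun w hw => ?_).trans ?_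
    · rw [mem_closedBall] at hw ⊢
      linarith [dist_triangle w (π z) x]
    · rw [hAdef, ENNReal.ofReal_ofNat]
      gcongr
      exact (ballAvg_le_maxFn _ _ (by positivity)).trans (hx j)
  have hh1 : ∀ j, ∫⁻ x in G, sqFn k (h j) x ≤ M * (2 * V) := fun j => by
    have hjj : h j j = bb j := mixedTuple_self _ _ _ _
    refine (setLIntegral_sqFn_le_of_cancel hk hγ (hhm j) (hhi j) j (D := D) hE hGm hs hπ ?_ ?_ hdist
      hscale ?_).trans ?_
    · intro φ hφ hB
      rw [hjj]; exact hcan j φ hφ hB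
    · intro z hz
      rw [hjj, hbb]; simp only [hgE j z hz, sub_self]
    · intro x hx i hij r hr
      have : h j i = f i ∨ h j i = g i := by
        rw [hh, mixedTuple]; split_ifs
        exacts [Or.inl rfl, Or.inr rfl]
      rcases this with e | e <;> rw [e]
      · exact ((ballAvg_le_maxFn _ _ hr).trans (hx i)).trans le_self_add
      · exact (ballAvg_le_of_ae_le (hgA i) x hr).trans le_add_self
    · rw [hjj]
      gcongr
      calc ∫⁻ z, ‖bb j z‖ₑ ≤ ∫⁻ z, (‖f j z‖ₑ + ‖g j z‖ₑ) := lintegral_mono fun z => enorm_sub_le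
        _ = (∫⁻ z, ‖f j z‖ₑ) + ∫⁻ z, ‖g j z‖ₑ := lintegral_add_left (hfm j).enorm _
        _ ≤ V + V := add_le_add (hf j) ((hgf j).trans (hf j))
        _ = 2 * V := (two_mul V).symm
  have hsub : {x | (∃ j, Λ < maxFn (fun z => ‖f j z‖ₑ) x) ∨ Λ < sqFn k f x} ⊆
      (⋃ j, {x | A₁ < maxFn (fun z => ‖f j z‖ₑ) x}) ∪ ({x | L ^ q ≤ sqFn k g x ^ q} ∪
        ⋃ j, ({x | L ≤ sqFn k (h j) x} ∩ G)) := by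
    intro x hx
    by_cases hxG : x ∈ G
    · rcases hx with ⟨j, hj⟩ | hx
      · exact absurd hj (not_lt.2 ((hxG j).trans (le_max_left _ _)))
      · right
        by_contra hcon
        simp only [mem_union, mem_iUnion, mem_inter_iff, mem_ofPred_eq, not_or, not_exists, not_and,
          not_le, ENNReal.rpow_lt_rpow_iff hq0] at hcon
        refine absurd hx (not_lt.2 ?_)
        calc sqFn k f x ≤ L + ∑ _j : Fin m, L := by
              refine (hsq x).trans (add_le_add hcon.1.le (Finset.sum_le_sum fun j _ => ?_))
              by_contra hlt
              exact hcon.2 j (not_le.1 hlt).le hxG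
          _ = (m + 1) * L := by simp; ring
          _ ≤ Λ := le_max_right _ _
    · left
      simpa [hG] using hxG
  calc _ ≤ _ := measure_mono hsub
    _ ≤ ε / 3 * V + (ε / 3 * V + ε / 3 * V) := by
        refine (measure_union_le _ _).trans (add_le_add ?_ ((measure_union_le _ _).trans
          (add_le_add ?_ ?_)))
        · calc _ ≤ ∑ j, volume {x | A₁ < maxFn (fun z => ‖f j z‖ₑ) x} :=
                measure_iUnion_fintype_le _ _
            _ ≤ ∑ _j : Fin m, 5 ^ n * unitVol n * (A₁⁻¹ * V) := by
                refine Finset.sum_le_sum fun j _ => (maxFn_weak _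
                  (lt_of_lt_of_le one_pos hA1).ne' hAt).trans ?_
                gcongr; exact hf j
            _ = m * (5 ^ n * unitVol n) * A₁⁻¹ * V := by simp; ring
            _ ≤ _ := by gcongr; exact hA A₁ le_rfl
        · calc _ ≤ (∫⁻ x, sqFn k g x ^ q) / L ^ q :=
                meas_ge_le_lintegral_div ((measurable_sqFn hk hgm).pow_const q).aemeasurable
                  (by simp [hL0, hLt]) (ENNReal.rpow_ne_top_of_nonneg hq0.le hLt)
            _ ≤ (K₂ * V) / L ^ q := by
                gcongr
                exact lintegral_sqFn_rpow_le hΩ hk hqs hq0 hq hK hgm hA3t hVt hgA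
                  fun i => (hgf i).trans (hf i)
            _ = K₂ * (L ^ q)⁻¹ * V := by rw [div_eq_mul_inv]; ring
            _ ≤ _ := by gcongr; exact hL1 _ hLq
        · calc _ ≤ ∑ j, volume ({x | L ≤ sqFn k (h j) x} ∩ G) := measure_iUnion_fintype_le _ _
            _ ≤ ∑ _j : Fin m, M * (2 * V) / L := by
                refine Finset.sum_le_sum fun j _ => ?_
                rw [← Measure.restrict_apply (measurableSet_le measurable_const
                  (measurable_sqFn hk (hhm j)))]
                refine (meas_ge_le_lintegral_div (measurable_sqFn hk (hhm j)).aemeasurable hL0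
                  hLt).trans ?_
                gcongr
                exact hh1 j
            _ = m * (M * 2) * L⁻¹ * V := by rw [div_eq_mul_inv]; simp; ring
            _ ≤ _ := by gcongr; exact hL2 _ (le_max_right _ _)
    _ = ε * V := by
        rw [← add_mul, ← add_mul, ← add_assoc, ENNReal.add_thirds]

end WeakEndpoint

/-! ### Finite ranges of scales and comparison of nearby points. -/

section Truncations

variable {n m : ℕ} {k : ℝ → (Fin m → Rn n) → ℂ} {C : ℝ≥0} {γ : ℝ} {f : Fin m → Rn n → ℂ}

/-- A weak type bound at the endpoint for tuples normalised in `L¹`. -/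
def HasWeakBound (k : ℝ → (Fin m → Rn n) → ℂ) (L : ℝ≥0) (ε : ℝ≥0∞) : Prop :=
  ∀ (b : ℤ) (f : Fin m → Rn n → ℂ), (∀ j, Measurable (f j)) →
    (∀ j, ∫⁻ z, ‖f j z‖ₑ ≤ ENNReal.ofReal (2 ^ b) ^ n) →
    volume {x | (∃ j, L < maxFn (fun z => ‖f j z‖ₑ) x) ∨ L < sqFn k f x} ≤
      ε * ENNReal.ofReal (2 ^ b) ^ n

lemma maxFn_const_mul {c : ℝ≥0∞} (hc : c ≠ ∞) (h : Rn n → ℝ≥0∞) (x : Rn n) :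
    maxFn (fun z => c * h z) x = c * maxFn h x := by
  simp only [maxFn, ENNReal.mul_iSup, ballAvg, lintegral_const_mul' _ _ hc, mul_left_comm c]

lemma sqFn_smul (c : Fin m → ℂ) (x : Rn n) :
    sqFn k (fun i z => c i * f i z) x = (∏ i, ‖c i‖ₑ) * sqFn k f x := by
  have hp : ‖∏ i, c i‖ₑ = ∏ i, ‖c i‖ₑ := by
    simp_rw [← ofReal_norm, norm_prod]
    exact ENNReal.ofReal_prod_of_nonneg fun i _ => norm_nonneg _
  unfold sqFn
  simp_rw [annOp_smul, enorm_mul, mul_pow]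
  rw [lintegral_const_mul' _ _ (by finiteness), ENNReal.mul_rpow_of_nonneg _ _ (by norm_num),
    ennreal_sqrt_sq, hp]

/-- Multilinearity: apply the bound to f_j / A_j. Dividing requires A_j to be nonzero and finite. -/
lemma HasWeakBound.scaled {L : ℝ≥0} {ε : ℝ≥0∞} (hw : HasWeakBound k L ε) {b : ℤ}
    (hf : ∀ j, Measurable (f j)) {A : Fin m → ℝ≥0∞} (hA0 : ∀ j, A j ≠ 0) (hAt : ∀ j, A j ≠ ∞)
    (hfA : ∀ j, ∫⁻ z, ‖f j z‖ₑ ≤ A j * ENNReal.ofReal (2 ^ b) ^ n) :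
    volume {x | (∃ j, L * A j < maxFn (fun z => ‖f j z‖ₑ) x) ∨ L * ∏ j, A j < sqFn k f x} ≤
      ε * ENNReal.ofReal (2 ^ b) ^ n := by
  set c : Fin m → ℂ := fun j => (((A j).toReal⁻¹ : ℝ) : ℂ) with hc
  have hce : ∀ j, ‖c j‖ₑ = (A j)⁻¹ := fun j => by
    have hpos : 0 < (A j).toReal := ENNReal.toReal_pos (hA0 j) (hAt j)
    rw [← ofReal_norm, hc, Complex.norm_real, Real.norm_of_nonneg (by positivity),
      ENNReal.ofReal_inv_of_pos hpos, ENNReal.ofReal_toReal (hAt j)]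
  have hct : ∀ j, (A j)⁻¹ ≠ ∞ := fun j => ENNReal.inv_ne_top.2 (hA0 j)
  have key : ∀ {a u v : ℝ≥0∞}, a ≠ 0 → a ≠ ∞ → u * a < v → u < a⁻¹ * v := fun h0 ht h => by
    rw [← ENNReal.div_eq_inv_mul]
    exact (ENNReal.lt_div_iff_mul_lt (Or.inl h0) (Or.inl ht)).2 h
  refine (measure_mono fun x hx => ?_).trans (hw b (fun j z => c j * f j z)
    (fun j => (hf j).const_mul _) fun j => ?_)
  · simp only [mem_ofPred_eq, enorm_mul, hce, maxFn_const_mul (hct _), sqFn_smul] at hx ⊢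
    rcases hx with ⟨j, hj⟩ | hx
    · exact Or.inl ⟨j, key (hA0 j) (hAt j) hj⟩
    · right
      rw [← ENNReal.prod_inv_distrib]
      · exact key (Finset.prod_ne_zero_iff.2 fun j _ => hA0 j)
          (ENNReal.prod_ne_top fun j _ => hAt j) hx
      · intro i _ j _ _; exact Or.inl (hA0 i)
  · simp_rw [enorm_mul, hce]
    rw [lintegral_const_mul' _ _ (hct j), ← ENNReal.div_eq_inv_mul]
    refine ENNReal.div_le_of_le_mul ?_
    rw [mul_comm]; exact hfA j

/-- The square function restricted to the scales `2 ^ l`, `a ≤ l < b`. -/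
def partialSq (k : ℝ → (Fin m → Rn n) → ℂ) (f : Fin m → Rn n → ℂ) (a b : ℤ) (x : Rn n) : ℝ≥0∞ :=
  (∑ l ∈ Finset.Ico a b, blockNorm k f (2 ^ l) x ^ 2) ^ (1 / 2 : ℝ)

lemma partialSq_sq (a b : ℤ) (x : Rn n) :
    partialSq k f a b x ^ 2 = ∑ l ∈ Finset.Ico a b, blockNorm k f (2 ^ l) x ^ 2 := by
  rw [partialSq, ennreal_sq_sqrt]

lemma measurable_partialSq (hk : IsAnnular k C γ) (hf : ∀ i, Measurable (f i)) (a b : ℤ) :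
    Measurable (partialSq k f a b) :=
  (Finset.measurable_fun_sum _ fun _ _ => (measurable_blockNorm hk hf _).pow_const 2).pow_const _

lemma partialSq_le_add {a b c : ℤ} (hab : a ≤ b) (hbc : b ≤ c) (x : Rn n) :
    partialSq k f a c x ≤ partialSq k f a b x + partialSq k f b c x := by
  refine ennreal_sqrt_le ?_
  rw [← Finset.Ico_union_Ico_eq_Ico hab hbc,
    Finset.sum_union (Finset.Ico_disjoint_Ico_consecutive a b c), ← partialSq_sq, ← partialSq_sq,
    add_sq]
  calc _ ≤ partialSq k f a b x ^ 2 + partialSq k f b c x ^ 2 +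
        2 * partialSq k f a b x * partialSq k f b c x := le_self_add
    _ = _ := by ring

lemma blockNorm_congr (hk : IsAnnular k C γ) {g : Fin m → Rn n → ℂ} {T : ℝ} (hT : 0 < T) {x : Rn n}
    (h : ∀ i, ∀ z ∈ closedBall x (2 * T), f i z = g i z) :
    blockNorm k f T x = blockNorm k g T x := by
  unfold blockNorm
  congr 1
  refine setLIntegral_congr_fun measurableSet_Ioc fun t ht => ?_
  rw [annOp_congr hk (hT.trans ht.1).le fun i z hz =>
    h i z (closedBall_subset_closedBall ht.2 hz)]

/-- The constant in the comparison of `blockNorm` at two points at distance at most `N * T`. -/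
def compareConst (n m : ℕ) (C : ℝ≥0) (N : ℝ) : ℝ≥0∞ :=
  C * ((3 ^ n) ^ m + (2 ^ n * ENNReal.ofReal ((N + 2) / 2) ^ n) ^ m)

/-- Up to distance T this is the regularity estimate. Between T and N T the factor (dist / T)^γ is
at least 1, so the size estimate alone suffices. -/
lemma blockNorm_le_add_maxFn [NeZero m] (hk : IsAnnular k C γ) (hγ : 0 < γ)
    (hf : ∀ i, Measurable (f i)) (hl : ∀ i, LocallyIntegrable (f i)) {T N : ℝ} (hT : 0 < T)
    (hN : 0 ≤ N) {x x' : Rn n} (hx : dist x x' ≤ N * T) :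
    blockNorm k f T x ≤ blockNorm k f T x' + compareConst n m C N *
      ENNReal.ofReal (dist x x' / T) ^ γ * ∏ i, maxFn (fun z => ‖f i z‖ₑ) x' := by
  rcases le_or_gt (dist x x') T with h | h
  · refine (blockNorm_regular hk hf hl hT h).trans ?_
    rw [compareConst]
    calc _ ≤ blockNorm k f T x' + C * ENNReal.ofReal (dist x x' / T) ^ γ *
          ((3 ^ n) ^ m * ∏ i, maxFn (fun z => ‖f i z‖ₑ) x') := by
          gcongr with i
          exact ballAvg_le_maxFn _ _ (by positivity)
      _ = blockNorm k f T x' + C * (3 ^ n) ^ m * ENNReal.ofReal (dist x x' / T) ^ γ *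
          ∏ i, maxFn (fun z => ‖f i z‖ₑ) x' := by ring
      _ ≤ _ := by gcongr; exact le_self_add
  · refine (blockNorm_le hk hf hT x).trans (le_trans ?_ le_add_self)
    have h1 : 1 ≤ ENNReal.ofReal (dist x x' / T) ^ γ := by
      refine ENNReal.one_le_rpow ?_ hγ
      rw [ENNReal.one_le_ofReal, one_le_div hT]; exact h.le
    have h2 : ∀ i, ballAvg (fun z => ‖f i z‖ₑ) x (2 * T) ≤
        ENNReal.ofReal ((N + 2) / 2) ^ n * maxFn (fun z => ‖f i z‖ₑ) x' := fun i => by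
      refine (ballAvg_le_of_subset _ (y := x') (K := (N + 2) / 2) (by positivity) ?_).trans ?_
      · refine closedBall_subset_closedBall' ?_
        nlinarith
      · gcongr
        exact ballAvg_le_maxFn _ _ (by positivity)
    calc _ ≤ C * ((2 ^ n) ^ m * ∏ i, (ENNReal.ofReal ((N + 2) / 2) ^ n *
            maxFn (fun z => ‖f i z‖ₑ) x')) := by gcongr with i; exact h2 i
      _ = C * (2 ^ n * ENNReal.ofReal ((N + 2) / 2) ^ n) ^ m * 1 *
            ∏ i, maxFn (fun z => ‖f i z‖ₑ) x' := by
          rw [Finset.prod_mul_distrib, Finset.prod_const, Finset.card_univ, Fintype.card_fin,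
            mul_pow]
          ring
      _ ≤ _ := by
          rw [compareConst]
          gcongr
          exact le_add_self

/-- The constant in the comparison of `partialSq` with the square function at a nearby point. -/
def nearConst (n m : ℕ) (C : ℝ≥0) (γ N : ℝ) : ℝ≥0∞ :=
  compareConst n m C N * ENNReal.ofReal N ^ γ * (1 - (1 / 2 : ℝ≥0∞) ^ γ)⁻¹

lemma nearConst_ne_top (n m : ℕ) (C : ℝ≥0) {γ : ℝ} (hγ : 0 < γ) (N : ℝ) :
    nearConst n m C γ N ≠ ∞ := by
  refine ENNReal.mul_ne_top (ENNReal.mul_ne_top ?_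
    (ENNReal.rpow_ne_top_of_nonneg hγ.le ENNReal.ofReal_ne_top)) ?_
  · rw [compareConst]; finiteness
  · rw [ENNReal.inv_ne_top, ne_eq, tsub_eq_zero_iff_le, not_le]
    exact ENNReal.rpow_lt_one (by simp) hγ

/-- Points at distance at most N 2^a are compared at each scale 2^l ≥ 2^a with error O((N 2^a /
2^l)^γ), which is summable in l. Truncating below at a is essential: at finer scales the two points
are unrelated. -/
lemma partialSq_le_of_dist_le [NeZero m] (hk : IsAnnular k C γ) (hγ : 0 < γ)
    (hf : ∀ i, Measurable (f i)) (hl : ∀ i, LocallyIntegrable (f i)) {N : ℝ} (hN : 0 ≤ N) {a b : ℤ}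
    {x x' : Rn n} (hx : dist x x' ≤ N * 2 ^ a) :
    partialSq k f a b x ≤
      2 * (sqFn k f x' + nearConst n m C γ N * ∏ i, maxFn (fun z => ‖f i z‖ₑ) x') := by
  set P := ∏ i, maxFn (fun z => ‖f i z‖ₑ) x' with hP
  set v : ℤ → ℝ≥0∞ := fun l => compareConst n m C N * ENNReal.ofReal N ^ γ *
    (if a ≤ l then ENNReal.ofReal (2 ^ a / 2 ^ l) ^ γ else 0) * P with hv
  have hpt : ∀ l ∈ Finset.Ico a b, blockNorm k f (2 ^ l) x ≤ blockNorm k f (2 ^ l) x' + v l := by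
    intro l hlab
    have hal : a ≤ l := (Finset.mem_Ico.1 hlab).1
    have h2 : (0 : ℝ) < 2 ^ l := by positivity
    have hpow : (2 : ℝ) ^ a ≤ 2 ^ l := zpow_le_zpow_right₀ one_le_two hal
    refine (blockNorm_le_add_maxFn hk hγ hf hl h2 hN
      (hx.trans (mul_le_mul_of_nonneg_left hpow hN))).trans ?_
    simp only [hv, if_pos hal]
    rw [mul_assoc (compareConst n m C N) (ENNReal.ofReal N ^ γ), ← ENNReal.mul_rpow_of_nonneg _ _ hγ.le,
      ← ENNReal.ofReal_mul hN, ← mul_div_assoc]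
    gcongr
  have hsum : ∑ l ∈ Finset.Ico a b, v l ≤ nearConst n m C γ N * P := by
    calc _ ≤ ∑' l, v l := ENNReal.sum_le_tsum _
      _ = _ := by
        simp only [hv]
        rw [ENNReal.tsum_mul_right, ENNReal.tsum_mul_left, tsum_int_rpow_geometric, nearConst]
  set S := ∑ l ∈ Finset.Ico a b, v l with hS
  have hvS : ∑ l ∈ Finset.Ico a b, v l ^ 2 ≤ S ^ 2 := by
    rw [sq S, hS, Finset.sum_mul]
    refine Finset.sum_le_sum fun l hl => ?_
    rw [sq]
    gcongr
    exact Finset.single_le_sum (f := v) (fun _ _ => zero_le) hl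
  refine ennreal_sqrt_le ?_
  calc ∑ l ∈ Finset.Ico a b, blockNorm k f (2 ^ l) x ^ 2
      ≤ ∑ l ∈ Finset.Ico a b, 2 * (blockNorm k f (2 ^ l) x' ^ 2 + v l ^ 2) := by
        refine Finset.sum_le_sum fun l hl => ?_
        exact (pow_le_pow_left' (hpt l hl) 2).trans (ennreal_add_sq_le _ _)
    _ = 2 * (∑ l ∈ Finset.Ico a b, blockNorm k f (2 ^ l) x' ^ 2 +
          ∑ l ∈ Finset.Ico a b, v l ^ 2) := by
        rw [← Finset.mul_sum, Finset.sum_add_distrib]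
    _ ≤ 2 * (sqFn k f x' ^ 2 + (nearConst n m C γ N * P) ^ 2) := by
        gcongr
        · rw [sqFn_sq_eq_tsum]; exact ENNReal.sum_le_tsum _
        · exact hvS.trans (pow_le_pow_left' hsum 2)
    _ ≤ (2 * (sqFn k f x' + nearConst n m C γ N * P)) ^ 2 := by
        generalize nearConst n m C γ N * P = w
        rw [mul_pow, add_sq, sq (2 : ℝ≥0∞), mul_assoc]
        gcongr
        calc _ ≤ sqFn k f x' ^ 2 + w ^ 2 + 2 * sqFn k f x' * w := le_self_add
          _ = 1 * (sqFn k f x' ^ 2 + 2 * sqFn k f x' * w + w ^ 2) := by ring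
          _ ≤ _ := by gcongr; norm_num

end Truncations

/-! ### Sparse-type domination by induction on the number of scales. -/

section Sparse

variable {n m : ℕ} {k : ℝ → (Fin m → Rn n) → ℂ} {C : ℝ≥0} {γ : ℝ} {f : Fin m → Rn n → ℂ}

lemma exists_mem_notMem_of_volume_le {X : Type*} [MeasurableSpace X] {μ : Measure X} {R O : Set X}
    (h0 : μ R ≠ 0) (ht : μ R ≠ ∞) (h : ¬μ R < 2 * μ (R ∩ O)) : ∃ x ∈ R, x ∉ O := by
  by_contra! hcon
  rw [inter_eq_left.2 hcon, two_mul] at h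
  exact h (ENNReal.lt_add_right ht h0)

lemma setLIntegral_inter_le_maxFn (g : Rn n → ℝ≥0∞) [NeZero n] {b : ℤ} {x : Rn n} :
    ∫⁻ y in gridCell b (gridIdx b x), g y ≤
      ENNReal.ofReal (2 * √n) ^ n * ENNReal.ofReal (2 ^ b) ^ n * maxFn g x := by
  have hn : (0 : ℝ) < n := by exact_mod_cast NeZero.pos n
  have hr : 0 < 2 * √n * (2 : ℝ) ^ b := by positivity
  calc ∫⁻ y in gridCell b (gridIdx b x), g y ≤ ∫⁻ y in closedBall x (2 * √n * 2 ^ b), g y :=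
        lintegral_mono_set fun y hy => dist_le_of_gridIdx_eq hy
    _ ≤ _ := by
        rw [setLIntegral_closedBall_eq g x hr, ← mul_pow, ← ENNReal.ofReal_mul (by positivity)]
        gcongr
        exact ballAvg_le_maxFn _ _ hr

/-- Scales below the side of a cell see only this ball around it, which is why the tuple can be
localised there. -/
lemma closedBall_subset_of_mem_gridCell {b l : ℤ} {x : Rn n} (hlb : l < b) :
    closedBall x (2 * 2 ^ l) ⊆ closedBall (gridPt b (gridIdx b x)) ((√n + 1) * 2 ^ b) := by
  have h2 : 2 * (2 : ℝ) ^ l ≤ 2 ^ b := by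
    rw [← zpow_one_add₀ two_ne_zero]
    exact zpow_le_zpow_right₀ one_le_two (by omega)
  refine closedBall_subset_closedBall' ?_
  have := dist_gridPt_le b x
  rw [dist_comm]
  linarith

lemma setLIntegral_ball_gridPt_le (h : Rn n → ℝ≥0∞) (b : ℤ) (x : Rn n) :
    ∫⁻ z in closedBall (gridPt b (gridIdx b x)) ((√n + 1) * 2 ^ b), h z ≤
      ENNReal.ofReal (2 * √n + 1) ^ n * ENNReal.ofReal (2 ^ b) ^ n * maxFn h x := by
  have hr : 0 < (2 * √n + 1) * (2 : ℝ) ^ b := by positivity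
  calc _ ≤ ∫⁻ z in closedBall x ((2 * √n + 1) * 2 ^ b), h z := by
        refine lintegral_mono_set (closedBall_subset_closedBall' ?_)
        have := dist_gridPt_le b x
        linarith
    _ ≤ _ := by
        rw [setLIntegral_closedBall_eq h x hr, ← mul_pow, ← ENNReal.ofReal_mul (by positivity)]
        gcongr
        exact ballAvg_le_maxFn _ _ hr

/-- The constant in the domination of the square function near a good point. -/
def goodConst (n m : ℕ) (C : ℝ≥0) (γ : ℝ) (L : ℝ≥0) : ℝ≥0∞ :=
  2 * (L + nearConst n m C γ (4 * √n) * L ^ m)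

/-- Outside a set of small measure, and near its complement, the square function of the localised
tuple is controlled by the product of the averages. -/
lemma exists_exceptional [NeZero n] [NeZero m] (hk : IsAnnular k C γ) (hγ : 0 < γ) {L : ℝ≥0}
    {ε : ℝ≥0∞} (hw : HasWeakBound k L ε) (hf : ∀ i, Measurable (f i))
    (hl : ∀ i, LocallyIntegrable (f i)) (b : ℤ) (v : Fin n → ℤ) {A : Fin m → ℝ≥0∞}
    (hA0 : ∀ j, A j ≠ 0) (hAt : ∀ j, A j ≠ ∞)
    (hfA : ∀ j, ∫⁻ z in closedBall (gridPt b v) ((√n + 1) * 2 ^ b), ‖f j z‖ₑ =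
      A j * ENNReal.ofReal (2 ^ b) ^ n) :
    ∃ O : Set (Rn n), volume O ≤ ε * ENNReal.ofReal (2 ^ b) ^ n ∧
      ∀ x ∈ gridCell b v, ∀ x' ∉ O, ∀ a, dist x x' ≤ 4 * √n * 2 ^ a →
        partialSq k f a b x ≤ goodConst n m C γ L * ∏ j, A j := by
  set B := closedBall (gridPt b v) ((√n + 1) * 2 ^ b) with hB
  have hBm : MeasurableSet B := measurableSet_closedBall
  set F : Fin m → Rn n → ℂ := fun j => B.indicator (f j) with hF
  have hFm : ∀ j, Measurable (F j) := fun j => (hf j).indicator hBm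
  have hFi : ∀ j, Integrable (F j) := fun j =>
    ((hl j).integrableOn_isCompact (isCompact_closedBall _ _)).integrable_indicator hBm
  have hFA : ∀ j, ∫⁻ z, ‖F j z‖ₑ ≤ A j * ENNReal.ofReal (2 ^ b) ^ n := fun j => by
    simp only [hF, enorm_indicator_eq_indicator_enorm]
    rw [lintegral_indicator hBm, hfA j]
  refine ⟨_, hw.scaled hFm hA0 hAt hFA, fun x hx x' hx' a hxx' => ?_⟩
  simp only [mem_ofPred_eq, not_or, not_exists, not_lt] at hx'
  have hx : gridIdx b x = v := hx
  have hcongr : partialSq k f a b x = partialSq k F a b x := by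
    unfold partialSq
    congr 1
    refine Finset.sum_congr rfl fun l hl => ?_
    rw [blockNorm_congr hk (g := F) (by positivity) fun i z hz => ?_]
    rw [hF]
    refine (indicator_of_mem ?_ _).symm
    rw [hB, ← hx]
    exact closedBall_subset_of_mem_gridCell (Finset.mem_Ico.1 hl).2 hz
  rw [hcongr]
  refine (partialSq_le_of_dist_le hk hγ hFm (fun i => (hFi i).locallyIntegrable) (by positivity)
    hxx').trans ?_
  calc _ ≤ 2 * (L * ∏ j, A j + nearConst n m C γ (4 * √n) * ∏ j, (L * A j)) := by
        gcongr with j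
        · exact hx'.2
        · exact hx'.1 j
    _ = _ := by
        rw [Finset.prod_mul_distrib, Finset.prod_const, Finset.card_univ, Fintype.card_fin,
          goodConst]
        ring

/-- The constant in the domination of the truncated square function by maximal functions. -/
def sparseConst (n m : ℕ) (C : ℝ≥0) (γ : ℝ) (L : ℝ≥0) : ℝ≥0∞ :=
  2 * goodConst n m C γ L * (ENNReal.ofReal (2 * √n + 1) ^ n) ^ m * ENNReal.ofReal (2 * √n) ^ n

lemma sparseConst_ne_top (n m : ℕ) (C : ℝ≥0) {γ : ℝ} (hγ : 0 < γ) (L : ℝ≥0) :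
    sparseConst n m C γ L ≠ ∞ := by
  have := nearConst_ne_top n m C hγ (4 * √n)
  unfold sparseConst goodConst
  finiteness

/-- Outside an exceptional set O, and near its complement, the truncated square function on Q is at
most a constant times ∏ A_j, with A_j averages of |f_j| near Q. Inside Q the maximal cells more than
half filled by O cover at most half of Q; on them the coarse scales are still controlled through the
parent cell and the fine scales are left to induction. The main term is charged to the rest of Q.
These remainders are disjoint over all generations, so the constant does not grow with d. -/
theorem setLIntegral_partialSq_mul_le [NeZero n] [NeZero m] (hk : IsAnnular k C γ) (hγ : 0 < γ)
    {L : ℝ≥0} (hw : HasWeakBound k L (1 / 4)) (hf : ∀ i, Measurable (f i))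
    (hl : ∀ i, LocallyIntegrable (f i)) {g : Rn n → ℝ≥0∞} (hg : Measurable g) (a : ℤ) (d : ℕ)
    (v : Fin n → ℤ) :
    ∫⁻ x in gridCell (a + d) v, partialSq k f a (a + d) x * g x ≤
      sparseConst n m C γ L *
        ∫⁻ x in gridCell (a + d) v, (∏ i, maxFn (fun z => ‖f i z‖ₑ) x) * maxFn g x := by
  induction d using Nat.strong_induction_on generalizing v with
  | _ d ih =>
  set b : ℤ := a + d with hb
  have hab : a ≤ b := by omega
  set Q : Set (Rn n) := gridCell b v with hQ
  have hQm : MeasurableSet Q := measurableSet_gridCell b v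
  set V : ℝ≥0∞ := ENNReal.ofReal (2 ^ b) ^ n with hV
  have hQV : volume Q = V := volume_gridCell b v
  have hV0 : V ≠ 0 := ofReal_pow_ne_zero (by positivity)
  have hVt : V ≠ ∞ := ofReal_pow_ne_top
  set B := closedBall (gridPt b v) ((√n + 1) * 2 ^ b) with hB
  set A : Fin m → ℝ≥0∞ := fun j => V⁻¹ * ∫⁻ z in B, ‖f j z‖ₑ with hA
  set H : Rn n → ℝ≥0∞ := fun x => (∏ i, maxFn (fun z => ‖f i z‖ₑ) x) * maxFn g x with hH
  have hAt : ∀ j, A j ≠ ∞ := fun j => ENNReal.mul_ne_top (ENNReal.inv_ne_top.2 hV0)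
    ((hl j).integrableOn_isCompact (isCompact_closedBall _ _)).2.ne
  have hfA : ∀ j, ∫⁻ z in B, ‖f j z‖ₑ = A j * V := fun j => by
    rw [hA, mul_comm, ← mul_assoc, ENNReal.mul_inv_cancel hV0 hVt, one_mul]
  -- If some f_j vanishes almost everywhere near Q, all blocks in question are 0; this case is
  -- excluded because the weak bound is rescaled by the A_j.
  by_cases hA0 : ∃ j, A j = 0
  · obtain ⟨j, hj⟩ := hA0
    have hBj : ∫⁻ z in B, ‖f j z‖ₑ = 0 := by rw [hfA, hj, zero_mul]
    refine le_of_eq_of_le ?_ zero_le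
    rw [setLIntegral_congr_fun hQm (g := fun _ => 0), lintegral_zero]
    intro x hx
    have hx : gridIdx b x = v := hx
    have : partialSq k f a b x = 0 := by
      rw [partialSq, Finset.sum_eq_zero, ENNReal.zero_rpow_of_pos (by norm_num)]
      intro l hlab
      have h0 : ballAvg (fun z => ‖f j z‖ₑ) x (2 * 2 ^ l) = 0 := by
        rw [ballAvg, mul_eq_zero]
        refine Or.inr (le_antisymm (le_of_le_of_eq (lintegral_mono_set ?_) hBj) zero_le)
        rw [hB, ← hx]
        exact closedBall_subset_of_mem_gridCell (Finset.mem_Ico.1 hlab).2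
      have := blockNorm_le hk hf (show (0 : ℝ) < 2 ^ l by positivity) x
      rw [Finset.prod_eq_zero (Finset.mem_univ j) h0, mul_zero, mul_zero, nonpos_iff_eq_zero] at this
      rw [this]; simp
    simp [this]
  push Not at hA0
  obtain ⟨O, hO, hgood⟩ := exists_exceptional hk hγ hw hf hl b v hA0 hAt hfA
  set c := goodConst n m C γ L * ∏ j, A j with hc
  set κ := ENNReal.ofReal (2 * √n + 1) ^ n with hκ
  set κ' := ENNReal.ofReal (2 * √n) ^ n with hκ'
  set Bad : ℤ → (Fin n → ℤ) → Prop := fun s w =>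
    a ≤ s ∧ s < b ∧ volume (gridCell s w) < 2 * volume (gridCell s w ∩ O) with hBad
  have hbadle : ∀ s w, b ≤ s → ¬Bad s w := fun s w hs h => absurd h.2.1 (not_lt.2 hs)
  have hQO : ¬volume Q < 2 * volume (Q ∩ O) := by
    rw [not_lt, hQV]
    calc 2 * volume (Q ∩ O) ≤ 2 * (1 / 4 * V) := by
          gcongr; exact (measure_mono inter_subset_right).trans hO
      _ = (2 * (1 / 4)) * V := by ring
      _ ≤ 1 * V := by
          gcongr
          rw [one_div, ← div_eq_mul_inv]
          exact ENNReal.div_le_of_le_mul (by norm_num)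
      _ = V := one_mul V
  have hpoint : ∀ x ∈ Q, ∀ s, a ≤ s → s ≤ b → ¬Bad s (gridIdx s x) →
      ∃ x' ∉ O, dist x x' ≤ 2 * √n * 2 ^ s := by
    intro x hx s has hsb hs
    have hcell : ¬volume (gridCell s (gridIdx s x)) < 2 * volume (gridCell s (gridIdx s x) ∩ O) := by
      rcases hsb.lt_or_eq with h | h
      · exact fun hlt => hs ⟨has, h, hlt⟩
      · rw [h, show gridIdx b x = v from hx]; exact hQO
    obtain ⟨x', hx', hx'O⟩ := exists_mem_notMem_of_volume_le
      (by rw [volume_gridCell]; exact ofReal_pow_ne_zero (by positivity))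
      (volume_gridCell_ne_top _ _) hcell
    exact ⟨x', hx'O, dist_le_of_gridIdx_eq (Eq.symm hx')⟩
  set E : Set (Rn n) := Q ∩ stopSet Bad with hE
  have hEm : MeasurableSet E := hQm.inter (measurableSet_stopSet Bad)
  set φ := stopIdx (n := n) Bad with hφ
  have hφm : Measurable φ := measurable_stopIdx Bad
  have hfib : ∀ x ∈ E, E ∩ φ ⁻¹' {φ x} = gridCell (stopScale Bad x) (gridIdx (stopScale Bad x) x) := by
    intro x hx
    rw [hE, inter_assoc, stopSet_inter_preimage hx.2]
    refine inter_eq_right.2 fun y hy => ?_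
    have hs := (isStop_stopScale hx.2).1.2.1
    exact (gridIdx_congr hs.le hy).trans hx.1
  -- pointwise domination
  have hpt : ∀ x ∈ Q, partialSq k f a b x * g x ≤
      c * g x + E.indicator (fun x => partialSq k f a (stopScale Bad x) x * g x) x := by
    intro x hx
    by_cases hxE : x ∈ E
    · have hst := isStop_stopScale hxE.2
      set s := stopScale Bad x with hs
      have hsb : s < b := hst.1.2.1
      have has : a ≤ s := hst.1.1
      -- The parent cell, of side 2^{s+1}, is not bad and so contains a point outside O; its
      -- diameter bound 2√n · 2^{s+1} = 4√n · 2^s is the source of the 4√n in `goodConst`.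
      obtain ⟨x', hx'O, hx'd⟩ := hpoint x hx (s + 1) (by omega) (by omega)
        (hst.2 (s + 1) (lt_add_one s))
      rw [indicator_of_mem hxE, ← add_mul, add_comm]
      gcongr
      refine (partialSq_le_add has hsb.le x).trans (add_le_add le_rfl ?_)
      refine hgood x hx x' hx'O s (hx'd.trans (le_of_eq ?_))
      rw [zpow_add_one₀ two_ne_zero]; ring
    · obtain ⟨x', hx'O, hx'd⟩ := hpoint x hx a le_rfl hab fun h => by
        obtain ⟨l, -, hl⟩ := exists_isStop hbadle h
        exact hxE ⟨hx, l, hl⟩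
      rw [indicator_of_notMem hxE, add_zero]
      gcongr
      refine hgood x hx x' hx'O a (hx'd.trans ?_)
      have : 0 ≤ √(n : ℝ) * 2 ^ a := by positivity
      linarith
  -- the contribution of the maximal cells
  have hmaximal : ∫⁻ x in E, partialSq k f a (stopScale Bad x) x * g x ≤
      sparseConst n m C γ L * ∫⁻ x in E, H x := by
    rw [Measure.restrict_congr_set (Filter.EventuallyEq.of_eq (eq_iUnion_fibre E φ)),
      lintegral_iUnion (measurableSet_fibre hEm hφm) (pairwise_disjoint_fibre E φ),
      lintegral_iUnion (measurableSet_fibre hEm hφm) (pairwise_disjoint_fibre E φ),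
      ← ENNReal.tsum_mul_left]
    refine ENNReal.tsum_le_tsum fun i => ?_
    by_cases hne : ∃ x ∈ E, φ x = i
    · obtain ⟨x, hxE, rfl⟩ := hne
      rw [hfib x hxE]
      have hst := isStop_stopScale hxE.2
      set s := stopScale Bad x with hs
      obtain ⟨d', hd'⟩ : ∃ d' : ℕ, s = a + d' := ⟨(s - a).toNat, by have := hst.1.1; omega⟩
      have := ih d' (by have := hst.1.2.1; omega) (gridIdx s x)
      rw [← hd'] at this
      refine le_of_eq_of_le (setLIntegral_congr_fun (measurableSet_gridCell _ _) fun y hy => ?_) this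
      rw [(hst.congr (Eq.symm hy)).stopScale_eq]
    · have : E ∩ φ ⁻¹' {i} = ∅ := by
        ext y
        simp only [mem_inter_iff, mem_preimage, mem_singleton_iff, mem_empty_iff_false, iff_false]
        exact fun hy => hne ⟨y, hy⟩
      simp [this]
  -- Each maximal cell has less than twice the measure of its part in O, and |O| ≤ V / 4; this fixes
  -- the fraction 1/4 in the weak bound.
  have hEV : volume E ≤ V / 2 := by
    have h1 : volume E ≤ 2 * volume (E ∩ O) := by
      have hr : volume (E ∩ O) = volume.restrict O E := (Measure.restrict_apply hEm).symm
      rw [hr]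
      conv_lhs => rw [eq_iUnion_fibre E φ]
      conv_rhs => rw [eq_iUnion_fibre E φ]
      rw [measure_iUnion (pairwise_disjoint_fibre E φ) (measurableSet_fibre hEm hφm),
        measure_iUnion (pairwise_disjoint_fibre E φ) (measurableSet_fibre hEm hφm),
        ← ENNReal.tsum_mul_left]
      refine ENNReal.tsum_le_tsum fun i => ?_
      rw [Measure.restrict_apply (measurableSet_fibre hEm hφm i)]
      by_cases hne : ∃ x ∈ E, φ x = i
      · obtain ⟨x, hxE, rfl⟩ := hne
        rw [hfib x hxE]
        exact (isStop_stopScale hxE.2).1.2.2.le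
      · have : E ∩ φ ⁻¹' {i} = ∅ := by
          ext y
          simp only [mem_inter_iff, mem_preimage, mem_singleton_iff, mem_empty_iff_false, iff_false]
          exact fun hy => hne ⟨y, hy⟩
        simp [this]
    calc volume E ≤ 2 * (1 / 4 * V) :=
          h1.trans (by gcongr; exact (measure_mono inter_subset_right).trans hO)
      _ = V / 2 := by
          have h4 : (2 : ℝ≥0∞) * (1 / 4) = 2⁻¹ := by
            rw [show (4 : ℝ≥0∞) = 2 * 2 by norm_num, one_div,
              ENNReal.mul_inv (by simp) (by simp), ← mul_assoc,
              ENNReal.mul_inv_cancel (by simp) (by simp), one_mul]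
          rw [← mul_assoc, h4, ENNReal.div_eq_inv_mul]
  have hdiff : V / 2 ≤ volume (Q \ E) := by
    rw [measure_sdiff inter_subset_left hEm.nullMeasurableSet
      ((measure_mono inter_subset_left).trans_lt (hQV ▸ hVt.lt_top)).ne, hQV]
    refine ENNReal.le_sub_of_add_le_left ((hEV.trans_lt (ENNReal.div_lt_top hVt (by simp))).ne) ?_
    calc volume E + V / 2 ≤ V / 2 + V / 2 := by gcongr
      _ = V := ENNReal.add_halves V
  -- the average over the cell
  have hHQ : ∀ x ∈ Q, (∏ j, A j) * ∫⁻ y in Q, g y ≤ κ ^ m * κ' * V * H x := by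
    intro x hx
    have hx : gridIdx b x = v := hx
    have h1 : ∀ j, A j ≤ κ * maxFn (fun z => ‖f j z‖ₑ) x := fun j => by
      have := setLIntegral_ball_gridPt_le (fun z => ‖f j z‖ₑ) b x
      rw [hx, ← hB, ← hκ, ← hV] at this
      refine (ENNReal.mul_le_mul_iff_left hV0 hVt).1 ?_
      rw [← hfA]
      exact this.trans_eq (mul_right_comm _ _ _)
    have h2 : ∫⁻ y in Q, g y ≤ κ' * V * maxFn g x := by
      have := setLIntegral_inter_le_maxFn g (b := b) (x := x)
      rwa [hx] at this
    calc _ ≤ (∏ j, (κ * maxFn (fun z => ‖f j z‖ₑ) x)) * (κ' * V * maxFn g x) := by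
          gcongr with j; exact h1 j
      _ = _ := by
          rw [Finset.prod_mul_distrib, Finset.prod_const, Finset.card_univ, Fintype.card_fin, hH]
          ring
  have hHt : κ ^ m * κ' * V ≠ ∞ := by finiteness
  -- The bound `hHQ` holds at every point of Q, so it may be averaged over Q \ E alone, whose
  -- measure is at least V / 2; this costs the factor 2.
  have havg : (∏ j, A j) * ∫⁻ y in Q, g y ≤ 2 * (κ ^ m * κ') * ∫⁻ x in Q \ E, H x := by
    have h1 : ((∏ j, A j) * ∫⁻ y in Q, g y) * (V / 2) ≤ κ ^ m * κ' * V * ∫⁻ x in Q \ E, H x := by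
      calc _ ≤ ((∏ j, A j) * ∫⁻ y in Q, g y) * volume (Q \ E) := by gcongr
        _ = ∫⁻ _x in Q \ E, ((∏ j, A j) * ∫⁻ y in Q, g y) := (setLIntegral_const _ _).symm
        _ ≤ ∫⁻ x in Q \ E, κ ^ m * κ' * V * H x :=
            setLIntegral_mono' (hQm.diff hEm) fun x hx => hHQ x hx.1
        _ = _ := lintegral_const_mul' _ _ hHt
    have hV2 : V / 2 ≠ 0 := by simp [hV0]
    have hV2t : V / 2 ≠ ∞ := ENNReal.div_ne_top hVt (by simp)
    refine (ENNReal.mul_le_mul_iff_left hV2 hV2t).1 (h1.trans (le_of_eq ?_))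
    calc _ = κ ^ m * κ' * (V / 2 + V / 2) * ∫⁻ x in Q \ E, H x := by rw [ENNReal.add_halves]
      _ = _ := by ring
  calc ∫⁻ x in Q, partialSq k f a b x * g x
      ≤ ∫⁻ x in Q, (c * g x + E.indicator (fun x => partialSq k f a (stopScale Bad x) x * g x) x) :=
        setLIntegral_mono' hQm hpt
    _ = c * (∫⁻ x in Q, g x) + ∫⁻ x in E, partialSq k f a (stopScale Bad x) x * g x := by
        rw [lintegral_add_left (hg.const_mul c), lintegral_const_mul _ hg, lintegral_indicator hEm,
          Measure.restrict_restrict hEm, inter_eq_left.2 (inter_subset_left : E ⊆ Q)]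
    _ ≤ goodConst n m C γ L * (2 * (κ ^ m * κ') * ∫⁻ x in Q \ E, H x) +
          sparseConst n m C γ L * ∫⁻ x in E, H x := by
        rw [hc, mul_assoc]
        gcongr
    -- The coefficient of the integral over Q \ E is exactly `sparseConst`, so the induction closes
    -- with the same constant.
    _ = sparseConst n m C γ L * ((∫⁻ x in Q \ E, H x) + ∫⁻ x in E, H x) := by
        rw [sparseConst, ← hκ, ← hκ']; ring
    _ = _ := by
        rw [add_comm, ← lintegral_inter_add_sdiff H Q hEm, inter_eq_right.2 (inter_subset_left : E ⊆ Q)]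

end Sparse

/-! ### L^p norms by duality. -/

section Duality

lemma lintegral_rpow_le_of_forall_lintegral_mul_le {X : Type*} [MeasurableSpace X] {μ : Measure X}
    [SigmaFinite μ] {p q : ℝ} (hpq : p.HolderConjugate q) {h : X → ℝ≥0∞} (hh : Measurable h)
    {B : ℝ≥0∞} (hB : ∀ g : X → ℝ≥0∞, Measurable g →
      ∫⁻ x, h x * g x ∂μ ≤ B * (∫⁻ x, g x ^ q ∂μ) ^ (1 / q)) :
    ∫⁻ x, h x ^ p ∂μ ≤ B ^ p := by
  have hp0 : 0 < p := hpq.pos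
  have hp1 : 0 < p - 1 := hpq.sub_one_pos
  -- Truncation in height and in space makes the integral of u^p finite, so that one may test
  -- against u^{p-1} and divide; monotone convergence removes it.
  set u : ℕ → X → ℝ≥0∞ := fun N => (spanningSets μ N).indicator fun x => min (h x) N with hu
  have hum : ∀ N, Measurable (u N) := fun N =>
    (hh.min measurable_const).indicator (measurableSet_spanningSets μ N)
  have huh : ∀ N x, u N x ≤ h x := fun N x =>
    indicator_apply_le' (fun _ => min_le_left _ _) fun _ => zero_le
  have hI : ∀ N, ∫⁻ x, u N x ^ p ∂μ ≤ B ^ p := by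
    intro N
    set I := ∫⁻ x, u N x ^ p ∂μ with hIdef
    have hIt : I ≠ ∞ := by
      refine ne_top_of_le_ne_top (b := (N : ℝ≥0∞) ^ p * μ (spanningSets μ N)) (by
        have := measure_spanningSets_lt_top μ N
        exact ENNReal.mul_ne_top (ENNReal.rpow_ne_top_of_nonneg hp0.le (by simp)) this.ne) ?_
      rw [← lintegral_indicator_const (measurableSet_spanningSets μ N)]
      refine lintegral_mono fun x => ?_
      by_cases hx : x ∈ spanningSets μ N
      · simp only [hu, indicator_of_mem hx]
        exact ENNReal.rpow_le_rpow (min_le_right _ _) hp0.le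
      · simp [hu, indicator_of_notMem hx, ENNReal.zero_rpow_of_pos hp0]
    by_cases hI0 : I = 0
    · rw [hI0]; exact zero_le
    have h1 : I ≤ B * I ^ (1 / q) := by
      have h2 := hB (fun x => u N x ^ (p - 1)) ((hum N).pow_const _)
      simp_rw [← ENNReal.rpow_mul, hpq.sub_one_mul_conj] at h2
      refine le_trans (lintegral_mono fun x => ?_) h2
      calc u N x ^ p = u N x * u N x ^ (p - 1) := by
            conv_lhs => rw [← add_sub_cancel 1 p,
              ENNReal.rpow_add_of_nonneg _ _ zero_le_one hp1.le, ENNReal.rpow_one]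
        _ ≤ _ := by gcongr; exact huh N x
    have hq0 : I ^ (1 / q) ≠ 0 :=
      (ENNReal.rpow_pos (pos_iff_ne_zero.2 hI0) hIt).ne'
    have hqt : I ^ (1 / q) ≠ ∞ := ENNReal.rpow_ne_top_of_nonneg (one_div_pos.2 hpq.symm.pos).le hIt
    have h3 : I ^ (1 / p) ≤ B := by
      refine (ENNReal.mul_le_mul_iff_left hq0 hqt).1 (le_of_eq_of_le ?_ h1)
      rw [← ENNReal.rpow_add _ _ hI0 hIt, one_div, one_div, hpq.inv_add_inv_eq_one,
        ENNReal.rpow_one]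
    calc I = (I ^ (1 / p)) ^ p := by
          rw [← ENNReal.rpow_mul, one_div_mul_cancel hp0.ne', ENNReal.rpow_one]
      _ ≤ B ^ p := ENNReal.rpow_le_rpow h3 hp0.le
  refine le_of_tendsto' (lintegral_tendsto_of_tendsto_of_monotone
    (fun N => ((hum N).pow_const p).aemeasurable) (Filter.Eventually.of_forall fun x => ?_)
    (Filter.Eventually.of_forall fun x => ?_)) hI
  · intro N N' hNN
    refine ENNReal.rpow_le_rpow ?_ hp0.le
    refine indicator_le_indicator_of_subset (monotone_spanningSets μ hNN) (fun _ => zero_le) x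
      |>.trans (indicator_le_indicator ?_)
    gcongr
  · refine (ENNReal.continuous_rpow_const.tendsto (h x)).comp ?_
    have h1 : Filter.Tendsto (fun N : ℕ => min (h x) (N : ℝ≥0∞)) Filter.atTop
        (nhds (min (h x) ∞)) := tendsto_const_nhds.min ENNReal.tendsto_nat_nhds_top
    rw [min_eq_left le_top] at h1
    refine h1.congr' ?_
    filter_upwards [Filter.eventually_ge_atTop (spanningSetsIndex μ x)] with N hN
    simp only [hu, indicator_of_mem (mem_spanningSets_of_index_le μ x hN)]

end Duality

/-! ### L^{p₁} × ⋯ × L^{pₘ} → L^p bounds for the square function. -/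

section StrongType

variable {n m : ℕ} {k : ℝ → (Fin m → Rn n) → ℂ} {C : ℝ≥0} {γ : ℝ} {f : Fin m → Rn n → ℂ}

lemma iUnion_gridCell (b : ℤ) : ⋃ v, gridCell (n := n) b v = univ := by
  ext x; simp [gridCell]

lemma pairwise_disjoint_gridCell (b : ℤ) :
    Pairwise (Function.onFun Disjoint (gridCell (n := n) b)) := fun _ _ hvw =>
  Set.disjoint_left.2 fun _ hx hx' => hvw (Eq.trans (Eq.symm hx) hx')

lemma lintegral_partialSq_mul_le [NeZero n] [NeZero m] (hk : IsAnnular k C γ) (hγ : 0 < γ)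
    {L : ℝ≥0} (hw : HasWeakBound k L (1 / 4)) (hf : ∀ i, Measurable (f i))
    (hl : ∀ i, LocallyIntegrable (f i)) {g : Rn n → ℝ≥0∞} (hg : Measurable g) (a : ℤ) (d : ℕ) :
    ∫⁻ x, partialSq k f a (a + d) x * g x ≤
      sparseConst n m C γ L * ∫⁻ x, (∏ i, maxFn (fun z => ‖f i z‖ₑ) x) * maxFn g x := by
  rw [← setLIntegral_univ, ← setLIntegral_univ (fun x => (∏ i, _) * _), ← iUnion_gridCell (a + d),
    lintegral_iUnion (measurableSet_gridCell _) (pairwise_disjoint_gridCell _),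
    lintegral_iUnion (measurableSet_gridCell _) (pairwise_disjoint_gridCell _),
    ← ENNReal.tsum_mul_left]
  exact ENNReal.tsum_le_tsum fun v => setLIntegral_partialSq_mul_le hk hγ hw hf hl hg a d v

lemma lintegral_prod_rpow_le {X ι : Type*} [MeasurableSpace X] {μ : Measure X} [Fintype ι]
    {h : ι → X → ℝ≥0∞} (hh : ∀ i, Measurable (h i)) {ps : ι → ℝ} {p : ℝ} (hps : ∀ i, 0 < ps i)
    (hp0 : 0 < p) (hp : 1 / p = ∑ i, 1 / ps i) :
    ∫⁻ x, (∏ i, h i x) ^ p ∂μ ≤ ∏ i, (∫⁻ x, h i x ^ ps i ∂μ) ^ (p / ps i) := by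
  have hsum : ∑ i, p / ps i = 1 := by
    simp_rw [div_eq_mul_one_div p]
    rw [← Finset.mul_sum, ← hp, mul_one_div_cancel hp0.ne']
  refine le_of_eq_of_le (lintegral_congr fun x => ?_) (ENNReal.lintegral_prod_norm_pow_le Finset.univ
    (f := fun i x => h i x ^ ps i) (fun i _ => ((hh i).pow_const _).aemeasurable) hsum
    fun i _ => (div_pos hp0 (hps i)).le)
  rw [← ENNReal.prod_rpow_of_nonneg hp0.le]
  refine Finset.prod_congr rfl fun i _ => ?_
  rw [← ENNReal.rpow_mul, mul_div_cancel₀ _ (hps i).ne']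

lemma tendsto_partialSq_rpow {p : ℝ} (x : Rn n) :
    Filter.Tendsto (fun N : ℕ => partialSq k f (-(N : ℤ)) (-(N : ℤ) + (2 * N : ℕ)) x ^ p)
      Filter.atTop (nhds (sqFn k f x ^ p)) := by
  refine (ENNReal.continuous_rpow_const.tendsto _).comp ?_
  have h1 : sqFn k f x = (∑' l : ℤ, blockNorm k f (2 ^ l) x ^ 2) ^ (1 / 2 : ℝ) := by
    rw [← sqFn_sq_eq_tsum, ennreal_sqrt_sq]
  rw [h1]
  refine (ENNReal.continuous_rpow_const.tendsto _).comp ?_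
  refine (ENNReal.summable.hasSum (f := fun l : ℤ => blockNorm k f (2 ^ l) x ^ 2)).comp
    (Filter.tendsto_atTop_finset_of_monotone ?_ fun l => ⟨l.natAbs + 1, ?_⟩)
  · intro N N' h
    exact Finset.Ico_subset_Ico (by omega) (by omega)
  · rw [Finset.mem_Ico]; omega

lemma partialSq_mono {a b a' b' : ℤ} (ha : a' ≤ a) (hb : b ≤ b') (x : Rn n) :
    partialSq k f a b x ≤ partialSq k f a' b' x :=
  ENNReal.rpow_le_rpow (Finset.sum_le_sum_of_subset (Finset.Ico_subset_Ico ha hb)) (by norm_num)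

/-- The sparse-type bound, Hölder for p and its conjugate, and the maximal theorem at each p_j and
at the conjugate exponent; p > 1 is what makes duality available. The bound is uniform in the range
of scales, which then exhausts ℤ. -/
theorem exists_lintegral_sqFn_rpow_le [NeZero n] [NeZero m] (hk : IsAnnular k C γ) (hγ : 0 < γ)
    {L : ℝ≥0} (hw : HasWeakBound k L (1 / 4)) {ps : Fin m → ℝ} {p : ℝ} (hps : ∀ j, 1 < ps j)
    (hp1 : 1 < p) (hp : 1 / p = ∑ j, 1 / ps j) :
    ∃ K : ℝ≥0, ∀ f : Fin m → Rn n → ℂ, (∀ i, Measurable (f i)) → (∀ i, LocallyIntegrable (f i)) →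
      ∫⁻ x, sqFn k f x ^ p ≤ K * ∏ j, (∫⁻ x, ‖f j x‖ₑ ^ ps j) ^ (p / ps j) := by
  have hp0 : 0 < p := one_pos.trans hp1
  have hps0 : ∀ j, 0 < ps j := fun j => one_pos.trans (hps j)
  have hpq := Real.HolderConjugate.conjExponent hp1
  set q := p.conjExponent with hq
  obtain ⟨C₀, hC₀⟩ := maxFn_strong (n := n) hpq.symm.lt
  choose c hc using fun j => maxFn_strong (n := n) (hps j)
  set S := sparseConst n m C γ L with hS
  have hSt : S ≠ ∞ := sparseConst_ne_top n m C hγ L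
  set K : ℝ≥0∞ := (S * (C₀ : ℝ≥0∞) ^ (1 / q)) ^ p * ∏ j, (c j : ℝ≥0∞) ^ (p / ps j) with hK
  have hKt : K ≠ ∞ := by
    refine ENNReal.mul_ne_top (ENNReal.rpow_ne_top_of_nonneg hp0.le (ENNReal.mul_ne_top hSt
      (ENNReal.rpow_ne_top_of_nonneg (one_div_pos.2 hpq.symm.pos).le ENNReal.coe_ne_top)))
      (ENNReal.prod_ne_top fun j _ => ENNReal.rpow_ne_top_of_nonneg (div_pos hp0 (hps0 j)).le
        ENNReal.coe_ne_top)
  refine ⟨K.toNNReal, fun f hf hl => ?_⟩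
  rw [ENNReal.coe_toNNReal hKt]
  set P : Rn n → ℝ≥0∞ := fun x => ∏ i, maxFn (fun z => ‖f i z‖ₑ) x with hP
  have hPm : Measurable P := Finset.measurable_fun_prod _ fun i _ => measurable_maxFn _
  have hPp : ∫⁻ x, P x ^ p ≤
      (∏ j, (c j : ℝ≥0∞) ^ (p / ps j)) * ∏ j, (∫⁻ x, ‖f j x‖ₑ ^ ps j) ^ (p / ps j) := by
    refine (lintegral_prod_rpow_le (fun i => measurable_maxFn _) hps0 hp0 hp).trans ?_
    rw [← Finset.prod_mul_distrib]
    refine Finset.prod_le_prod' fun j _ => ?_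
    rw [← ENNReal.mul_rpow_of_nonneg _ _ (div_pos hp0 (hps0 j)).le]
    exact ENNReal.rpow_le_rpow (hc j _ (hf j).enorm) (div_pos hp0 (hps0 j)).le
  have key : ∀ (a : ℤ) (d : ℕ), ∫⁻ x, partialSq k f a (a + d) x ^ p ≤
      K * ∏ j, (∫⁻ x, ‖f j x‖ₑ ^ ps j) ^ (p / ps j) := by
    intro a d
    refine (lintegral_rpow_le_of_forall_lintegral_mul_le hpq (measurable_partialSq hk hf _ _)
      (B := S * (C₀ : ℝ≥0∞) ^ (1 / q) * (∫⁻ x, P x ^ p) ^ (1 / p)) fun g hg => ?_).trans ?_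
    · calc _ ≤ S * ∫⁻ x, P x * maxFn g x := lintegral_partialSq_mul_le hk hγ hw hf hl hg a d
        _ ≤ S * ((∫⁻ x, P x ^ p) ^ (1 / p) * (∫⁻ x, maxFn g x ^ q) ^ (1 / q)) := by
            gcongr
            exact ENNReal.lintegral_mul_le_Lp_mul_Lq volume hpq hPm.aemeasurable
              (measurable_maxFn g).aemeasurable
        _ ≤ S * ((∫⁻ x, P x ^ p) ^ (1 / p) * (C₀ * ∫⁻ x, g x ^ q) ^ (1 / q)) := by
            gcongr
            · exact (one_div_pos.2 hpq.symm.pos).le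
            · exact hC₀ g hg
        _ = _ := by
            rw [ENNReal.mul_rpow_of_nonneg _ _ (one_div_pos.2 hpq.symm.pos).le]
            ring
    · rw [ENNReal.mul_rpow_of_nonneg _ _ hp0.le, ← ENNReal.rpow_mul, one_div_mul_cancel hp0.ne',
        ENNReal.rpow_one, hK, mul_assoc]
      gcongr
  refine le_of_tendsto' (lintegral_tendsto_of_tendsto_of_monotone
    (fun N : ℕ => ((measurable_partialSq hk hf (-(N : ℤ)) (-(N : ℤ) + (2 * N : ℕ))).pow_const
      p).aemeasurable) (Filter.Eventually.of_forall fun x => ?_)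
    (Filter.Eventually.of_forall fun x => tendsto_partialSq_rpow x)) fun N => key _ _
  intro N N' h
  exact ENNReal.rpow_le_rpow (partialSq_mono (by omega) (by omega) x) hp0.le

end StrongType

/-! ### L^p averages over balls and their relation to the Campanato norm. -/

section BallLp

variable {n : ℕ} {G : Type*} [NormedAddCommGroup G] [NormedSpace ℝ G]

/-- The `L^p` average over a ball. -/
def ballLp (p : ℝ) (h : Rn n → ℝ≥0∞) (c : Rn n) (r : ℝ) : ℝ≥0∞ :=
  ((volume (closedBall c r))⁻¹ * ∫⁻ x in closedBall c r, h x ^ p) ^ (1 / p)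

lemma volume_closedBall_ne_zero (c : Rn n) {r : ℝ} (hr : 0 < r) : volume (closedBall c r) ≠ 0 :=
  (measure_closedBall_pos volume c hr).ne'

lemma volume_closedBall_ne_top (c : Rn n) (r : ℝ) : volume (closedBall c r) ≠ ∞ :=
  measure_closedBall_lt_top.ne

lemma ballLp_mono_ae {p : ℝ} (hp : 0 < p) {g h : Rn n → ℝ≥0∞} {c : Rn n} {r : ℝ}
    (hgh : ∀ᵐ x ∂volume.restrict (closedBall c r), g x ≤ h x) : ballLp p g c r ≤ ballLp p h c r := by
  refine ENNReal.rpow_le_rpow (mul_le_mul_right (lintegral_mono_ae ?_) _) (by positivity)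
  filter_upwards [hgh] with x hx
  exact ENNReal.rpow_le_rpow hx hp.le

lemma ballLp_add_le {p : ℝ} (hp : 1 ≤ p) {g h : Rn n → ℝ≥0∞} (hg : Measurable g)
    (hh : Measurable h) (c : Rn n) (r : ℝ) :
    ballLp p (fun x => g x + h x) c r ≤ ballLp p g c r + ballLp p h c r := by
  have hp0 : 0 ≤ 1 / p := by positivity
  unfold ballLp
  rw [ENNReal.mul_rpow_of_nonneg _ _ hp0, ENNReal.mul_rpow_of_nonneg _ _ hp0,
    ENNReal.mul_rpow_of_nonneg _ _ hp0, ← mul_add]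
  exact mul_le_mul_right (ENNReal.lintegral_Lp_add_le hg.aemeasurable hh.aemeasurable hp) _

lemma ballLp_const {p : ℝ} (hp : 0 < p) (a : ℝ≥0∞) (c : Rn n) {r : ℝ} (hr : 0 < r) :
    ballLp p (fun _ => a) c r = a := by
  rw [ballLp, setLIntegral_const, mul_comm (a ^ p), ← mul_assoc,
    ENNReal.inv_mul_cancel (volume_closedBall_ne_zero c hr) (volume_closedBall_ne_top c r), one_mul,
    ← ENNReal.rpow_mul, mul_one_div_cancel hp.ne', ENNReal.rpow_one]

lemma ballLp_const_mul {p : ℝ} (hp : 0 < p) {a : ℝ≥0∞} (ha : a ≠ ∞) (h : Rn n → ℝ≥0∞) (c : Rn n)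
    (r : ℝ) : ballLp p (fun x => a * h x) c r = a * ballLp p h c r := by
  unfold ballLp
  simp_rw [ENNReal.mul_rpow_of_nonneg _ _ hp.le]
  rw [lintegral_const_mul' _ _ (ENNReal.rpow_ne_top_of_nonneg hp.le ha), mul_left_comm,
    ENNReal.mul_rpow_of_nonneg _ _ (by positivity), ← ENNReal.rpow_mul, mul_one_div_cancel hp.ne',
    ENNReal.rpow_one]

lemma average_le_ballLp {p : ℝ} (hp : 1 < p) {h : Rn n → ℝ≥0∞} (hh : AEMeasurable h) (c : Rn n)
    {r : ℝ} (hr : 0 < r) :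
    (volume (closedBall c r))⁻¹ * ∫⁻ x in closedBall c r, h x ≤ ballLp p h c r := by
  have hpq := Real.HolderConjugate.conjExponent hp
  set q := p.conjExponent
  set v := volume (closedBall c r) with hv
  have hv0 : v ≠ 0 := volume_closedBall_ne_zero c hr
  have hvt : v ≠ ∞ := volume_closedBall_ne_top c r
  have h1 := ENNReal.lintegral_mul_le_Lp_mul_Lq (volume.restrict (closedBall c r)) hpq
    hh.restrict (aemeasurable_const (b := (1 : ℝ≥0∞)))
  simp only [Pi.mul_apply, mul_one, ENNReal.one_rpow, setLIntegral_const, one_mul, ← hv] at h1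
  calc v⁻¹ * ∫⁻ x in closedBall c r, h x
      ≤ v⁻¹ * ((∫⁻ x in closedBall c r, h x ^ p) ^ (1 / p) * v ^ (1 / q)) := by gcongr
    _ = (v⁻¹ * v ^ (1 / q)) * (∫⁻ x in closedBall c r, h x ^ p) ^ (1 / p) := by ring
    _ = (v⁻¹) ^ (1 / p) * (∫⁻ x in closedBall c r, h x ^ p) ^ (1 / p) := by
        congr 1
        rw [ENNReal.inv_rpow, ← ENNReal.rpow_neg, ← ENNReal.rpow_neg_one v,
          ← ENNReal.rpow_add _ _ hv0 hvt]
        congr 1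
        have := hpq.inv_add_inv_eq_one
        rw [one_div, one_div]; linarith
    _ = _ := by rw [ballLp, ENNReal.mul_rpow_of_nonneg _ _ (one_div_pos.2 hpq.pos).le]

lemma ballAvg_le_ballLp {p : ℝ} (hp : 1 < p) {h : Rn n → ℝ≥0∞} (hh : AEMeasurable h) (c : Rn n)
    {r : ℝ} (hr : 0 < r) : ballAvg h c r ≤ unitVol n * ballLp p h c r := by
  refine le_trans (le_of_eq ?_) (mul_le_mul_right (average_le_ballLp hp hh c hr) _)
  rw [volume_closedBall_eq c hr.le, ENNReal.mul_inv (Or.inr unitVol_ne_top)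
    (Or.inr unitVol_ne_zero), ← mul_assoc, mul_left_comm,
    ENNReal.mul_inv_cancel unitVol_ne_zero unitVol_ne_top, mul_one, ballAvg]

lemma setLIntegral_rpow_eq_ballLp {p : ℝ} (hp : 0 < p) (h : Rn n → ℝ≥0∞) (c : Rn n) {r : ℝ}
    (hr : 0 < r) : ∫⁻ x in closedBall c r, h x ^ p =
      volume (closedBall c r) * ballLp p h c r ^ p := by
  rw [ballLp, ← ENNReal.rpow_mul, one_div_mul_cancel hp.ne', ENNReal.rpow_one, ← mul_assoc,
    ENNReal.mul_inv_cancel (volume_closedBall_ne_zero c hr) (volume_closedBall_ne_top c r), one_mul]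

lemma volume_closedBall_rpow [NeZero n] (c : Rn n) {r : ℝ} (hr : 0 < r) (α : ℝ) :
    volume (closedBall c r) ^ (α / n) = ENNReal.ofReal r ^ α * unitVol n ^ (α / n) := by
  have hn : (n : ℝ) ≠ 0 := by exact_mod_cast NeZero.ne n
  rw [volume_closedBall_eq c hr.le, ENNReal.mul_rpow_of_ne_zero (ofReal_pow_ne_zero hr)
    unitVol_ne_zero, ← ENNReal.rpow_natCast, ← ENNReal.rpow_mul, mul_div_cancel₀ _ hn]

lemma ballLp_le_campanatoNorm [NeZero n] (α p : ℝ) (f : Rn n → G) (c : Rn n) {r : ℝ} (hr : 0 < r) :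
    ballLp p (fun x => ‖f x - ⨍ z in closedBall c r, f z‖ₑ) c r ≤
      ENNReal.ofReal r ^ α * (unitVol n ^ (α / n) * campanatoNorm α p f) := by
  have hv0 := volume_closedBall_ne_zero c hr
  have hvt := volume_closedBall_ne_top c r
  have h1 : volume (closedBall c r) ^ (-(α / n)) *
      ballLp p (fun x => ‖f x - ⨍ z in closedBall c r, f z‖ₑ) c r ≤ campanatoNorm α p f :=
    le_iSup_of_le c (le_iSup_of_le r (le_iSup_of_le hr le_rfl))
  rw [← mul_assoc, ← volume_closedBall_rpow c hr]
  calc _ = volume (closedBall c r) ^ (α / n) * (volume (closedBall c r) ^ (-(α / n)) *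
        ballLp p (fun x => ‖f x - ⨍ z in closedBall c r, f z‖ₑ) c r) := by
        rw [← mul_assoc, ← ENNReal.rpow_add _ _ hv0 hvt, add_neg_cancel, ENNReal.rpow_zero, one_mul]
    _ ≤ _ := by gcongr

lemma campanatoNorm_le_of_ballLp_le [NeZero n] {α p : ℝ} {f : Rn n → G} {D : ℝ≥0∞}
    (h : ∀ (c : Rn n) (r : ℝ), 0 < r →
      ballLp p (fun x => ‖f x - ⨍ z in closedBall c r, f z‖ₑ) c r ≤ ENNReal.ofReal r ^ α * D) :
    campanatoNorm α p f ≤ unitVol n ^ (-(α / n)) * D := by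
  refine iSup_le fun c => iSup_le fun r => iSup_le fun hr => ?_
  have h1 := h c r hr
  have h0 : ENNReal.ofReal r ≠ 0 := by simpa using hr
  calc _ ≤ volume (closedBall c r) ^ (-(α / n)) * (ENNReal.ofReal r ^ α * D) :=
        mul_le_mul_right h1 _
    _ = (ENNReal.ofReal r ^ (-α) * ENNReal.ofReal r ^ α) * (unitVol n ^ (-(α / n)) * D) := by
        rw [← neg_div, volume_closedBall_rpow c hr]; ring
    _ = _ := by
        rw [← ENNReal.rpow_add _ _ h0 ENNReal.ofReal_ne_top, neg_add_cancel, ENNReal.rpow_zero,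
          one_mul]

lemma ennreal_prod_rpow {ι : Type*} {V : ℝ≥0∞} (h0 : V ≠ 0) (ht : V ≠ ∞) (r : ι → ℝ)
    (s : Finset ι) : ∏ i ∈ s, V ^ r i = V ^ ∑ i ∈ s, r i := by
  classical
  induction s using Finset.induction_on with
  | empty => simp
  | insert a s ha ih =>
    rw [Finset.sum_insert ha, Finset.prod_insert ha, ENNReal.rpow_add _ _ h0 ht, ih]

end BallLp

/-! ### The integral of t^{2α} dt/t over t > r. -/

section Tail

lemma setLIntegral_Ioi_rpow_le {α r : ℝ} (hα : α < 0) (hr : 0 < r) :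
    ∫⁻ t in Ioi r, (ENNReal.ofReal t ^ α) ^ 2 ∂logMeasure ≤
      (ENNReal.ofReal r ^ α) ^ 2 * ENNReal.ofReal (1 / (-(2 * α))) := by
  have h0 : Ioi r ⊆ Ioi 0 := Ioi_subset_Ioi hr.le
  have hexp : 2 * α - 1 < -1 := by linarith
  rw [setLIntegral_logMeasure _ measurableSet_Ioi h0]
  have e : ∫⁻ t in Ioi r, (ENNReal.ofReal t ^ α) ^ 2 / ENNReal.ofReal t =
      ∫⁻ t in Ioi r, ENNReal.ofReal (t ^ (2 * α - 1)) := by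
    refine setLIntegral_congr_fun measurableSet_Ioi fun t ht => ?_
    have ht : 0 < t := h0 ht
    rw [ENNReal.ofReal_rpow_of_pos ht, ← ENNReal.ofReal_pow (by positivity),
      ← ENNReal.ofReal_div_of_pos ht, Real.rpow_sub_one ht.ne', mul_comm 2 α,
      Real.rpow_mul ht.le]
    norm_cast
  rw [e, ← ofReal_integral_eq_lintegral_ofReal (integrableOn_Ioi_rpow_of_lt hexp hr),
    integral_Ioi_rpow_of_lt hexp hr, ENNReal.ofReal_rpow_of_pos hr,
    ← ENNReal.ofReal_pow (by positivity), ← ENNReal.ofReal_mul (by positivity)]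
  · refine ENNReal.ofReal_le_ofReal (le_of_eq ?_)
    have h2 : (r ^ α) ^ 2 = r ^ (2 * α) := by
      rw [mul_comm, Real.rpow_mul hr.le]; norm_cast
    rw [h2, sub_add_cancel]
    field_simp
  · filter_upwards [ae_restrict_mem measurableSet_Ioi] with t ht
    have ht : 0 < t := h0 ht
    simp only [Pi.zero_apply]; positivity

end Tail

/-! ### Growth of the square function of a Campanato tuple on balls. -/

section CampanatoEstimate

variable {n m : ℕ} {k : ℝ → (Fin m → Rn n) → ℂ} {C : ℝ≥0} {γ : ℝ} {f : Fin m → Rn n → ℂ}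

/-- The product of the normalised Campanato norms. -/
def campanatoProd (αs ps : Fin m → ℝ) (f : Fin m → Rn n → ℂ) : ℝ≥0∞ :=
  ∏ i, (unitVol n ^ (αs i / n) * campanatoNorm (αs i) (ps i) (f i))

lemma prod_ballLp_le [NeZero n] {αs ps : Fin m → ℝ} (f : Fin m → Rn n → ℂ) (c : Rn n) {r : ℝ}
    (hr : 0 < r) :
    ∏ i, ballLp (ps i) (fun x => ‖f i x - ⨍ z in closedBall c r, f i z‖ₑ) c r ≤
      ENNReal.ofReal r ^ (∑ i, αs i) * campanatoProd αs ps f := by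
  rw [campanatoProd, ← ennreal_prod_rpow (by simpa using hr) ENNReal.ofReal_ne_top,
    ← Finset.prod_mul_distrib]
  exact Finset.prod_le_prod' fun i _ => ballLp_le_campanatoNorm _ _ _ _ hr

/-- Subtract from each f_i its average over B(x,t), the ball that T_t sees; what is left is the mean
oscillation, of size t^{α_i}, and the exponents add up. -/
lemma enorm_annOp_le_campanato [NeZero n] (hk : IsAnnular k C γ) (hf : ∀ i, Measurable (f i))
    (hl : ∀ i, LocallyIntegrable (f i)) {αs ps : Fin m → ℝ} (hps : ∀ i, 1 < ps i) {t : ℝ}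
    (ht : 0 < t) (x : Rn n) : ‖annOp k f t x‖ₑ ≤
      ENNReal.ofReal t ^ (∑ i, αs i) * (C * unitVol n ^ m * campanatoProd αs ps f) := by
  rw [annOp_sub_const hk hf hl (fun i => ⨍ z in closedBall x t, f i z) ht]
  refine (enorm_annOp_le hk (fun i => (hf i).sub measurable_const) ht x).trans ?_
  calc _ ≤ C * ∏ i, (unitVol n *
        ballLp (ps i) (fun y => ‖f i y - ⨍ z in closedBall x t, f i z‖ₑ) x t) := by
        gcongr with i
        exact ballAvg_le_ballLp (hps i) ((hf i).sub measurable_const).enorm.aemeasurable x ht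
    _ ≤ C * (unitVol n ^ m * (ENNReal.ofReal t ^ (∑ i, αs i) * campanatoProd αs ps f)) := by
        rw [Finset.prod_mul_distrib, Finset.prod_const, Finset.card_univ, Fintype.card_fin]
        gcongr
        exact prod_ballLp_le f x ht
    _ = _ := by ring

/-- The square function is split at t = r. For t ≤ r and x in B(c,r), T_t sees only B(c,2r), and one
fixed family of constants, the averages over that ball, is subtracted. For t > r the constants vary
with t and x, and t^{2α} is integrable for dt/t since α < 0. -/
lemma sqFn_le_local_add [NeZero n] (hk : IsAnnular k C γ) (hf : ∀ i, Measurable (f i))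
    (hl : ∀ i, LocallyIntegrable (f i)) {αs ps : Fin m → ℝ} (hps : ∀ i, 1 < ps i)
    (hα : ∑ i, αs i < 0) {c x : Rn n} {r : ℝ} (hr : 0 < r) (hx : x ∈ closedBall c r) :
    sqFn k f x ≤ sqFn k (fun i => (closedBall c (2 * r)).indicator fun z =>
        f i z - ⨍ w in closedBall c (2 * r), f i w) x +
      ENNReal.ofReal r ^ (∑ i, αs i) * (ENNReal.ofReal (1 / (-(2 * ∑ i, αs i))) ^ (1 / 2 : ℝ) *
        (C * unitVol n ^ m * campanatoProd αs ps f)) := by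
  set α := ∑ i, αs i with hαdef
  set D := C * unitVol n ^ m * campanatoProd αs ps f with hD
  set h : Fin m → Rn n → ℂ := fun i => (closedBall c (2 * r)).indicator fun z =>
    f i z - ⨍ w in closedBall c (2 * r), f i w with hh
  have hnear : ∫⁻ t in Iic r, ‖annOp k f t x‖ₑ ^ 2 ∂logMeasure ≤ sqFn k h x ^ 2 := by
    rw [sqFn, ennreal_sq_sqrt]
    refine le_trans (lintegral_mono_ae ?_) (setLIntegral_le_lintegral (Iic r) _)
    filter_upwards [ae_restrict_mem measurableSet_Iic, ae_restrict_of_ae ae_logMeasure_pos]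
      with t htr ht
    rw [annOp_sub_const hk hf hl (fun i => ⨍ w in closedBall c (2 * r), f i w) ht,
      annOp_congr hk (g := h) ht.le]
    intro i z hz
    have hzB : z ∈ closedBall c (2 * r) := by
      rw [mem_closedBall] at hz hx ⊢
      linarith [dist_triangle z x c, mem_Iic.1 htr]
    simp only [hh, indicator_of_mem hzB]
  have hfar : ∫⁻ t in (Iic r)ᶜ, ‖annOp k f t x‖ₑ ^ 2 ∂logMeasure ≤
      (ENNReal.ofReal r ^ α * (ENNReal.ofReal (1 / (-(2 * α))) ^ (1 / 2 : ℝ) * D)) ^ 2 := by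
    rw [compl_Iic]
    calc _ ≤ ∫⁻ t in Ioi r, D ^ 2 * (ENNReal.ofReal t ^ α) ^ 2 ∂logMeasure := by
          refine setLIntegral_mono' measurableSet_Ioi fun t ht => ?_
          rw [← mul_pow, mul_comm]
          gcongr
          exact enorm_annOp_le_campanato hk hf hl hps (hr.trans ht) x
      _ = D ^ 2 * ∫⁻ t in Ioi r, (ENNReal.ofReal t ^ α) ^ 2 ∂logMeasure :=
          lintegral_const_mul _ ((ENNReal.measurable_ofReal.pow_const α).pow_const 2)
      _ ≤ D ^ 2 * ((ENNReal.ofReal r ^ α) ^ 2 * ENNReal.ofReal (1 / (-(2 * α)))) := by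
          gcongr
          exact setLIntegral_Ioi_rpow_le hα hr
      _ = _ := by
          rw [mul_pow (ENNReal.ofReal r ^ α), mul_pow _ D, ennreal_sq_sqrt]; ring
  set W := ENNReal.ofReal r ^ α * (ENNReal.ofReal (1 / (-(2 * α))) ^ (1 / 2 : ℝ) * D) with hW
  refine ennreal_sqrt_le ?_
  rw [← lintegral_add_compl _ measurableSet_Iic (A := Iic r)]
  calc _ ≤ sqFn k h x ^ 2 + W ^ 2 := add_le_add hnear hfar
    _ ≤ sqFn k h x ^ 2 + W ^ 2 + 2 * sqFn k h x * W := le_self_add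
    _ = _ := by ring

/-- The local part is controlled by the global L^p bound, the tail pointwise. The estimate is for
the size of the square function and not only for its oscillation. -/
theorem exists_ballLp_sqFn_le [NeZero n] [NeZero m] (hk : IsAnnular k C γ) (hγ : 0 < γ)
    {L : ℝ≥0} (hw : HasWeakBound k L (1 / 4)) {αs ps : Fin m → ℝ} {p : ℝ} (hps : ∀ j, 1 < ps j)
    (hp1 : 1 < p) (hp : 1 / p = ∑ j, 1 / ps j) (hα : ∑ j, αs j < 0) :
    ∃ K : ℝ≥0, ∀ f : Fin m → Rn n → ℂ, (∀ i, Measurable (f i)) → (∀ i, LocallyIntegrable (f i)) →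
      ∀ (c : Rn n) (r : ℝ), 0 < r → ballLp p (sqFn k f) c r ≤
        ENNReal.ofReal r ^ (∑ j, αs j) * (K * ∏ j, campanatoNorm (αs j) (ps j) (f j)) := by
  have hp0 : 0 < p := one_pos.trans hp1
  have hps0 : ∀ j, 0 < ps j := fun j => one_pos.trans (hps j)
  obtain ⟨K, hK⟩ := exists_lintegral_sqFn_rpow_le hk hγ hw hps hp1 hp
  set α := ∑ j, αs j with hαdef
  set U : ℝ≥0∞ := ∏ i, unitVol n ^ (αs i / n) with hU
  have hUt : U ≠ ∞ := ENNReal.prod_ne_top fun i _ =>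
    ENNReal.rpow_ne_top_of_ne_zero unitVol_ne_zero unitVol_ne_top
  -- 2ⁿ is the ratio of the volumes of B(c,2r) and B(c,r), and 2^α comes from (2r)^α.
  set K₁ : ℝ≥0∞ := (K * 2 ^ n) ^ (1 / p) * 2 ^ α with hK1
  set K₂ : ℝ≥0∞ := ENNReal.ofReal (1 / (-(2 * α))) ^ (1 / 2 : ℝ) * (C * unitVol n ^ m) with hK2
  have hK1t : K₁ ≠ ∞ := ENNReal.mul_ne_top
    (ENNReal.rpow_ne_top_of_nonneg (by positivity) (by finiteness))
    (ENNReal.rpow_ne_top_of_ne_zero (by simp) (by simp))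
  have hK2t : K₂ ≠ ∞ := by
    have := unitVol_ne_top (n := n)
    exact ENNReal.mul_ne_top (ENNReal.rpow_ne_top_of_nonneg (by norm_num) ENNReal.ofReal_ne_top)
      (by finiteness)
  have hKt : (K₁ + K₂) * U ≠ ∞ := by finiteness
  refine ⟨((K₁ + K₂) * U).toNNReal, fun f hf hl c r hr => ?_⟩
  rw [ENNReal.coe_toNNReal hKt]
  have hprod : campanatoProd αs ps f = U * ∏ j, campanatoNorm (αs j) (ps j) (f j) := by
    rw [campanatoProd, Finset.prod_mul_distrib]
  set B := closedBall c (2 * r) with hB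
  set h : Fin m → Rn n → ℂ := fun i => B.indicator fun z => f i z - ⨍ w in B, f i w with hh
  have hhm : ∀ i, Measurable (h i) := fun i =>
    ((hf i).sub measurable_const).indicator measurableSet_closedBall
  have hhl : ∀ i, LocallyIntegrable (h i) := fun i =>
    (((hl i).integrableOn_isCompact (isCompact_closedBall _ _)).sub
      (integrableOn_const measure_closedBall_lt_top.ne)).integrable_indicator
        measurableSet_closedBall |>.locallyIntegrable
  have h2r : 0 < 2 * r := by positivity
  have hlocal : ballLp p (sqFn k h) c r ≤ ENNReal.ofReal r ^ α * (K₁ * campanatoProd αs ps f) := by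
    have h1 : ∀ j, (∫⁻ x, ‖h j x‖ₑ ^ ps j) ^ (p / ps j) = volume B ^ (p / ps j) *
        ballLp (ps j) (fun x => ‖f j x - ⨍ z in B, f j z‖ₑ) c (2 * r) ^ p := fun j => by
      have e : ∫⁻ x, ‖h j x‖ₑ ^ ps j = ∫⁻ x in B, ‖f j x - ⨍ z in B, f j z‖ₑ ^ ps j := by
        rw [← lintegral_indicator measurableSet_closedBall]
        refine lintegral_congr fun x => ?_
        by_cases hx : x ∈ B
        · simp only [hh, indicator_of_mem hx, indicator_of_mem (show x ∈ closedBall c (2 * r) from hx)]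
        · simp only [hh, indicator_of_notMem hx, enorm_zero, ENNReal.zero_rpow_of_pos (hps0 j),
            indicator_of_notMem (show x ∉ closedBall c (2 * r) from hx)]
      rw [e, setLIntegral_rpow_eq_ballLp (hps0 j) _ c h2r,
        ENNReal.mul_rpow_of_nonneg _ _ (div_pos hp0 (hps0 j)).le, ← ENNReal.rpow_mul _ (ps j),
        mul_div_cancel₀ _ (hps0 j).ne']
    have hsum : ∑ i, p / ps i = 1 := by
      simp_rw [div_eq_mul_one_div p]
      rw [← Finset.mul_sum, ← hp, mul_one_div_cancel hp0.ne']
    have h2 : ∫⁻ x in closedBall c r, sqFn k h x ^ p ≤ K * (volume B *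
        (ENNReal.ofReal (2 * r) ^ α * campanatoProd αs ps f) ^ p) := by
      refine (setLIntegral_le_lintegral _ _).trans ((hK h hhm hhl).trans ?_)
      simp_rw [h1]
      rw [Finset.prod_mul_distrib, ennreal_prod_rpow (volume_closedBall_ne_zero c h2r)
        (volume_closedBall_ne_top c _), hsum, ENNReal.rpow_one, ENNReal.prod_rpow_of_nonneg hp0.le]
      gcongr
      exact prod_ballLp_le f c h2r
    have hvB : (volume (closedBall c r))⁻¹ * volume B = 2 ^ n := by
      rw [hB, volume_closedBall_eq c h2r.le, ENNReal.ofReal_mul two_pos.le, mul_pow, mul_assoc,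
        ← volume_closedBall_eq c hr.le, mul_left_comm,
        ENNReal.inv_mul_cancel (volume_closedBall_ne_zero c hr) (volume_closedBall_ne_top c r),
        ENNReal.ofReal_ofNat, mul_one]
    calc ballLp p (sqFn k h) c r ≤ ((volume (closedBall c r))⁻¹ * (K * (volume B *
          (ENNReal.ofReal (2 * r) ^ α * campanatoProd αs ps f) ^ p))) ^ (1 / p) := by
          unfold ballLp; gcongr
      _ = (K * 2 ^ n * (ENNReal.ofReal (2 * r) ^ α * campanatoProd αs ps f) ^ p) ^ (1 / p) := by
          rw [← hvB]; congr 1; ring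
      _ = (K * 2 ^ n) ^ (1 / p) * (ENNReal.ofReal (2 * r) ^ α * campanatoProd αs ps f) := by
          rw [ENNReal.mul_rpow_of_nonneg _ _ (by positivity), ← ENNReal.rpow_mul,
            mul_one_div_cancel hp0.ne', ENNReal.rpow_one]
      _ = _ := by
          rw [ENNReal.ofReal_mul two_pos.le, ENNReal.ofReal_ofNat,
            ENNReal.mul_rpow_of_ne_zero (x := 2) (by simp) (by simpa using hr), hK1]
          ring
  calc ballLp p (sqFn k f) c r ≤ ballLp p (fun x => sqFn k h x +
        ENNReal.ofReal r ^ α * (K₂ * campanatoProd αs ps f)) c r := by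
        refine ballLp_mono_ae hp0 ?_
        filter_upwards [ae_restrict_mem measurableSet_closedBall] with x hx
        refine (sqFn_le_local_add hk hf hl hps hα hr hx).trans (le_of_eq ?_)
        rw [hK2, mul_assoc (ENNReal.ofReal (1 / (-(2 * α))) ^ (1 / 2 : ℝ))]
    _ ≤ ballLp p (sqFn k h) c r + ballLp p (fun _ =>
          ENNReal.ofReal r ^ α * (K₂ * campanatoProd αs ps f)) c r :=
        ballLp_add_le hp1.le (measurable_sqFn hk hhm) measurable_const c r
    _ ≤ ENNReal.ofReal r ^ α * (K₁ * campanatoProd αs ps f) +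
          ENNReal.ofReal r ^ α * (K₂ * campanatoProd αs ps f) := by
        rw [ballLp_const hp0 _ c hr]; gcongr
    _ = _ := by rw [hprod]; ring

end CampanatoEstimate

/-! ### Independence of the choice of representatives. -/

section Congruence

variable {n m : ℕ} {Ω : (Fin m → Rn n) → ℂ} {f g : Fin m → Rn n → ℂ}

/-- Valid for every x: the map y ↦ x - y_i pulls null sets back to null sets. Changing the f_j on
null sets therefore leaves μ(f) unchanged at every point. -/
lemma integrand_congr_ae (h : ∀ j, f j =ᵐ[volume] g j) (x : Rn n) :
    integrand Ω f x =ᵐ[volume] integrand Ω g x := by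
  have h1 : ∀ i, ∀ᵐ y : Fin m → Rn n, f i (x - y i) = g i (x - y i) := fun i =>
    (((Measure.measurePreserving_sub_left volume x).quasiMeasurePreserving.comp
      (Measure.quasiMeasurePreserving_eval (fun _ : Fin m => (volume : Measure (Rn n))) i)).ae
        (h i) :)
  filter_upwards [Filter.eventually_all.2 h1] with y hy
  unfold integrand
  rw [Finset.prod_congr rfl fun i _ => hy i]

lemma marcinkiewicz_congr_ae (h : ∀ j, f j =ᵐ[volume] g j) :
    marcinkiewicz Ω f = marcinkiewicz Ω g := by
  funext x
  have hF : ∀ t, F Ω t f x = F Ω t g x := fun t => by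
    unfold F
    rw [integral_congr_ae (ae_restrict_of_ae (integrand_congr_ae h x))]
  simp only [marcinkiewicz, hF]

lemma campanatoNorm_congr_ae {G : Type*} [NormedAddCommGroup G] [NormedSpace ℝ G] {α p : ℝ}
    {f g : Rn n → G} (h : f =ᵐ[volume] g) : campanatoNorm α p f = campanatoNorm α p g := by
  unfold campanatoNorm
  refine iSup_congr fun c => iSup_congr fun r => iSup_congr fun _ => ?_
  rw [average_congr (ae_restrict_of_ae h)]
  congr 3
  refine lintegral_congr_ae (ae_restrict_of_ae ?_)
  filter_upwards [h] with x hx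
  rw [hx]

end Congruence

/-! ### From L^p averages to the Campanato bound for μ. -/

section Final

variable {n m : ℕ} {Ω : (Fin m → Rn n) → ℂ} {C : ℝ≥0} {γ : ℝ}

lemma ballLp_sub_average_le {G : Type*} [NormedAddCommGroup G] [NormedSpace ℝ G] {p : ℝ}
    (hp : 1 < p) {h : Rn n → G} (hh : Measurable fun x => ‖h x‖ₑ) (c : Rn n) {r : ℝ} (hr : 0 < r) :
    ballLp p (fun x => ‖h x - ⨍ z in closedBall c r, h z‖ₑ) c r ≤
      2 * ballLp p (fun x => ‖h x‖ₑ) c r := by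
  have hp0 : 0 < p := one_pos.trans hp
  have hv0 := volume_closedBall_ne_zero c hr
  have hvt := volume_closedBall_ne_top c r
  have havg : ‖⨍ z in closedBall c r, h z‖ₑ ≤ ballLp p (fun x => ‖h x‖ₑ) c r := by
    refine le_trans ?_ (average_le_ballLp hp hh.aemeasurable c hr)
    rw [← ENNReal.div_eq_inv_mul, ENNReal.le_div_iff_mul_le (Or.inl hv0) (Or.inl hvt)]
    exact enorm_setAverage_mul_le _ hvt
  calc _ ≤ ballLp p (fun x => ‖h x‖ₑ + ‖⨍ z in closedBall c r, h z‖ₑ) c r :=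
        ballLp_mono_ae hp0 (Filter.Eventually.of_forall fun x => enorm_sub_le)
    _ ≤ ballLp p (fun x => ‖h x‖ₑ) c r + ballLp p (fun _ => ‖⨍ z in closedBall c r, h z‖ₑ) c r :=
        ballLp_add_le hp.le hh measurable_const c r
    _ ≤ _ := by rw [ballLp_const hp0 _ c hr, two_mul]; gcongr

lemma ae_lt_top_of_ballLp_ne_top {p : ℝ} (hp : 0 < p) {h : Rn n → ℝ≥0∞} (hh : Measurable h)
    (hfin : ∀ (c : Rn n) (r : ℝ), 0 < r → ballLp p h c r ≠ ∞) : ∀ᵐ x, h x < ∞ := by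
  have hball : ∀ N : ℕ, ∀ᵐ x, x ∈ closedBall (0 : Rn n) (N + 1) → h x < ∞ := fun N => by
    have hN : (0 : ℝ) < N + 1 := by positivity
    rw [← ae_restrict_iff' measurableSet_closedBall]
    have h1 : ∫⁻ x in closedBall (0 : Rn n) (N + 1), h x ^ p ≠ ∞ := by
      rw [setLIntegral_rpow_eq_ballLp hp h 0 hN]
      exact ENNReal.mul_ne_top (volume_closedBall_ne_top _ _)
        (ENNReal.rpow_ne_top_of_nonneg hp.le (hfin 0 _ hN))
    filter_upwards [ae_lt_top (hh.pow_const p) h1] with x hx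
    exact (ENNReal.rpow_lt_top_iff_of_pos hp).1 hx
  filter_upwards [ae_all_iff.2 hball] with x hx
  obtain ⟨N, hN⟩ := exists_nat_ge ‖x‖
  exact hx N (by rw [mem_closedBall, dist_zero_right]; linarith)

lemma locallyIntegrable_toReal_of_ballLp_ne_top {p : ℝ} (hp : 1 < p) {h : Rn n → ℝ≥0∞}
    (hh : Measurable h) (hfin : ∀ (c : Rn n) (r : ℝ), 0 < r → ballLp p h c r ≠ ∞) :
    LocallyIntegrable (fun x => (h x).toReal) := by
  intro x
  refine ⟨closedBall x 1, closedBall_mem_nhds x one_pos,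
    hh.ennreal_toReal.aestronglyMeasurable, ?_⟩
  have hv0 := volume_closedBall_ne_zero x one_pos
  have hvt := volume_closedBall_ne_top x 1
  have h1 := (average_le_ballLp hp hh.aemeasurable x one_pos).trans_lt (hfin x 1 one_pos).lt_top
  have h2 : ∫⁻ z in closedBall x 1, h z < ∞ := by
    rw [← one_mul (∫⁻ z in closedBall x 1, h z), ← ENNReal.mul_inv_cancel hv0 hvt, mul_assoc]
    exact ENNReal.mul_lt_top hvt.lt_top h1
  refine lt_of_le_of_lt (lintegral_mono fun z => ?_) h2
  rw [Real.enorm_of_nonneg ENNReal.toReal_nonneg]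
  exact ENNReal.ofReal_toReal_le

theorem exists_campanato_bound [NeZero n] [NeZero m] (hΩ : Measurable Ω)
    (hk : IsAnnular (annularKernel Ω) C γ) (hγ : 0 < γ) {L : ℝ≥0}
    (hw : HasWeakBound (annularKernel Ω) L (1 / 4)) {αs ps : Fin m → ℝ} {p : ℝ}
    (hps : ∀ j, 1 < ps j) (hp1 : 1 < p) (hp : 1 / p = ∑ j, 1 / ps j) (hα : ∑ j, αs j < 0) :
    ∃ K : ℝ≥0, ∀ f : Fin m → Rn n → ℂ, (∀ j, Measurable (f j)) →
      (∀ j, MemCampanato (αs j) (ps j) (f j)) →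
      (∀ᵐ x, ∀ t : ℝ, 0 < t → IntegrableOn (integrand Ω f x) (ballPow n m t)) ∧
      (∀ᵐ x, marcinkiewicz Ω f x < ∞) ∧
      LocallyIntegrable (fun x => (marcinkiewicz Ω f x).toReal) ∧
      campanatoNorm (∑ j, αs j) p (fun x => (marcinkiewicz Ω f x).toReal) ≤
        K * ∏ j, campanatoNorm (αs j) (ps j) (f j) := by
  have hp0 : 0 < p := one_pos.trans hp1
  obtain ⟨K, hK⟩ := exists_ballLp_sqFn_le hk hγ hw hps hp1 hp hα
  set α := ∑ j, αs j with hαdef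
  -- One factor 2 comes from μ ≤ 2S, the other from bounding the oscillation by twice the size; the
  -- power of `unitVol n` passes from r^α to |B|^{α/n}.
  set K' : ℝ≥0∞ := unitVol n ^ (-(α / n)) * (2 * (2 * K)) with hK'
  have hK't : K' ≠ ∞ := ENNReal.mul_ne_top
    (ENNReal.rpow_ne_top_of_ne_zero unitVol_ne_zero unitVol_ne_top) (by finiteness)
  refine ⟨K'.toNNReal, fun f hf hC => ?_⟩
  rw [ENNReal.coe_toNNReal hK't]
  have hl : ∀ j, LocallyIntegrable (f j) := fun j => (hC j).1
  set N := ∏ j, campanatoNorm (αs j) (ps j) (f j) with hN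
  have hNt : N ≠ ∞ := ENNReal.prod_ne_top fun j _ => (hC j).2.ne
  have hint : ∀ᵐ x, ∀ t : ℝ, 0 < t → IntegrableOn (integrand Ω f x) (ballPow n m t) := by
    filter_upwards [ae_all_iff.2 fun j => ae_locBdd (hl j)] with x hx t ht
    exact integrableOn_integrand hΩ hk hf hx ht
  have hμm := measurable_marcinkiewicz hΩ hf
  have hμ : ∀ (c : Rn n) (r : ℝ), 0 < r →
      ballLp p (marcinkiewicz Ω f) c r ≤ ENNReal.ofReal r ^ α * (2 * K * N) := by
    intro c r hr
    calc _ ≤ ballLp p (fun x => 2 * sqFn (annularKernel Ω) f x) c r := by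
          refine ballLp_mono_ae hp0 (ae_restrict_of_ae ?_)
          filter_upwards [hint] with x hx
          exact marcinkiewicz_le_sqFn hk hf hx
      _ = 2 * ballLp p (sqFn (annularKernel Ω) f) c r := ballLp_const_mul hp0 (by simp) _ c r
      _ ≤ 2 * (ENNReal.ofReal r ^ α * (K * N)) := by gcongr; exact hK f hf hl c r hr
      _ = _ := by ring
  have hfin : ∀ (c : Rn n) (r : ℝ), 0 < r → ballLp p (marcinkiewicz Ω f) c r ≠ ∞ :=
    fun c r hr => ne_top_of_le_ne_top (ENNReal.mul_ne_top
      (ENNReal.rpow_ne_top_of_ne_zero (by simpa using hr) ENNReal.ofReal_ne_top)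
      (ENNReal.mul_ne_top (by finiteness) hNt)) (hμ c r hr)
  refine ⟨hint, ae_lt_top_of_ballLp_ne_top hp0 hμm hfin,
    locallyIntegrable_toReal_of_ballLp_ne_top hp1 hμm hfin, ?_⟩
  refine (campanatoNorm_le_of_ballLp_le (D := 2 * (2 * K * N)) fun c r hr => ?_).trans
    (le_of_eq ?_)
  · refine (ballLp_sub_average_le hp1 hμm.ennreal_toReal.enorm c hr).trans ?_
    calc _ ≤ 2 * ballLp p (marcinkiewicz Ω f) c r := by
          gcongr
          refine ballLp_mono_ae hp0 (Filter.Eventually.of_forall fun z => ?_)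
          rw [Real.enorm_of_nonneg ENNReal.toReal_nonneg]
          exact ENNReal.ofReal_toReal_le
      _ ≤ 2 * (ENNReal.ofReal r ^ α * (2 * K * N)) := by gcongr; exact hμ c r hr
      _ = _ := by ring
  · rw [hK']; ring

end Final

end MultilinearMarcinkiewicz

end

theorem theorem1p2 (n m : ℕ) (hn : 1 ≤ n) (hm : 1 ≤ m)
    (Ω : (Fin m → MultilinearMarcinkiewicz.Rn n) → ℂ) (β : ℝ) (hβ0 : 0 < β) (hβ1 : β < 1)
    (hΩ : MultilinearMarcinkiewicz.IsKernel Ω β)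
    (qs : Fin m → ℝ) (q : ℝ) (hqs : ∀ i, 1 < qs i) (hq : 1 / q = ∑ i, 1 / qs i)
    (hbdd : MultilinearMarcinkiewicz.IsBoundedOnLp Ω qs q)
    (ps : Fin m → ℝ) (p : ℝ) (hps : ∀ j, 1 < ps j) (hp : 1 / p = ∑ j, 1 / ps j)
    (αs : Fin m → ℝ) (α : ℝ) (hα : α = ∑ j, αs j) (hα0 : α < 0)
    (hαs : ∀ j, -(n / ps j) ≤ αs j ∧ αs j < 1)
    (hcase : ((∀ j, αs j < 0) ∧ (n : ℝ) < p) ∨ (-(m : ℝ) < α ∧ 1 < p)) :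
    ∃ C : ℝ≥0, ∀ f : Fin m → MultilinearMarcinkiewicz.Rn n → ℂ,
      (∀ j, MultilinearMarcinkiewicz.MemCampanato (αs j) (ps j) (f j)) →
      -- the integrals defining `μ(f)(x)` converge absolutely for almost every `x`
      (∀ᵐ x, ∀ t : ℝ, 0 < t →
        IntegrableOn (MultilinearMarcinkiewicz.integrand Ω f x)
          (MultilinearMarcinkiewicz.ballPow n m t) volume) ∧
      -- `μ(f)` is infinite everywhere, or finite almost everywhere with the norm bound
      ((∀ x, MultilinearMarcinkiewicz.marcinkiewicz Ω f x = ∞) ∨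
        ((∀ᵐ x, MultilinearMarcinkiewicz.marcinkiewicz Ω f x < ∞) ∧
          MultilinearMarcinkiewicz.MemCampanato α p
            (fun x => (MultilinearMarcinkiewicz.marcinkiewicz Ω f x).toReal) ∧
          MultilinearMarcinkiewicz.campanatoNorm α p
            (fun x => (MultilinearMarcinkiewicz.marcinkiewicz Ω f x).toReal)
            ≤ C * ∏ j, MultilinearMarcinkiewicz.campanatoNorm (αs j) (ps j) (f j))) := by
  have : NeZero n := ⟨by omega⟩
  have : NeZero m := ⟨by omega⟩
  -- Both alternatives force p > 1, the range in which the duality argument works.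
  have hp1 : 1 < p := by
    rcases hcase with ⟨-, h⟩ | ⟨-, h⟩
    · have : (1 : ℝ) ≤ n := by exact_mod_cast hn
      linarith
    · exact h
  have hΩm := hΩ.measurable hβ0
  obtain ⟨C₀, hk⟩ := MultilinearMarcinkiewicz.exists_isAnnular hΩ hβ0 hβ1
  obtain ⟨L, hw⟩ := MultilinearMarcinkiewicz.exists_volume_sqFn_le hΩm hk (half_pos hβ0) hqs hq hbdd
    (show (1 / 4 : ℝ≥0∞) ≠ 0 by simp)
  subst hα
  obtain ⟨K, hK⟩ :=
    MultilinearMarcinkiewicz.exists_campanato_bound hΩm hk (half_pos hβ0) hw hps hp1 hp hα0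
  refine ⟨K, fun f hf => ?_⟩
  have hae : ∀ j, AEStronglyMeasurable (f j) := fun j => (hf j).1.aestronglyMeasurable
  -- The f_j are only almost everywhere equal to measurable functions, while the estimates above are
  -- for measurable ones.
  set g : Fin m → MultilinearMarcinkiewicz.Rn n → ℂ := fun j => (hae j).mk with hg
  have hfg : ∀ j, f j =ᵐ[volume] g j := fun j => (hae j).ae_eq_mk
  have hnorm : ∀ j, MultilinearMarcinkiewicz.campanatoNorm (αs j) (ps j) (f j) =
      MultilinearMarcinkiewicz.campanatoNorm (αs j) (ps j) (g j) := fun j =>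
    MultilinearMarcinkiewicz.campanatoNorm_congr_ae (hfg j)
  obtain ⟨h1, h2, h3, h4⟩ := hK g (fun j => (hae j).stronglyMeasurable_mk.measurable)
    fun j => ⟨(hf j).1.congr (hfg j), hnorm j ▸ (hf j).2⟩
  simp only [MultilinearMarcinkiewicz.marcinkiewicz_congr_ae (Ω := Ω) hfg, hnorm]
  -- The second alternative always holds: μ(f) has finite L^p averages on all balls.
  refine ⟨?_, Or.inr ⟨h2, ⟨h3, h4.trans_lt (ENNReal.mul_lt_top ENNReal.coe_lt_top
    (ENNReal.prod_lt_top fun j _ => ?_))⟩, h4⟩⟩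
  · filter_upwards [h1] with x hx t ht
    exact (hx t ht).congr_fun_ae (ae_restrict_of_ae
      (MultilinearMarcinkiewicz.integrand_congr_ae hfg x).symm)
  · rw [← hnorm j]; exact (hf j).2
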